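/- Let $M$ be a finite-dimensional smooth Riemannian manifold (without boundary) with metric $\langle\cdot,\cdot\rangle$, norm $\|\cdot\|$, Levi-Civita connection $\nabla$ and curvature tensor $\mathcal R(X,Y)=\nabla_X\nabla_Y-\nabla_Y\nabla_X-\nabla_{[X,Y]}$. For a smooth curve $\gamma:[0,1]\to M$ let $P_\gamma^{t_1,t_2}:T_{\gamma(t_1)}M\to T_{\gamma(t_2)}M$ denote parallel transport along $\gamma$. Let $\mathcal M=\mathrm{Imm}([0,1],M)$ be the space of smooth curves $c:[0,1]\to M$ with $c'(t)\neq 0$ for all $t\in[0,1]$, with the Riemannian metric $$G_c(h,k)=\langle h(0),k(0)\rangle+\int_0^1\Big(\langle\nabla_\ell h^N,\nabla_\ell k^N\rangle+\tfrac14\langle\nabla_\ell h^T,\nabla_\ell k^T\rangle\Big)\|c'(t)\|\,dt$$ for smooth vector fields $h,k$ along $c$, where $v=c'/\|c'\|$, $\nabla_\ell h=\nabla_{c'}h/\|c'\|$, $\nabla_\ell h^T=\langle\nabla_\ell h,v\rangle v$ and $\nabla_\ell h^N=\nabla_\ell h-\nabla_\ell h^T$. For $c_0,c_1\in\mathcal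 M$, a path from $c_0$ to $c_1$ is a smooth map $c:[0,1]\times[0,1]\to M$, $(s,t)\mapsto c(s,t)$, with $c(s,\cdot)\in\mathcal M$ for all $s$, $c(0,\cdot)=c_0$ and $c(1,\cdot)=c_1$; write $c_s,c_t$ for its partial derivatives and $\nabla_s,\nabla_t$ for covariant derivatives in the directions $c_s,c_t$. Let $d(c_0,c_1)\in[0,\infty]$ be the geodesic distance induced by $G$, that is, the infimum over all paths from $c_0$ to $c_1$ of $\int_0^1\sqrt{G_{c(s,\cdot)}(c_s(s,\cdot),c_s(s,\cdot))}\,ds$ (the infimum is $\infty$ if there is no path). For a path $c$ put $$q(s,t)=\frac{c_t(s,t)}{\sqrt{\|c_t(s,t)\|}},\qquad \tilde q(s,t)=P_{c(\cdot,0)}^{s,0}\circ P_{c(s,\cdot)}^{t,0}\big(q(s,t)\big)\in T_{c_0(0)}M,$$ $$\omega^{s,t}(a,\tau)=P_{c(a,\cdot)}^{0,\tau}\circ P_{c(\cdot,0)}^{s,a}\circ P_{c(s,\cdot)}^{t,0}\big(q(s,t)\big)\in T_{c(a,\tau)}M,\qquad \Omega(s,t)=P_{c(\cdot,0)}^{s,0}\circ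 P_{c(s,\cdot)}^{t,0}\big(\nabla_a\omega^{s,t}(s,t)\big)\in T_{c_0(0)}M .$$ Then for all $c_0,c_1\in\mathcal M$, with infima over all paths $c$ from $c_0$ to $c_1$, $$d(c_0,c_1)=\inf_{c}\int_0^1\sqrt{\|c_s(s,0)\|^2+\int_0^1\|\nabla_sq(s,t)\|^2\,dt}\;ds=\inf_{c}\int_0^1\sqrt{\|c_s(s,0)\|^2+\int_0^1\|\tilde q_s(s,t)+\Omega(s,t)\|^2\,dt}\;ds .$$ Moreover, for every such path all the parallel transports, derivatives and integrals above are well defined, and for all $s,t\in[0,1]$ $$\Omega(s,t)=P_{c(\cdot,0)}^{s,0}\left(\int_0^tP_{c(s,\cdot)}^{\tau,0}\Big(\mathcal R\big(c_\tau(s,\tau),c_s(s,\tau)\big)P_{c(s,\cdot)}^{t,\tau}q(s,t)\Big)\,d\tau\right).$$ -/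

import Mathlib

open Set MeasureTheory
open scoped Manifold ContDiff ENNReal

noncomputable section

namespace CurveSpace

variable {E : Type*} [NormedAddCommGroup E] [NormedSpace ℝ E]
  {M : Type*} [TopologicalSpace M] [ChartedSpace E M] [IsManifold 𝓘(ℝ, E) ∞ M]

variable (E M) in
/-- A smooth Riemannian metric on `M`. -/
abbrev RMetric : Type _ :=
  Bundle.ContMDiffRiemannianMetric 𝓘(ℝ, E) ∞ E (fun x : M => TangentSpace 𝓘(ℝ, E) x)

/-- The norm of a tangent vector for the Riemannian metric. -/
def gnorm (g : RMetric E M) {x : M} (v : TangentSpace 𝓘(ℝ, E) x) : ℝ := √(g.inner x v v)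

/-! ### Levi-Civita connection and curvature, in charts -/

/-- The Riemannian metric read in the chart at `x₀`: the bilinear form `g_y(u, v)` on `E` at the
point of `M` whose coordinate is `y`. -/
def chartMetric (g : RMetric E M) (x₀ : M) (y : E) : E →L[ℝ] E →L[ℝ] ℝ :=
  let p : M := (extChartAt 𝓘(ℝ, E) x₀).symm y
  let A : E →L[ℝ] E := tangentCoordChange 𝓘(ℝ, E) x₀ p p
  let B : E →L[ℝ] E →L[ℝ] ℝ := g.inner p
  B.bilinearComp A A

/-- The Christoffel symbols `Γ_y(u, v)` of the Levi-Civita connection in the chart at `x₀`, that is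
`2 g_y(Γ_y(u, v), z) = D_u g(v, z) + D_v g(u, z) - D_z g(u, v)` for all `z`. -/
def christoffel (g : RMetric E M) (x₀ : M) (y u v : E) : E :=
  let Dg : E →L[ℝ] E →L[ℝ] E →L[ℝ] ℝ := fderiv ℝ (chartMetric g x₀) y
  (1 / 2 : ℝ) • (chartMetric g x₀ y).inverse (Dg u v + Dg v u - (Dg.flip u).flip v)

/-- The Riemann curvature tensor `𝓡(u, v) w` at `x`, with the convention
`𝓡(X, Y) = ∇_X ∇_Y - ∇_Y ∇_X - ∇_{[X, Y]}`, computed in the chart at `x`. -/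
def curvature (g : RMetric E M) (x : M) (u v w : TangentSpace 𝓘(ℝ, E) x) :
    TangentSpace 𝓘(ℝ, E) x :=
  let curv (u v w : E) : E :=
    let y₀ : E := extChartAt 𝓘(ℝ, E) x x
    let Γ : E → E → E → E := christoffel g x
    fderiv ℝ (fun y => Γ y v w) y₀ u - fderiv ℝ (fun y => Γ y u w) y₀ v
      + Γ y₀ u (Γ y₀ v w) - Γ y₀ v (Γ y₀ u w)
  curv u v w

/-! ### Curves on `[0, 1]`, covariant derivative and parallel transport along them

A curve on `[0, 1]` is a function on `ℝ` of which only the restriction to `[0, 1]` is used; its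
derivatives are taken within `[0, 1]`. -/

/-- The velocity `γ'(t) ∈ T_{γ(t)} M`. -/
def velocity (γ : ℝ → M) (t : ℝ) : TangentSpace 𝓘(ℝ, E) (γ t) :=
  mfderivWithin 𝓘(ℝ, ℝ) 𝓘(ℝ, E) γ (Icc 0 1) t (1 : ℝ)

/-- A vector field `V` along `γ`, read in the chart at `x₀`. -/
def fieldCoord (γ : ℝ → M) (V : ∀ t, TangentSpace 𝓘(ℝ, E) (γ t)) (x₀ : M) (t : ℝ) : E :=
  (trivializationAt E (TangentSpace 𝓘(ℝ, E) : M → Type _) x₀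
    (⟨γ t, V t⟩ : TangentBundle 𝓘(ℝ, E) M)).2

/-- The vector field `V` along `γ` is differentiable at `t`. -/
def FieldDifferentiableAt (γ : ℝ → M) (V : ∀ t, TangentSpace 𝓘(ℝ, E) (γ t)) (t : ℝ) : Prop :=
  MDifferentiableWithinAt 𝓘(ℝ, ℝ) 𝓘(ℝ, E).tangent
    (fun τ => (⟨γ τ, V τ⟩ : TangentBundle 𝓘(ℝ, E) M)) (Icc 0 1) t

/-- The covariant derivative `∇_{γ'} V` at time `t` of a vector field `V` along `γ`, for the
Levi-Civita connection: `(V^k)' + Γ^k_{ij} (γ^i)' V^j` in the chart at `γ t`. -/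
def covDeriv (g : RMetric E M) (γ : ℝ → M) (V : ∀ t, TangentSpace 𝓘(ℝ, E) (γ t)) (t : ℝ) :
    TangentSpace 𝓘(ℝ, E) (γ t) :=
  (derivWithin (fieldCoord γ V (γ t)) (Icc 0 1) t
    + christoffel g (γ t) (extChartAt 𝓘(ℝ, E) (γ t) (γ t)) (velocity γ t : E) (V t : E) : E)

/-- `V` is a parallel vector field along `γ` on `[0, 1]`. -/
def IsParallel (g : RMetric E M) (γ : ℝ → M) (V : ∀ t, TangentSpace 𝓘(ℝ, E) (γ t)) : Prop :=
  ∀ t ∈ Icc (0 : ℝ) 1, FieldDifferentiableAt γ V t ∧ covDeriv g γ V t = 0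

open Classical in
/-- The parallel transport `P_γ^{t₁, t₂} : T_{γ(t₁)} M → T_{γ(t₂)} M`: the value at `t₂` of the
parallel vector field along `γ` that takes the value `u` at `t₁`. -/
def transport (g : RMetric E M) (γ : ℝ → M) (t₁ t₂ : ℝ) (u : TangentSpace 𝓘(ℝ, E) (γ t₁)) :
    TangentSpace 𝓘(ℝ, E) (γ t₂) :=
  if h : ∃ V : ∀ t, TangentSpace 𝓘(ℝ, E) (γ t), IsParallel g γ V ∧ V t₁ = u then
    h.choose t₂
  else 0

/-- Along `γ`, parallel vector fields exist and are unique on `[0, 1]` for every initial value, so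
that all parallel transports along `γ` are well defined. -/
def HasTransport (g : RMetric E M) (γ : ℝ → M) : Prop :=
  ∀ t₁ ∈ Icc (0 : ℝ) 1,
    (∀ u : TangentSpace 𝓘(ℝ, E) (γ t₁), ∃ V : ∀ t, TangentSpace 𝓘(ℝ, E) (γ t),
      IsParallel g γ V ∧ V t₁ = u) ∧
    (∀ V W : ∀ t, TangentSpace 𝓘(ℝ, E) (γ t), IsParallel g γ V → IsParallel g γ W →
      V t₁ = W t₁ → ∀ t ∈ Icc (0 : ℝ) 1, V t = W t)

/-! ### The space of immersions and its metric -/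

/-- `c` is a smooth immersion `[0, 1] → M`. -/
def IsImm (c : ℝ → M) : Prop :=
  ContMDiffOn 𝓘(ℝ, ℝ) 𝓘(ℝ, E) ∞ c (Icc 0 1) ∧
    ∀ t ∈ Icc (0 : ℝ) 1, velocity (E := E) c t ≠ 0

/-- The unit speed vector field `c' / ‖c'‖`. -/
def unitSpeed (g : RMetric E M) (c : ℝ → M) (t : ℝ) : TangentSpace 𝓘(ℝ, E) (c t) :=
  (gnorm g (velocity c t))⁻¹ • velocity c t

/-- The covariant derivative according to arc length `∇_ℓ h = ∇_{c'} h / ‖c'‖`. -/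
def covArc (g : RMetric E M) (c : ℝ → M) (h : ∀ t, TangentSpace 𝓘(ℝ, E) (c t)) (t : ℝ) :
    TangentSpace 𝓘(ℝ, E) (c t) :=
  (gnorm g (velocity c t))⁻¹ • covDeriv g c h t

/-- The tangential component `∇_ℓ h^T = ⟨∇_ℓ h, v⟩ v`, where `v = c' / ‖c'‖`. -/
def covArcT (g : RMetric E M) (c : ℝ → M) (h : ∀ t, TangentSpace 𝓘(ℝ, E) (c t)) (t : ℝ) :
    TangentSpace 𝓘(ℝ, E) (c t) :=
  g.inner (c t) (covArc g c h t) (unitSpeed g c t) • unitSpeed g c t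

/-- The normal component `∇_ℓ h^N = ∇_ℓ h - ∇_ℓ h^T`. -/
def covArcN (g : RMetric E M) (c : ℝ → M) (h : ∀ t, TangentSpace 𝓘(ℝ, E) (c t)) (t : ℝ) :
    TangentSpace 𝓘(ℝ, E) (c t) :=
  covArc g c h t - covArcT g c h t

/-- The integrand `(⟨∇_ℓ h^N, ∇_ℓ k^N⟩ + ⟨∇_ℓ h^T, ∇_ℓ k^T⟩ / 4) ‖c'‖` of the Sobolev metric. -/
def sobolevIntegrand (g : RMetric E M) (c : ℝ → M) (h k : ∀ t, TangentSpace 𝓘(ℝ, E) (c t))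
    (t : ℝ) : ℝ :=
  (g.inner (c t) (covArcN g c h t) (covArcN g c k t)
    + 1 / 4 * g.inner (c t) (covArcT g c h t) (covArcT g c k t)) * gnorm g (velocity c t)

/-- The first-order Sobolev metric `G_c(h, k)` on the space of immersions. -/
def sobolevMetric (g : RMetric E M) (c : ℝ → M) (h k : ∀ t, TangentSpace 𝓘(ℝ, E) (c t)) : ℝ :=
  g.inner (c 0) (h 0) (k 0) + ∫ t in (0 : ℝ)..1, sobolevIntegrand g c h k t

/-- `c` is a smooth path `s ↦ c(s, ·)` of immersions, `s ∈ [0, 1]`, that joins `c₀` to `c₁`. -/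
structure IsPath (c₀ c₁ : ℝ → M) (c : ℝ → ℝ → M) : Prop where
  smooth : ContMDiffOn 𝓘(ℝ, ℝ × ℝ) 𝓘(ℝ, E) ∞ (fun z : ℝ × ℝ => c z.1 z.2) (Icc 0 1 ×ˢ Icc 0 1)
  imm : ∀ s ∈ Icc (0 : ℝ) 1, IsImm (E := E) (c s)
  source : ∀ t ∈ Icc (0 : ℝ) 1, c 0 t = c₀ t
  target : ∀ t ∈ Icc (0 : ℝ) 1, c 1 t = c₁ t

/-- The derivative `c_s(s, t)`. -/
def derivS (c : ℝ → ℝ → M) (s t : ℝ) : TangentSpace 𝓘(ℝ, E) (c s t) :=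
  velocity (fun σ => c σ t) s

/-- The derivative `c_t(s, t)`. -/
def derivT (c : ℝ → ℝ → M) (s t : ℝ) : TangentSpace 𝓘(ℝ, E) (c s t) :=
  velocity (c s) t

/-- The length of a path of immersions for the Riemannian metric `G`. -/
def pathLength (g : RMetric E M) (c : ℝ → ℝ → M) : ℝ :=
  ∫ s in (0 : ℝ)..1, √(sobolevMetric g (c s) (derivS c s) (derivS c s))

/-- The geodesic distance induced by `G`: the infimum of the lengths of the paths of immersions
that join the two curves (`∞` if there is none). -/
def geodesicDist (g : RMetric E M) (c₀ c₁ : ℝ → M) : ℝ≥0∞ :=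
  ⨅ (c : ℝ → ℝ → M) (_ : IsPath (E := E) c₀ c₁ c), ENNReal.ofReal (pathLength g c)

/-! ### Square root velocity representation, raising, holonomy -/

/-- The square root velocity function `R(c) = c' / √‖c'‖`. -/
def srvf (g : RMetric E M) (c : ℝ → M) (t : ℝ) : TangentSpace 𝓘(ℝ, E) (c t) :=
  (√(gnorm g (velocity c t)))⁻¹ • velocity c t

/-- The covariant derivative `∇_s q(s, t)`, where `q(s, ·) = R(c(s, ·))`. -/
def covSrvf (g : RMetric E M) (c : ℝ → ℝ → M) (s t : ℝ) : TangentSpace 𝓘(ℝ, E) (c s t) :=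
  covDeriv g (fun σ => c σ t) (fun σ => srvf g (c σ) t) s

/-- Transport of `u ∈ T_{c(s, t)} M` along `c(s, ·)` to its origin, then along `c(·, 0)` to
`T_{c(0, 0)} M`. -/
def transportToOrigin (g : RMetric E M) (c : ℝ → ℝ → M) (s t : ℝ)
    (u : TangentSpace 𝓘(ℝ, E) (c s t)) : TangentSpace 𝓘(ℝ, E) (c 0 0) :=
  transport g (fun σ => c σ 0) s 0 (transport g (c s) t 0 u)

/-- The raising `q̃(s, t)` of `q` in the tangent space `T_{c(0, 0)} M`. -/
def raising (g : RMetric E M) (c : ℝ → ℝ → M) (s t : ℝ) : TangentSpace 𝓘(ℝ, E) (c 0 0) :=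
  transportToOrigin g c s t (srvf g (c s) t)

/-- The derivative `q̃_s(s, t)`, in the fixed vector space `T_{c(0, 0)} M = E`. -/
def raisingS (g : RMetric E M) (c : ℝ → ℝ → M) (s t : ℝ) : TangentSpace 𝓘(ℝ, E) (c 0 0) :=
  derivWithin (fun σ => (raising g c σ t : E)) (Icc 0 1) s

/-- The vector field `ω^{s, t}(a, τ)`, which transports `q(s, t)` along `c(s, ·)` to its origin,
then along `c(·, 0)` to `c(a, 0)`, then along `c(a, ·)` to `c(a, τ)`. -/
def omegaField (g : RMetric E M) (c : ℝ → ℝ → M) (s t a τ : ℝ) : TangentSpace 𝓘(ℝ, E) (c a τ) :=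
  transport g (c a) 0 τ
    (transport g (fun σ => c σ 0) s a (transport g (c s) t 0 (srvf g (c s) t)))

/-- The holonomy term `Ω(s, t)`: the transport of `∇_a ω^{s, t}(s, t)` to `T_{c(0, 0)} M`. -/
def holonomy (g : RMetric E M) (c : ℝ → ℝ → M) (s t : ℝ) : TangentSpace 𝓘(ℝ, E) (c 0 0) :=
  transportToOrigin g c s t
    (covDeriv g (fun a => c a t) (fun a => omegaField g c s t a t) s)

/-- The vector `P_{c(s, ·)}^{τ, 0} (𝓡(c_τ, c_s) P_{c(s, ·)}^{t, τ} q(s, t))`, at the point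
`(s, τ)` of the surface, as an element of `T_{c(s, 0)} M = E`. -/
def curvatureIntegrand (g : RMetric E M) (c : ℝ → ℝ → M) (s t τ : ℝ) : E :=
  transport g (c s) τ 0
    (curvature g (c s τ) (derivT c s τ) (derivS c s τ) (transport g (c s) t τ (srvf g (c s) t)))

/-- The speed in `s`, written with `∇_s q`. -/
def speedSrvf (g : RMetric E M) (c : ℝ → ℝ → M) (s : ℝ) : ℝ :=
  √(gnorm g (derivS c s 0) ^ 2 + ∫ t in (0 : ℝ)..1, gnorm g (covSrvf g c s t) ^ 2)

/-- The speed in `s`, written with `q̃_s + Ω`. -/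
def speedRaising (g : RMetric E M) (c : ℝ → ℝ → M) (s : ℝ) : ℝ :=
  √(gnorm g (derivS c s 0) ^ 2 +
    ∫ t in (0 : ℝ)..1, gnorm g (raisingS g c s t + holonomy g c s t) ^ 2)

/-- All the objects attached to a path of curves are well defined: the parallel transports, the
derivatives `∇_t c_s`, `∇_s q`, `q̃_s` and `∇_a ω`, and the integrals. -/
structure WellDefined (g : RMetric E M) (c : ℝ → ℝ → M) : Prop where
  transport_curve : ∀ s ∈ Icc (0 : ℝ) 1, HasTransport g (c s)
  transport_origin : HasTransport g (fun s => c s 0)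
  derivS_diff : ∀ s ∈ Icc (0 : ℝ) 1, ∀ t ∈ Icc (0 : ℝ) 1,
    FieldDifferentiableAt (E := E) (c s) (derivS c s) t
  srvf_diff : ∀ s ∈ Icc (0 : ℝ) 1, ∀ t ∈ Icc (0 : ℝ) 1,
    FieldDifferentiableAt (fun σ => c σ t) (fun σ => srvf g (c σ) t) s
  raising_diff : ∀ s ∈ Icc (0 : ℝ) 1, ∀ t ∈ Icc (0 : ℝ) 1,
    DifferentiableWithinAt ℝ (fun σ => (raising g c σ t : E)) (Icc 0 1) s
  omega_diff : ∀ s ∈ Icc (0 : ℝ) 1, ∀ t ∈ Icc (0 : ℝ) 1,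
    FieldDifferentiableAt (fun a => c a t) (fun a => omegaField g c s t a t) s
  sobolev_int : ∀ s ∈ Icc (0 : ℝ) 1,
    IntervalIntegrable (sobolevIntegrand g (c s) (derivS c s) (derivS c s)) volume 0 1
  length_int : IntervalIntegrable
    (fun s => √(sobolevMetric g (c s) (derivS c s) (derivS c s))) volume 0 1
  srvf_int : ∀ s ∈ Icc (0 : ℝ) 1,
    IntervalIntegrable (fun t => gnorm g (covSrvf g c s t) ^ 2) volume 0 1
  raising_int : ∀ s ∈ Icc (0 : ℝ) 1, IntervalIntegrable
    (fun t => gnorm g (raisingS g c s t + holonomy g c s t) ^ 2) volume 0 1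
  curvature_int : ∀ s ∈ Icc (0 : ℝ) 1, ∀ t ∈ Icc (0 : ℝ) 1,
    IntervalIntegrable (curvatureIntegrand g c s t) volume 0 t
  speedSrvf_int : IntervalIntegrable (speedSrvf g c) volume 0 1
  speedRaising_int : IntervalIntegrable (speedRaising g c) volume 0 1

end CurveSpace

end

/-!
The three speeds agree for every path `c`, so the infima do. Torsion-freeness gives
`∇_s c_t = ∇_t c_s`; differentiating `q = c_t / √‖c_t‖` then turns `‖∇_s q‖²` into the integrand of
the metric `G`, the factor `1 / 4` coming from the derivative of the square root along `c_t`. In a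
transported frame the Leibniz rule shows that `q̃_s + Ω` is the image of `∇_s q` under transport to
the origin, which is an isometry. Finally `ω` is parallel in `τ` and, along `τ = 0`, in `a`: since
`∇_τ ∇_a ω - ∇_a ∇_τ ω = 𝓡(c_τ, c_a) ω`, the field `∇_a ω` solves `∇_τ X = 𝓡(c_τ, c_a) ω`, `X = 0`
at `τ = 0`, which integrates to the formula for `Ω`.
-/

noncomputable section

set_option maxSynthPendingDepth 3

open Filter Topology

namespace CurveSpace

/-! ### Linear differential equations on short intervals -/

section LinearODE

variable {F : Type*} [NormedAddCommGroup F] [NormedSpace ℝ F]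

theorem hasDerivWithinAt_continuousMap_of_apply {X : Type*} [TopologicalSpace X] [CompactSpace X]
    {A : Set ℝ} {s : ℝ} {f f' : ℝ → C(X, F)} (hA : Convex ℝ A) (hs : s ∈ A)
    (hf : ∀ a ∈ A, ∀ x, HasDerivWithinAt (fun b => f b x) (f' a x) A a)
    (hf' : ContinuousWithinAt f' A s) : HasDerivWithinAt f (f' s) A s := by
  rw [hasDerivWithinAt_iff_isLittleO, Asymptotics.isLittleO_iff]
  intro ε hε
  obtain ⟨δ, hδ, hf'δ⟩ := Metric.mem_nhdsWithin_iff.1 (hf' (Metric.closedBall_mem_nhds _ hε))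
  filter_upwards [self_mem_nhdsWithin, mem_nhdsWithin_of_mem_nhds (Metric.ball_mem_nhds s hδ)]
    with a ha haδ
  refine (ContinuousMap.norm_le _ (by positivity)).2 fun x => ?_
  have hderiv : ∀ b ∈ A ∩ Metric.ball s δ, HasDerivWithinAt (fun b => f b x - (b - s) • f' s x)
      (f' b x - f' s x) (A ∩ Metric.ball s δ) b := fun b hb => by
    have h := ((hasDerivWithinAt_id b A).sub_const s).smul_const (f' s x)
    rw [one_smul] at h
    exact ((hf b hb.1 x).sub h).mono inter_subset_left
  have hbound : ∀ b ∈ A ∩ Metric.ball s δ, ‖f' b x - f' s x‖ ≤ ε := fun b hb => by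
    rw [← dist_eq_norm]
    exact (ContinuousMap.dist_apply_le_dist x).trans (hf'δ ⟨hb.2, hb.1⟩)
  have h := Convex.norm_image_sub_le_of_norm_hasDerivWithin_le hderiv hbound
    (hA.inter (convex_ball _ _)) ⟨hs, Metric.mem_ball_self hδ⟩ ⟨ha, haδ⟩
  rw [sub_self, zero_smul, sub_zero] at h
  simpa only [ContinuousMap.sub_apply, ContinuousMap.smul_apply, sub_right_comm] using h

/-- The pointwise application of a continuous family of linear maps to a continuous function, as a
bounded bilinear map of Banach spaces. -/
def applyL (X F : Type*) [TopologicalSpace X] [CompactSpace X] [NormedAddCommGroup F]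
    [NormedSpace ℝ F] : C(X, F →L[ℝ] F) →L[ℝ] C(X, F) →L[ℝ] C(X, F) :=
  LinearMap.mkContinuous₂
    (LinearMap.mk₂ ℝ (fun B f => ⟨fun x => B x (f x), by fun_prop⟩)
      (fun _ _ _ => rfl) (fun _ _ _ => rfl) (fun _ _ _ => by ext; simp) (fun _ _ _ => by ext; simp))
    1 fun B f => (ContinuousMap.norm_le _ (by positivity)).2 fun x => by
      rw [one_mul]
      exact (B x).le_of_opNorm_le_of_le (B.norm_coe_le_norm x) (f.norm_coe_le_norm x)

variable {α β : ℝ}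

theorem norm_integral_projIcc_le (h : α ≤ β) (f : C(Icc α β, F)) (t₀ t : Icc α β) :
    ‖∫ τ in (t₀ : ℝ)..t, f (projIcc α β h τ)‖ ≤ (β - α) * ‖f‖ := by
  have hlen : |(t : ℝ) - t₀| ≤ β - α := abs_sub_le_of_le_of_le t.2.1 t.2.2 t₀.2.1 t₀.2.2
  calc ‖∫ τ in (t₀ : ℝ)..t, f (projIcc α β h τ)‖ ≤ ‖f‖ * |(t : ℝ) - t₀| :=
        intervalIntegral.norm_integral_le_of_norm_le_const fun _ _ => f.norm_coe_le_norm _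
    _ ≤ (β - α) * ‖f‖ := by rw [mul_comm]; gcongr

variable [CompleteSpace F]

theorem hasDerivAt_integral_projIcc (h : α ≤ β) (f : C(Icc α β, F)) (t₀ t : ℝ) :
    HasDerivAt (fun t => ∫ τ in t₀..t, f (projIcc α β h τ)) (f (projIcc α β h t)) t :=
  ((f.continuous.comp continuous_projIcc).integral_hasStrictDerivAt t₀ t).hasDerivAt

/-- The primitive that vanishes at `t₀`, as an operator on continuous functions; the Picard
iteration of the equation `x' = B x` with initial time `t₀` is `x ↦ x₀ + primitive t₀ (B x)`. -/
def primitive (t₀ : Icc α β) : C(Icc α β, F) →L[ℝ] C(Icc α β, F) :=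
  have h : α ≤ β := t₀.2.1.trans t₀.2.2
  LinearMap.mkContinuous
    { toFun f := ⟨fun t => ∫ τ in (t₀ : ℝ)..t, f (projIcc α β h τ),
        (continuous_iff_continuousAt.2 fun t =>
          (hasDerivAt_integral_projIcc h f t₀ t).continuousAt).comp continuous_subtype_val⟩
      map_add' f₁ f₂ := by
        ext t
        exact intervalIntegral.integral_add
          ((f₁.continuous.comp continuous_projIcc).intervalIntegrable _ _)
          ((f₂.continuous.comp continuous_projIcc).intervalIntegrable _ _)
      map_smul' r f := by
        ext t
        exact intervalIntegral.integral_smul r _ }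
    (β - α) fun f => (ContinuousMap.norm_le _ (mul_nonneg (sub_nonneg.2 h) (norm_nonneg f))).2
      (norm_integral_projIcc_le h f t₀)

theorem norm_primitive_le (t₀ : Icc α β) : ‖primitive (F := F) t₀‖ ≤ β - α :=
  have h : α ≤ β := t₀.2.1.trans t₀.2.2
  LinearMap.mkContinuous_norm_le _ (sub_nonneg.2 h) fun f =>
    (ContinuousMap.norm_le _ (mul_nonneg (sub_nonneg.2 h) (norm_nonneg f))).2
      (norm_integral_projIcc_le h f t₀)

theorem primitive_self (t₀ : Icc α β) (f : C(Icc α β, F)) : primitive t₀ f t₀ = 0 :=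
  intervalIntegral.integral_same

theorem hasDerivWithinAt_primitive (t₀ : Icc α β) (f : C(Icc α β, F)) (t : Icc α β) :
    HasDerivWithinAt (fun τ => primitive t₀ f (projIcc α β (t₀.2.1.trans t₀.2.2) τ)) (f t)
      (Icc α β) t := by
  have h := (hasDerivAt_integral_projIcc (t₀.2.1.trans t₀.2.2) f t₀ t).hasDerivWithinAt
    (s := Icc α β)
  rw [projIcc_val] at h
  refine h.congr_of_mem (fun τ hτ => ?_) t.2
  rw [projIcc_of_mem _ hτ]
  rfl

theorem eq_add_primitive {W : ℝ → F} {f : C(Icc α β, F)}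
    (hW : ∀ t : Icc α β, HasDerivWithinAt W (f t) (Icc α β) t) (t₀ t : Icc α β) :
    W t = W t₀ + primitive t₀ f t := by
  have hderiv : ∀ τ ∈ Icc α β, HasDerivWithinAt
      (fun τ => W τ - primitive t₀ f (projIcc α β (t₀.2.1.trans t₀.2.2) τ)) 0 (Icc α β) τ :=
    fun τ hτ =>
      ((hW ⟨τ, hτ⟩).sub (hasDerivWithinAt_primitive t₀ f ⟨τ, hτ⟩)).congr_deriv (sub_self _)
  have h := Convex.norm_image_sub_le_of_norm_hasDerivWithin_le (C := 0) hderiv (by simp)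
    (convex_Icc α β) t₀.2 t.2
  rw [zero_mul, norm_le_zero_iff] at h
  simp only [projIcc_val, primitive_self, sub_zero] at h
  rwa [sub_right_comm, sub_eq_zero, sub_eq_iff_eq_add'] at h

theorem isUnit_one_sub_primitive_comp {t₀ : Icc α β} {B : C(Icc α β, F →L[ℝ] F)}
    (hB : ‖B‖ * (β - α) < 1) :
    IsUnit (1 - (primitive t₀).comp (applyL (Icc α β) F B)) := by
  refine isUnit_one_sub_of_norm_lt_one (lt_of_le_of_lt ?_ hB)
  have happly : ‖applyL (Icc α β) F B‖ ≤ 1 * ‖B‖ :=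
    (applyL (Icc α β) F).le_of_opNorm_le (LinearMap.mkContinuous₂_norm_le _ zero_le_one _) B
  rw [one_mul] at happly
  have hαβ : 0 ≤ β - α := sub_nonneg.2 (t₀.2.1.trans t₀.2.2)
  calc ‖(primitive t₀).comp (applyL (Icc α β) F B)‖
      ≤ ‖primitive (F := F) t₀‖ * ‖applyL (Icc α β) F B‖ := ContinuousLinearMap.opNorm_comp_le _ _
    _ ≤ (β - α) * ‖B‖ := by gcongr; exact norm_primitive_le t₀
    _ = ‖B‖ * (β - α) := mul_comm _ _

theorem exists_eq_const_add_primitive {B : C(Icc α β, F →L[ℝ] F)} (hB : ‖B‖ * (β - α) < 1)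
    (t₀ : Icc α β) (x₀ : F) :
    ∃ x : C(Icc α β, F), x = .const _ x₀ + primitive t₀ (applyL _ _ B x) := by
  obtain ⟨u, hu⟩ := isUnit_one_sub_primitive_comp (t₀ := t₀) hB
  refine ⟨(↑u⁻¹ : C(Icc α β, F) →L[ℝ] C(Icc α β, F)) (.const _ x₀), ?_⟩
  have h := DFunLike.congr_fun u.mul_inv (ContinuousMap.const (Icc α β) x₀)
  rw [hu] at h
  exact sub_eq_iff_eq_add.1 h

theorem exists_hasDerivWithinAt_of_short {B : ℝ → F →L[ℝ] F} {C t₀ : ℝ}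
    (hB : ContinuousOn B (Icc α β)) (hC : ∀ t ∈ Icc α β, ‖B t‖ ≤ C) (hshort : C * (β - α) < 1)
    (ht₀ : t₀ ∈ Icc α β) (x₀ : F) :
    ∃ x : ℝ → F, x t₀ = x₀ ∧ ∀ t ∈ Icc α β, HasDerivWithinAt x (B t (x t)) (Icc α β) t := by
  have h : α ≤ β := ht₀.1.trans ht₀.2
  let B' : C(Icc α β, F →L[ℝ] F) := ⟨(Icc α β).domRestrict B, hB.domRestrict⟩
  have hB' : ‖B'‖ ≤ C := (ContinuousMap.norm_le _ ((norm_nonneg _).trans (hC t₀ ht₀))).2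
    fun t => hC t t.2
  obtain ⟨x, hx⟩ := exists_eq_const_add_primitive
    ((mul_le_mul_of_nonneg_right hB' (sub_nonneg.2 h)).trans_lt hshort) ⟨t₀, ht₀⟩ x₀
  have hxt : ∀ t, x t = x₀ + primitive ⟨t₀, ht₀⟩ (applyL _ _ B' x) t := DFunLike.congr_fun hx
  refine ⟨fun t => x (projIcc α β h t), ?_, fun t ht => ?_⟩
  · change x (projIcc α β h t₀) = x₀
    rw [projIcc_of_mem h ht₀, hxt, primitive_self, add_zero]
  · have hd := (hasDerivWithinAt_primitive ⟨t₀, ht₀⟩ (applyL _ _ B' x) ⟨t, ht⟩).const_add x₀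
    simp only [projIcc_of_mem h ht]
    exact hd.congr_of_mem (fun τ _ => hxt _) ht

theorem differentiableWithinAt_of_eq_const_add_primitive {A : Set ℝ} {s : ℝ} {t₀ : Icc α β}
    {B : ℝ → C(Icc α β, F →L[ℝ] F)} {x : ℝ → C(Icc α β, F)} {w : ℝ → F} (hs : s ∈ A)
    (hshort : ∀ a ∈ A, ‖B a‖ * (β - α) < 1) (hB : DifferentiableWithinAt ℝ B A s)
    (hw : DifferentiableWithinAt ℝ w A s)
    (hx : ∀ a ∈ A, x a = .const _ (w a) + primitive t₀ (applyL _ _ (B a) (x a))) :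
    DifferentiableWithinAt ℝ x A s := by
  let T : ℝ → C(Icc α β, F) →L[ℝ] C(Icc α β, F) := fun a =>
    1 - (primitive t₀).comp (applyL (Icc α β) F (B a))
  have hunit : ∀ a ∈ A, IsUnit (T a) := fun a ha => isUnit_one_sub_primitive_comp (hshort a ha)
  have hT : DifferentiableWithinAt ℝ T A s :=
    (differentiableWithinAt_const _).sub ((differentiableWithinAt_const _).clm_comp
      ((applyL (Icc α β) F).differentiableAt.comp_differentiableWithinAt s hB))
  have hconst : DifferentiableWithinAt ℝ (fun a => ContinuousMap.const (Icc α β) (w a)) A s :=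
    (ContinuousLinearMap.const ℝ (Icc α β)
      (M := F)).differentiableAt.comp_differentiableWithinAt s hw
  have hinv : DifferentiableWithinAt ℝ (fun a => Ring.inverse (T a)) A s :=
    (differentiableAt_inverse (𝕜 := ℝ) (hunit s hs)).comp_differentiableWithinAt s hT
  have hsolve : ∀ a ∈ A, x a = Ring.inverse (T a) (.const _ (w a)) := fun a ha => by
    have hTx : T a (x a) = .const _ (w a) := sub_eq_iff_eq_add.2 (hx a ha)
    rw [← hTx]
    exact (DFunLike.congr_fun (Ring.inverse_mul_cancel _ (hunit a ha)) (x a)).symm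
  exact (hinv.clm_apply hconst).congr hsolve (hsolve s hs)

theorem exists_hasDerivWithinAt_of_eq_const_add_primitive {A : Set ℝ} {s : ℝ} {t₀ : Icc α β}
    {B : ℝ → C(Icc α β, F →L[ℝ] F)} {B' : C(Icc α β, F →L[ℝ] F)} {x : ℝ → C(Icc α β, F)}
    {w : ℝ → F} {w' : F} (hA : UniqueDiffWithinAt ℝ A s) (hs : s ∈ A)
    (hshort : ∀ a ∈ A, ‖B a‖ * (β - α) < 1) (hB : HasDerivWithinAt B B' A s)
    (hw : HasDerivWithinAt w w' A s)
    (hx : ∀ a ∈ A, x a = .const _ (w a) + primitive t₀ (applyL _ _ (B a) (x a))) :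
    ∃ z, HasDerivWithinAt x z A s ∧
      z = .const _ w' + primitive t₀ (applyL _ _ (B s) z + applyL _ _ B' (x s)) := by
  have hxs := (differentiableWithinAt_of_eq_const_add_primitive hs hshort
    hB.differentiableWithinAt hw.differentiableWithinAt hx).hasDerivWithinAt
  refine ⟨_, hxs, hA.eq_deriv _ hxs ?_⟩
  have hBx := ContinuousLinearMap.hasDerivWithinAt_of_bilinear
    (B := applyL (Icc α β) F) hB hxs
  have hconst := (ContinuousLinearMap.const ℝ (Icc α β)
    (M := F)).hasFDerivAt.comp_hasDerivWithinAt s hw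
  exact (hconst.add ((primitive t₀).hasFDerivAt.comp_hasDerivWithinAt s hBx)).congr hx (hx s hs)

/-- The slice `D (a, ·)` as an element of the Banach space of continuous functions on `[α, β]`; it
is `0` if the slice is not continuous. -/
def slice (α β : ℝ) {G : Type*} [NormedAddCommGroup G] (D : ℝ × ℝ → G) (a : ℝ) : C(Icc α β, G) :=
  .mkD (fun τ => D (a, τ)) 0

section Slice

variable {G : Type*} [NormedAddCommGroup G] [NormedSpace ℝ G] {D D' : ℝ × ℝ → G} {a₀ a₁ s : ℝ}

omit [NormedSpace ℝ G] in
theorem slice_apply {a : ℝ} (hD : ContinuousOn (fun τ => D (a, τ)) (Icc α β)) (τ : Icc α β) :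
    slice α β D a τ = D (a, τ) :=
  ContinuousMap.mkD_apply_of_continuous (f := fun τ : Icc α β => D (a, τ)) hD.domRestrict

omit [NormedSpace ℝ G] in
theorem slice_apply_of_mem (hD : ContinuousOn D (Icc a₀ a₁ ×ˢ Icc α β)) {a : ℝ}
    (ha : a ∈ Icc a₀ a₁) (τ : Icc α β) : slice α β D a τ = D (a, τ) :=
  slice_apply (hD.comp (by fun_prop) fun _ hτ => ⟨ha, hτ⟩) τ

omit [NormedSpace ℝ G] in
theorem continuousOn_slice (hD : ContinuousOn D (Icc a₀ a₁ ×ˢ Icc α β)) :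
    ContinuousOn (slice α β D) (Icc a₀ a₁) := by
  rw [continuousOn_iff_continuous_domRestrict]
  refine ContinuousMap.continuous_of_continuous_uncurry _ ?_
  exact (hD.comp_continuous (f := fun p : Icc a₀ a₁ × Icc α β => ((p.1 : ℝ), (p.2 : ℝ)))
    (by fun_prop) fun p => ⟨p.1.2, p.2.2⟩).congr fun p => (slice_apply_of_mem hD p.1.2 p.2).symm

theorem hasDerivWithinAt_slice (hD : ContinuousOn D (Icc a₀ a₁ ×ˢ Icc α β))
    (hD' : ContinuousOn D' (Icc a₀ a₁ ×ˢ Icc α β))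
    (hderiv : ∀ a ∈ Icc a₀ a₁, ∀ τ ∈ Icc α β,
      HasDerivWithinAt (fun b => D (b, τ)) (D' (a, τ)) (Icc a₀ a₁) a) (hs : s ∈ Icc a₀ a₁) :
    HasDerivWithinAt (slice α β D) (slice α β D' s) (Icc a₀ a₁) s := by
  refine hasDerivWithinAt_continuousMap_of_apply (convex_Icc a₀ a₁) hs (fun a ha τ => ?_)
    (continuousOn_slice hD' s hs)
  rw [slice_apply_of_mem hD' ha]
  exact (hderiv a ha τ τ.2).congr_of_mem (fun b hb => slice_apply_of_mem hD hb τ) ha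

end Slice

/- The solution of a linear equation is an affine function of the initial value with invertible
coefficient in the Banach algebra of operators on `C([α, β], F)`, so it inherits differentiability
in the parameter; its derivative solves the linearized equation. -/
theorem exists_hasDerivWithinAt_parameter {a₀ a₁ s t₀ C : ℝ} {B B' : ℝ × ℝ → F →L[ℝ] F}
    {W : ℝ × ℝ → F} {w' : F} (ha : a₀ < a₁) (hs : s ∈ Icc a₀ a₁) (ht₀ : t₀ ∈ Icc α β)
    (hB : ContinuousOn B (Icc a₀ a₁ ×ˢ Icc α β)) (hB' : ContinuousOn B' (Icc a₀ a₁ ×ˢ Icc α β))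
    (hderiv : ∀ a ∈ Icc a₀ a₁, ∀ τ ∈ Icc α β,
      HasDerivWithinAt (fun b => B (b, τ)) (B' (a, τ)) (Icc a₀ a₁) a)
    (hC : ∀ p ∈ Icc a₀ a₁ ×ˢ Icc α β, ‖B p‖ ≤ C) (hshort : C * (β - α) < 1)
    (hW : ∀ a ∈ Icc a₀ a₁, ∀ τ ∈ Icc α β,
      HasDerivWithinAt (fun τ => W (a, τ)) (B (a, τ) (W (a, τ))) (Icc α β) τ)
    (hW₀ : HasDerivWithinAt (fun a => W (a, t₀)) w' (Icc a₀ a₁) s) :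
    ∃ z : ℝ → F, ∀ τ ∈ Icc α β, HasDerivWithinAt (fun a => W (a, τ)) (z τ) (Icc a₀ a₁) s ∧
      HasDerivWithinAt z (B (s, τ) (z τ) + B' (s, τ) (W (s, τ))) (Icc α β) τ := by
  have h : α ≤ β := ht₀.1.trans ht₀.2
  have hWslice : ∀ a ∈ Icc a₀ a₁, ∀ τ, slice α β W a τ = W (a, τ) := fun a ha =>
    slice_apply fun τ hτ => (hW a ha τ hτ).continuousWithinAt
  have hnorm : ∀ a ∈ Icc a₀ a₁, ‖slice α β B a‖ ≤ C := fun a ha =>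
    (ContinuousMap.norm_le _ ((norm_nonneg _).trans (hC (s, t₀) ⟨hs, ht₀⟩))).2 fun τ => by
      rw [slice_apply_of_mem hB ha]
      exact hC _ ⟨ha, τ.2⟩
  have hpicard : ∀ a ∈ Icc a₀ a₁, slice α β W a = .const _ (W (a, t₀)) +
      primitive ⟨t₀, ht₀⟩ (applyL _ _ (slice α β B a) (slice α β W a)) := fun a ha => by
    ext τ
    rw [hWslice a ha]
    refine eq_add_primitive (W := fun τ => W (a, τ)) (fun t => ?_) ⟨t₀, ht₀⟩ τ
    refine (hW a ha t t.2).congr_deriv ?_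
    rw [← hWslice a ha, ← slice_apply_of_mem hB ha]
    rfl
  obtain ⟨z, hz, hzeq⟩ := exists_hasDerivWithinAt_of_eq_const_add_primitive
    (uniqueDiffOn_Icc ha s hs) hs
    (fun a ha => (mul_le_mul_of_nonneg_right (hnorm a ha) (sub_nonneg.2 h)).trans_lt hshort)
    (hasDerivWithinAt_slice hB hB' hderiv hs) hW₀ hpicard
  refine ⟨fun τ => z (projIcc α β h τ), fun τ hτ => ?_⟩
  beta_reduce
  rw [projIcc_of_mem h hτ]
  constructor
  · exact ((ContinuousMap.evalCLM ℝ (⟨τ, hτ⟩ : Icc α β)).hasFDerivAt.comp_hasDerivWithinAt s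
      hz).congr_of_mem (fun a ha => (hWslice a ha ⟨τ, hτ⟩).symm) hs
  · have hd := (hasDerivWithinAt_primitive ⟨t₀, ht₀⟩ (applyL _ _ (slice α β B s) z +
      applyL _ _ (slice α β B' s) (slice α β W s)) ⟨τ, hτ⟩).const_add w'
    refine (hd.congr_of_mem (fun t _ => DFunLike.congr_fun hzeq _) hτ).congr_deriv ?_
    rw [← hWslice s hs ⟨τ, hτ⟩, ← slice_apply_of_mem hB hs ⟨τ, hτ⟩,
      ← slice_apply_of_mem hB' hs ⟨τ, hτ⟩]
    rfl

end LinearODE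

/-! ### Metric and Christoffel symbols in charts -/

section

variable {E : Type*} [NormedAddCommGroup E] [NormedSpace ℝ E]
  {M : Type*} [TopologicalSpace M] [ChartedSpace E M] [IsManifold 𝓘(ℝ, E) ∞ M]

/-- The coordinates, in the chart at `x₀`, of a tangent vector at `p`. Like every definition below
that duplicates one of the statement, it treats `TangentSpace 𝓘(ℝ, E) p` as the normed space `E`,
since tangent spaces come without a norm. -/
def toCoord (x₀ p : M) : E →L[ℝ] E := tangentCoordChange 𝓘(ℝ, E) p x₀ p

/-- The tangent vector at `p` with given coordinates in the chart at `x₀`. -/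
def ofCoord (x₀ p : M) : E →L[ℝ] E := tangentCoordChange 𝓘(ℝ, E) x₀ p p

theorem ofCoord_toCoord {x₀ p : M} (hp : p ∈ (extChartAt 𝓘(ℝ, E) x₀).source) (v : E) :
    ofCoord x₀ p (toCoord x₀ p v) = v := by
  unfold ofCoord toCoord
  rw [tangentCoordChange_comp ⟨⟨mem_extChartAt_source p, hp⟩, mem_extChartAt_source p⟩,
    tangentCoordChange_self (mem_extChartAt_source p)]

theorem toCoord_ofCoord {x₀ p : M} (hp : p ∈ (extChartAt 𝓘(ℝ, E) x₀).source) (v : E) :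
    toCoord x₀ p (ofCoord x₀ p v) = v := by
  unfold ofCoord toCoord
  rw [tangentCoordChange_comp ⟨⟨hp, mem_extChartAt_source p⟩, hp⟩, tangentCoordChange_self hp]

theorem toCoord_self (p : M) (v : E) : toCoord p p v = v :=
  tangentCoordChange_self (mem_extChartAt_source p)

/-- The Riemannian metric at `p`, as a bilinear form on the model space. -/
def innerE (g : RMetric E M) (p : M) : E →L[ℝ] E →L[ℝ] ℝ := g.inner p

theorem innerE_symm (g : RMetric E M) (p : M) (u v : E) : innerE g p u v = innerE g p v u :=
  g.symm p u v

theorem innerE_pos (g : RMetric E M) (p : M) {u : E} (hu : u ≠ 0) : 0 < innerE g p u u :=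
  g.pos p u hu

theorem innerE_self_nonneg (g : RMetric E M) (p : M) (u : E) : 0 ≤ innerE g p u u := by
  obtain rfl | hu := eq_or_ne u 0
  · simp
  · exact (innerE_pos g p hu).le

theorem chartMetric_extChartAt (g : RMetric E M) {x₀ p : M}
    (hp : p ∈ (extChartAt 𝓘(ℝ, E) x₀).source) (u v : E) :
    chartMetric g x₀ (extChartAt 𝓘(ℝ, E) x₀ p) u v =
      innerE g p (ofCoord x₀ p u) (ofCoord x₀ p v) := by
  have hq : ∀ q : M, q = p → (innerE g q).bilinearComp (tangentCoordChange 𝓘(ℝ, E) x₀ q q)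
      (tangentCoordChange 𝓘(ℝ, E) x₀ q q) u v = innerE g p (ofCoord x₀ p u) (ofCoord x₀ p v) := by
    rintro q rfl; rfl
  exact hq _ ((extChartAt 𝓘(ℝ, E) x₀).left_inv hp)

theorem chartMetric_toCoord (g : RMetric E M) {x₀ p : M}
    (hp : p ∈ (extChartAt 𝓘(ℝ, E) x₀).source) (u v : E) :
    chartMetric g x₀ (extChartAt 𝓘(ℝ, E) x₀ p) (toCoord x₀ p u) (toCoord x₀ p v) =
      innerE g p u v := by
  rw [chartMetric_extChartAt g hp, ofCoord_toCoord hp, ofCoord_toCoord hp]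

theorem chartMetric_symm (g : RMetric E M) (x₀ : M) {y : E}
    (hy : y ∈ (extChartAt 𝓘(ℝ, E) x₀).target) (u v : E) :
    chartMetric g x₀ y u v = chartMetric g x₀ y v u := by
  have hp := (extChartAt 𝓘(ℝ, E) x₀).map_target hy
  rw [← (extChartAt 𝓘(ℝ, E) x₀).right_inv hy, chartMetric_extChartAt g hp,
    chartMetric_extChartAt g hp, innerE_symm]

theorem chartMetric_pos (g : RMetric E M) (x₀ : M) {y : E}
    (hy : y ∈ (extChartAt 𝓘(ℝ, E) x₀).target) {u : E} (hu : u ≠ 0) :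
    0 < chartMetric g x₀ y u u := by
  have hp := (extChartAt 𝓘(ℝ, E) x₀).map_target hy
  rw [← (extChartAt 𝓘(ℝ, E) x₀).right_inv hy, chartMetric_extChartAt g hp]
  refine innerE_pos g _ fun h => hu ?_
  rw [← toCoord_ofCoord hp u, h, map_zero]

theorem contMDiffOn_ofCoord (x₀ : M) (w : E) :
    ContMDiffOn 𝓘(ℝ, E) 𝓘(ℝ, E).tangent ∞
      (fun p : M => (⟨p, ofCoord (E := E) x₀ p w⟩ : TangentBundle 𝓘(ℝ, E) M))
      (extChartAt 𝓘(ℝ, E) x₀).source := by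
  have hsymm := (trivializationAt E (TangentSpace 𝓘(ℝ, E) : M → Type _) x₀).contMDiffOn_symm
    (IB := 𝓘(ℝ, E)) (n := ∞)
  have hconst : ContMDiffOn 𝓘(ℝ, E) (𝓘(ℝ, E).prod 𝓘(ℝ, E)) ∞ (fun p : M => (p, w))
    (extChartAt 𝓘(ℝ, E) x₀).source := contMDiffOn_id.prodMk contMDiffOn_const
  exact (hsymm.comp hconst fun p hp => by simpa using hp).congr fun _ _ => rfl

theorem contMDiffOn_innerE (g : RMetric E M) {U V : M → E} {s : Set M}
    (hU : ContMDiffOn 𝓘(ℝ, E) 𝓘(ℝ, E).tangent ∞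
      (fun p => (⟨p, U p⟩ : TangentBundle 𝓘(ℝ, E) M)) s)
    (hV : ContMDiffOn 𝓘(ℝ, E) 𝓘(ℝ, E).tangent ∞
      (fun p => (⟨p, V p⟩ : TangentBundle 𝓘(ℝ, E) M)) s) :
    ContMDiffOn 𝓘(ℝ, E) 𝓘(ℝ, ℝ) ∞ (fun p => innerE g p (U p) (V p)) s := by
  have h : ContMDiffOn 𝓘(ℝ, E) (𝓘(ℝ, E).prod 𝓘(ℝ, ℝ)) ∞
      (fun p : M => Bundle.TotalSpace.mk' ℝ (E := Bundle.Trivial M ℝ) p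
        (innerE g p (U p) (V p))) s :=
    ContMDiffOn.clm_bundle_apply₂ (F₁ := E) (F₂ := E) (E₁ := fun x : M => TangentSpace 𝓘(ℝ, E) x)
      (E₂ := fun x : M => TangentSpace 𝓘(ℝ, E) x) g.contMDiff.contMDiffOn hU hV
  exact fun p hp => (Bundle.contMDiffWithinAt_totalSpace.1 (h p hp)).2

/-- The change of coordinates between the charts at `x₀` and `x₁`. -/
def transition (x₀ x₁ : M) : E → E := extChartAt 𝓘(ℝ, E) x₁ ∘ (extChartAt 𝓘(ℝ, E) x₀).symm

omit [IsManifold 𝓘(ℝ, E) ∞ M] in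
theorem transition_apply {x₀ p : M} (x₁ : M) (h₀ : p ∈ (extChartAt 𝓘(ℝ, E) x₀).source) :
    transition (E := E) x₀ x₁ (extChartAt 𝓘(ℝ, E) x₀ p) = extChartAt 𝓘(ℝ, E) x₁ p := by
  rw [transition, Function.comp_apply, (extChartAt 𝓘(ℝ, E) x₀).left_inv h₀]

theorem contDiffAt_transition {x₀ x₁ p : M} (h₀ : p ∈ (extChartAt 𝓘(ℝ, E) x₀).source)
    (h₁ : p ∈ (extChartAt 𝓘(ℝ, E) x₁).source) :
    ContDiffAt ℝ ∞ (transition (E := E) x₀ x₁) (extChartAt 𝓘(ℝ, E) x₀ p) := by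
  have hp : extChartAt 𝓘(ℝ, E) x₀ p ∈
      ((extChartAt 𝓘(ℝ, E) x₀).symm ≫ extChartAt 𝓘(ℝ, E) x₁).source := by
    rw [PartialEquiv.trans_source'', PartialEquiv.symm_symm, PartialEquiv.symm_target]
    exact mem_image_of_mem _ ⟨h₀, h₁⟩
  have h := contDiffWithinAt_ext_coord_change (n := ∞) x₁ x₀ hp
  rwa [modelWithCornersSelf_coe, range_id, contDiffWithinAt_univ] at h

theorem contDiffAt_fderiv_transition {x₀ x₁ p : M} (h₀ : p ∈ (extChartAt 𝓘(ℝ, E) x₀).source)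
    (h₁ : p ∈ (extChartAt 𝓘(ℝ, E) x₁).source) :
    ContDiffAt ℝ ∞ (fderiv ℝ (transition (E := E) x₀ x₁)) (extChartAt 𝓘(ℝ, E) x₀ p) :=
  (contDiffAt_transition h₀ h₁).fderiv_right (by simp)

theorem fderiv_fderiv_transition_symm {x₀ x₁ p : M} (h₀ : p ∈ (extChartAt 𝓘(ℝ, E) x₀).source)
    (h₁ : p ∈ (extChartAt 𝓘(ℝ, E) x₁).source) (u v : E) :
    fderiv ℝ (fderiv ℝ (transition x₀ x₁)) (extChartAt 𝓘(ℝ, E) x₀ p) u v =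
      fderiv ℝ (fderiv ℝ (transition x₀ x₁)) (extChartAt 𝓘(ℝ, E) x₀ p) v u := by
  have hn : minSmoothness ℝ 2 ≤ ((⊤ : ℕ∞) : WithTop ℕ∞) := by
    rw [minSmoothness_of_isRCLikeNormedField]
    exact WithTop.coe_le_coe.2 (le_top : (2 : ℕ∞) ≤ ⊤)
  exact ((contDiffAt_transition h₀ h₁).isSymmSndFDerivAt hn).eq u v

theorem fderiv_transition_toCoord {x₀ x₁ p : M} (h₀ : p ∈ (extChartAt 𝓘(ℝ, E) x₀).source)
    (h₁ : p ∈ (extChartAt 𝓘(ℝ, E) x₁).source) (v : E) :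
    fderiv ℝ (transition (E := E) x₀ x₁) (extChartAt 𝓘(ℝ, E) x₀ p) (toCoord x₀ p v) =
      toCoord x₁ p v := by
  have hD : fderiv ℝ (transition (E := E) x₀ x₁) (extChartAt 𝓘(ℝ, E) x₀ p) =
      tangentCoordChange 𝓘(ℝ, E) x₀ x₁ p := by
    rw [tangentCoordChange_def]
    simp [transition, fderivWithin_univ]
  rw [hD]
  exact tangentCoordChange_comp ⟨⟨mem_extChartAt_source p, h₀⟩, h₁⟩

theorem fderiv_transition_bijective {x₀ x₁ p : M} (h₀ : p ∈ (extChartAt 𝓘(ℝ, E) x₀).source)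
    (h₁ : p ∈ (extChartAt 𝓘(ℝ, E) x₁).source) :
    Function.Bijective (fderiv ℝ (transition (E := E) x₀ x₁) (extChartAt 𝓘(ℝ, E) x₀ p)) := by
  refine ⟨Function.LeftInverse.injective (g := fun z => toCoord x₀ p (ofCoord x₁ p z))
    fun z => ?_, fun z => ⟨toCoord x₀ p (ofCoord x₁ p z), ?_⟩⟩
  · obtain ⟨v, rfl⟩ : ∃ v, toCoord x₀ p v = z := ⟨_, toCoord_ofCoord h₀ z⟩
    simp only [fderiv_transition_toCoord h₀ h₁, ofCoord_toCoord h₁]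
  · rw [fderiv_transition_toCoord h₀ h₁, toCoord_ofCoord h₁]

theorem chartMetric_transition (g : RMetric E M) {x₀ x₁ p : M}
    (h₀ : p ∈ (extChartAt 𝓘(ℝ, E) x₀).source) (h₁ : p ∈ (extChartAt 𝓘(ℝ, E) x₁).source) (u v : E) :
    chartMetric g x₀ (extChartAt 𝓘(ℝ, E) x₀ p) u v =
      chartMetric g x₁ (transition x₀ x₁ (extChartAt 𝓘(ℝ, E) x₀ p))
        (fderiv ℝ (transition x₀ x₁) (extChartAt 𝓘(ℝ, E) x₀ p) u)
        (fderiv ℝ (transition x₀ x₁) (extChartAt 𝓘(ℝ, E) x₀ p) v) := by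
  rw [transition_apply x₁ h₀, ← toCoord_ofCoord h₀ u, ← toCoord_ofCoord h₀ v,
    fderiv_transition_toCoord h₀ h₁, fderiv_transition_toCoord h₀ h₁,
    chartMetric_toCoord g h₀, chartMetric_toCoord g h₁]

theorem eventually_chartMetric_transition (g : RMetric E M) {x₀ x₁ p : M}
    (h₀ : p ∈ (extChartAt 𝓘(ℝ, E) x₀).source) (h₁ : p ∈ (extChartAt 𝓘(ℝ, E) x₁).source) (u v : E) :
    ∀ᶠ y in 𝓝 (extChartAt 𝓘(ℝ, E) x₀ p), chartMetric g x₀ y u v =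
      chartMetric g x₁ (transition x₀ x₁ y) (fderiv ℝ (transition x₀ x₁) y u)
        (fderiv ℝ (transition x₀ x₁) y v) := by
  have hsource : ∀ᶠ y in 𝓝 (extChartAt 𝓘(ℝ, E) x₀ p),
      (extChartAt 𝓘(ℝ, E) x₀).symm y ∈ (extChartAt 𝓘(ℝ, E) x₁).source := by
    refine (continuousAt_extChartAt_symm' h₀).eventually ?_
    rw [(extChartAt 𝓘(ℝ, E) x₀).left_inv h₀]
    exact (isOpen_extChartAt_source x₁).mem_nhds h₁
  filter_upwards [hsource, (isOpen_extChartAt_target x₀).mem_nhds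
    ((extChartAt 𝓘(ℝ, E) x₀).map_source h₀)] with y hy₁ hy₀
  have h := chartMetric_transition g ((extChartAt 𝓘(ℝ, E) x₀).map_target hy₀) hy₁ u v
  rwa [(extChartAt 𝓘(ℝ, E) x₀).right_inv hy₀] at h

section FiniteDimensional

variable [FiniteDimensional ℝ E]

theorem contDiffAt_chartMetric (g : RMetric E M) (x₀ : M) {y : E}
    (hy : y ∈ (extChartAt 𝓘(ℝ, E) x₀).target) : ContDiffAt ℝ ∞ (chartMetric g x₀) y := by
  refine ContDiffOn.contDiffAt ?_ ((isOpen_extChartAt_target x₀).mem_nhds hy)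
  refine contDiffOn_clm_apply.2 fun u => contDiffOn_clm_apply.2 fun v => ?_
  rw [← contMDiffOn_iff_contDiffOn]
  refine ((contMDiffOn_innerE g (contMDiffOn_ofCoord x₀ u) (contMDiffOn_ofCoord x₀ v)).comp
    (contMDiffOn_extChartAt_symm x₀) fun _ hz => (extChartAt 𝓘(ℝ, E) x₀).map_target hz).congr
    fun z hz => ?_
  have h := chartMetric_extChartAt g ((extChartAt 𝓘(ℝ, E) x₀).map_target hz) u v
  rwa [(extChartAt 𝓘(ℝ, E) x₀).right_inv hz] at h

theorem hasFDerivAt_chartMetric (g : RMetric E M) (x₀ : M) {y : E}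
    (hy : y ∈ (extChartAt 𝓘(ℝ, E) x₀).target) :
    HasFDerivAt (chartMetric g x₀) (fderiv ℝ (chartMetric g x₀) y) y :=
  ((contDiffAt_chartMetric g x₀ hy).differentiableAt (by simp)).hasFDerivAt

theorem hasFDerivAt_chartMetric_apply (g : RMetric E M) (x₀ : M) {y : E}
    (hy : y ∈ (extChartAt 𝓘(ℝ, E) x₀).target) (u v : E) :
    HasFDerivAt (fun z => chartMetric g x₀ z u v)
      (((fderiv ℝ (chartMetric g x₀) y).flip u).flip v) y := by
  have h := ((hasFDerivAt_chartMetric g x₀ hy).clm_apply (hasFDerivAt_const u y)).clm_apply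
    (hasFDerivAt_const v y)
  convert! h using 1
  ext w
  simp

theorem fderiv_chartMetric_symm (g : RMetric E M) (x₀ : M) {y : E}
    (hy : y ∈ (extChartAt 𝓘(ℝ, E) x₀).target) (w u v : E) :
    fderiv ℝ (chartMetric g x₀) y w u v = fderiv ℝ (chartMetric g x₀) y w v u := by
  have hsymm : (fun z => chartMetric g x₀ z u v) =ᶠ[𝓝 y] fun z => chartMetric g x₀ z v u := by
    filter_upwards [(isOpen_extChartAt_target x₀).mem_nhds hy] with z hz
    exact chartMetric_symm g x₀ hz u v
  have h := (hasFDerivAt_chartMetric_apply g x₀ hy u v).unique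
    ((hasFDerivAt_chartMetric_apply g x₀ hy v u).congr_of_eventuallyEq hsymm)
  simpa using DFunLike.congr_fun h w

theorem fderiv_chartMetric_transition (g : RMetric E M) {x₀ x₁ p : M}
    (h₀ : p ∈ (extChartAt 𝓘(ℝ, E) x₀).source) (h₁ : p ∈ (extChartAt 𝓘(ℝ, E) x₁).source)
    {φ : E → E} (hφ : φ = transition x₀ x₁) {y : E} (hy : y = extChartAt 𝓘(ℝ, E) x₀ p)
    (w u v : E) :
    fderiv ℝ (chartMetric g x₀) y w u v =
      fderiv ℝ (chartMetric g x₁) (φ y) (fderiv ℝ φ y w) (fderiv ℝ φ y u) (fderiv ℝ φ y v)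
      + chartMetric g x₁ (φ y) (fderiv ℝ (fderiv ℝ φ) y w u) (fderiv ℝ φ y v)
      + chartMetric g x₁ (φ y) (fderiv ℝ φ y u) (fderiv ℝ (fderiv ℝ φ) y w v) := by
  subst hφ hy
  have htarget : transition x₀ x₁ (extChartAt 𝓘(ℝ, E) x₀ p) ∈ (extChartAt 𝓘(ℝ, E) x₁).target := by
    rw [transition_apply x₁ h₀]
    exact (extChartAt 𝓘(ℝ, E) x₁).map_source h₁
  have hφ := ((contDiffAt_transition h₀ h₁).differentiableAt (by simp)).hasFDerivAt
  have hDφ := ((contDiffAt_fderiv_transition h₀ h₁).differentiableAt (by simp)).hasFDerivAt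
  have hpull := (((hasFDerivAt_chartMetric g x₁ htarget).comp _ hφ).clm_apply
    (hDφ.clm_apply (hasFDerivAt_const u _))).clm_apply (hDφ.clm_apply (hasFDerivAt_const v _))
  have h := (hasFDerivAt_chartMetric_apply g x₀
    ((extChartAt 𝓘(ℝ, E) x₀).map_source h₀) u v).unique
      (hpull.congr_of_eventuallyEq (eventually_chartMetric_transition g h₀ h₁ u v))
  have hw := DFunLike.congr_fun h w
  simp only [ContinuousLinearMap.flip_apply, add_apply, ContinuousLinearMap.comp_apply,
    ContinuousLinearMap.comp_zero, zero_add, Function.comp_apply] at hw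
  rw [hw]
  ring

theorem isInvertible_of_pos {B : E →L[ℝ] E →L[ℝ] ℝ} (hB : ∀ u, u ≠ 0 → 0 < B u u) :
    B.IsInvertible := by
  have hinj : Function.Injective (B : E →ₗ[ℝ] (E →L[ℝ] ℝ)) := by
    refine LinearMap.ker_eq_bot.1 (LinearMap.ker_eq_bot'.2 fun u hu => ?_)
    by_contra h
    have hBu : B u = 0 := hu
    simpa [hBu] using hB u h
  have hrank : Module.finrank ℝ E = Module.finrank ℝ (E →L[ℝ] ℝ) := by
    rw [← (LinearMap.toContinuousLinearMap (𝕜 := ℝ) (E := E) (F' := ℝ)).finrank_eq]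
    exact (Subspace.dual_finrank_eq (K := ℝ) (V := E)).symm
  exact ⟨(LinearEquiv.ofInjectiveOfFinrankEq (B : E →ₗ[ℝ] (E →L[ℝ] ℝ)) hinj
    hrank).toContinuousLinearEquiv, rfl⟩

theorem isInvertible_chartMetric (g : RMetric E M) (x₀ : M) {y : E}
    (hy : y ∈ (extChartAt 𝓘(ℝ, E) x₀).target) : (chartMetric g x₀ y).IsInvertible :=
  isInvertible_of_pos fun _ hu => chartMetric_pos g x₀ hy hu

/-- The Christoffel symbols as a continuous bilinear map, which gives access to their smoothness in
the base point. -/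
def christoffelL (g : RMetric E M) (x₀ : M) (y : E) : E →L[ℝ] E →L[ℝ] E :=
  let Dg : E →L[ℝ] E →L[ℝ] E →L[ℝ] ℝ := fderiv ℝ (chartMetric g x₀) y
  (1 / 2 : ℝ) • (ContinuousLinearMap.compL ℝ E (E →L[ℝ] ℝ) E (chartMetric g x₀ y).inverse).comp
    (Dg + Dg.flip - ((ContinuousLinearMap.flipₗᵢ ℝ E E ℝ).toContinuousLinearEquiv :
      (E →L[ℝ] E →L[ℝ] ℝ) →L[ℝ] (E →L[ℝ] E →L[ℝ] ℝ)).comp Dg.flip)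

omit [FiniteDimensional ℝ E] in
theorem christoffel_eq_christoffelL (g : RMetric E M) (x₀ : M) (y u v : E) :
    christoffel g x₀ y u v = christoffelL g x₀ y u v := by
  simp [christoffel, christoffelL]

theorem contDiffAt_christoffelL (g : RMetric E M) (x₀ : M) {y : E}
    (hy : y ∈ (extChartAt 𝓘(ℝ, E) x₀).target) : ContDiffAt ℝ ∞ (christoffelL g x₀) y := by
  have hg := contDiffAt_chartMetric g x₀ hy
  have hD : ContDiffAt ℝ ∞ (fderiv ℝ (chartMetric g x₀)) y := hg.fderiv_right (by simp)
  have hflip : ContDiffAt ℝ ∞ (fun y => (fderiv ℝ (chartMetric g x₀) y).flip) y :=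
    (ContinuousLinearMap.flipₗᵢ ℝ E E (E →L[ℝ] ℝ)).contDiff.contDiffAt.comp y hD
  have hinv : ContDiffAt ℝ ∞ (fun y => (chartMetric g x₀ y).inverse) y :=
    ((isInvertible_chartMetric g x₀ hy).contDiffAt_map_inverse).comp y hg
  have hcomp := (ContinuousLinearMap.compL ℝ E (E →L[ℝ] ℝ) E).contDiff.contDiffAt.comp y hinv
  exact (hcomp.clm_comp ((hD.add hflip).sub (contDiffAt_const.clm_comp hflip))).const_smul
    (1 / 2 : ℝ)

theorem chartMetric_christoffelL (g : RMetric E M) (x₀ : M) {y : E}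
    (hy : y ∈ (extChartAt 𝓘(ℝ, E) x₀).target) (u v z : E) :
    chartMetric g x₀ y (christoffelL g x₀ y u v) z =
      1 / 2 * (fderiv ℝ (chartMetric g x₀) y u v z + fderiv ℝ (chartMetric g x₀) y v u z
        - fderiv ℝ (chartMetric g x₀) y z u v) := by
  rw [← christoffel_eq_christoffelL]
  unfold christoffel
  simp only [map_smul]
  rw [(isInvertible_chartMetric g x₀ hy).self_apply_inverse]
  simp

theorem christoffelL_symm (g : RMetric E M) (x₀ : M) {y : E}
    (hy : y ∈ (extChartAt 𝓘(ℝ, E) x₀).target) (u v : E) :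
    christoffelL g x₀ y u v = christoffelL g x₀ y v u := by
  apply (isInvertible_chartMetric g x₀ hy).injective
  ext z
  rw [chartMetric_christoffelL g x₀ hy, chartMetric_christoffelL g x₀ hy,
    fderiv_chartMetric_symm g x₀ hy z u v]
  ring

theorem fderiv_chartMetric_eq_christoffelL (g : RMetric E M) (x₀ : M) {y : E}
    (hy : y ∈ (extChartAt 𝓘(ℝ, E) x₀).target) (w u v : E) :
    fderiv ℝ (chartMetric g x₀) y w u v = chartMetric g x₀ y (christoffelL g x₀ y w u) v
      + chartMetric g x₀ y u (christoffelL g x₀ y w v) := by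
  rw [chartMetric_symm g x₀ hy u, chartMetric_christoffelL g x₀ hy,
    chartMetric_christoffelL g x₀ hy, fderiv_chartMetric_symm g x₀ hy w v u,
    fderiv_chartMetric_symm g x₀ hy v w u, fderiv_chartMetric_symm g x₀ hy u w v]
  ring

theorem christoffelL_transition (g : RMetric E M) {x₀ x₁ p : M}
    (h₀ : p ∈ (extChartAt 𝓘(ℝ, E) x₀).source) (h₁ : p ∈ (extChartAt 𝓘(ℝ, E) x₁).source) (u v : E) :
    fderiv ℝ (transition x₀ x₁) (extChartAt 𝓘(ℝ, E) x₀ p)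
        (christoffelL g x₀ (extChartAt 𝓘(ℝ, E) x₀ p) u v) =
      christoffelL g x₁ (extChartAt 𝓘(ℝ, E) x₁ p)
        (fderiv ℝ (transition x₀ x₁) (extChartAt 𝓘(ℝ, E) x₀ p) u)
        (fderiv ℝ (transition x₀ x₁) (extChartAt 𝓘(ℝ, E) x₀ p) v)
      + fderiv ℝ (fderiv ℝ (transition x₀ x₁)) (extChartAt 𝓘(ℝ, E) x₀ p) u v := by
  have hmetric := chartMetric_transition g h₀ h₁
  have hsymm := fderiv_fderiv_transition_symm h₀ h₁
  have hφy := transition_apply (E := E) x₁ h₀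
  have hsurj := (fderiv_transition_bijective (E := E) h₀ h₁).surjective
  have hy₀ : extChartAt 𝓘(ℝ, E) x₀ p ∈ _ := (extChartAt 𝓘(ℝ, E) x₀).map_source h₀
  have hy₁ : extChartAt 𝓘(ℝ, E) x₁ p ∈ _ := (extChartAt 𝓘(ℝ, E) x₁).map_source h₁
  set φ := transition (E := E) x₀ x₁ with hφ
  set y := extChartAt 𝓘(ℝ, E) x₀ p with hy
  rw [← hφy] at hy₁ ⊢
  apply (isInvertible_chartMetric g x₁ hy₁).injective
  ext z
  obtain ⟨z, rfl⟩ := hsurj z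
  rw [← hmetric, map_add, add_apply, chartMetric_christoffelL g x₀ hy₀,
    chartMetric_christoffelL g x₁ hy₁]
  simp only [fderiv_chartMetric_transition g h₀ h₁ hφ hy]
  rw [hsymm z u, hsymm z v, hsymm v u,
    chartMetric_symm g x₁ hy₁ (fderiv ℝ φ y v) (fderiv ℝ (fderiv ℝ φ) y u z)]
  ring

end FiniteDimensional

end

/-! ### Covariant derivatives in charts -/

section

variable {E : Type*} [NormedAddCommGroup E] [NormedSpace ℝ E]
  {M : Type*} [TopologicalSpace M] [ChartedSpace E M] [IsManifold 𝓘(ℝ, E) ∞ M]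

/-- The velocity of a curve, as an element of the model space. -/
def velocityE (γ : ℝ → M) (t : ℝ) : E := velocity (E := E) γ t

/-- The coordinates, in the chart at `x₀`, of a vector field along `γ` with values in the model
space. -/
def fieldCoordE (γ : ℝ → M) (V : ℝ → E) (x₀ : M) (t : ℝ) : E := toCoord x₀ (γ t) (V t)

/-- Differentiability of a vector field along `γ` with values in the model space. -/
def FieldDifferentiableAtE (γ : ℝ → M) (V : ℝ → E) (t : ℝ) : Prop :=
  FieldDifferentiableAt (E := E) γ V t

/-- The covariant derivative of a vector field along `γ` with values in the model space. -/
def covDerivE (g : RMetric E M) (γ : ℝ → M) (V : ℝ → E) (t : ℝ) : E := covDeriv (E := E) g γ V t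

/-- The vector field `V` along `γ` is differentiable at `t` with covariant derivative `w`; unlike
an equation for `covDerivE`, this excludes junk values of the derivative. -/
def HasCovDerivAtE (g : RMetric E M) (γ : ℝ → M) (V : ℝ → E) (w : E) (t : ℝ) : Prop :=
  FieldDifferentiableAtE γ V t ∧ covDerivE g γ V t = w

theorem uniqueDiffWithinAt_unitIcc {t : ℝ} (ht : t ∈ Icc (0 : ℝ) 1) :
    UniqueDiffWithinAt ℝ (Icc (0 : ℝ) 1) t :=
  uniqueDiffOn_Icc zero_lt_one t ht

theorem contDiffWithinAt_extChartAt_comp {W : Type*} [NormedAddCommGroup W] [NormedSpace ℝ W]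
    {f : W → M} {s : Set W} {z : W} {x₀ : M} (hf : ContMDiffWithinAt 𝓘(ℝ, W) 𝓘(ℝ, E) ∞ f s z)
    (hz : f z ∈ (extChartAt 𝓘(ℝ, E) x₀).source) :
    ContDiffWithinAt ℝ ∞ (fun w => extChartAt 𝓘(ℝ, E) x₀ (f w)) s z := by
  rw [← contMDiffWithinAt_iff_contDiffWithinAt]
  rw [extChartAt_source] at hz
  exact (contMDiffAt_extChartAt' hz).comp_contMDiffWithinAt z hf

omit [IsManifold 𝓘(ℝ, E) ∞ M] in
theorem eventually_mem_source {W : Type*} [TopologicalSpace W] {f : W → M} {s : Set W} {z : W}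
    {x₀ : M} (hf : ContinuousWithinAt f s z) (hz : f z ∈ (extChartAt 𝓘(ℝ, E) x₀).source) :
    ∀ᶠ w in 𝓝[s] z, f w ∈ (extChartAt 𝓘(ℝ, E) x₀).source :=
  hf.eventually ((isOpen_extChartAt_source x₀).mem_nhds hz)

omit [IsManifold 𝓘(ℝ, E) ∞ M] in
theorem hasDerivWithinAt_extChartAt_self {γ : ℝ → M} {t : ℝ}
    (hγ : MDifferentiableWithinAt 𝓘(ℝ, ℝ) 𝓘(ℝ, E) γ (Icc 0 1) t) :
    HasDerivWithinAt (fun τ => extChartAt 𝓘(ℝ, E) (γ t) (γ τ)) (velocityE γ t) (Icc 0 1) t := by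
  have h := hγ.hasMFDerivWithinAt.2
  simp only [writtenInExtChartAt, mfld_simps] at h
  exact HasFDerivWithinAt.hasDerivWithinAt h

theorem hasDerivWithinAt_extChartAt {γ : ℝ → M} {t : ℝ} {x₀ : M} (ht : t ∈ Icc (0 : ℝ) 1)
    (hγ : MDifferentiableWithinAt 𝓘(ℝ, ℝ) 𝓘(ℝ, E) γ (Icc 0 1) t)
    (hx : γ t ∈ (extChartAt 𝓘(ℝ, E) x₀).source) :
    HasDerivWithinAt (fun τ => extChartAt 𝓘(ℝ, E) x₀ (γ τ))
      (toCoord x₀ (γ t) (velocityE γ t)) (Icc 0 1) t := by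
  have hs := mem_extChartAt_source (I := 𝓘(ℝ, E)) (γ t)
  have h := ((contDiffAt_transition hs hx).differentiableAt
    (by simp)).hasFDerivAt.comp_hasDerivWithinAt t (hasDerivWithinAt_extChartAt_self hγ)
  rw [← toCoord_self (E := E) (γ t) (velocityE γ t), fderiv_transition_toCoord hs hx] at h
  refine h.congr_of_eventuallyEq_of_mem ?_ ht
  filter_upwards [eventually_mem_source hγ.continuousWithinAt hs] with τ hτ
  rw [Function.comp_apply, transition_apply x₀ hτ]

theorem fieldDifferentiableAtE_iff {γ : ℝ → M} {V : ℝ → E} {t : ℝ}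
    (hγ : MDifferentiableWithinAt 𝓘(ℝ, ℝ) 𝓘(ℝ, E) γ (Icc 0 1) t) :
    FieldDifferentiableAtE γ V t ↔
      DifferentiableWithinAt ℝ (fieldCoordE γ V (γ t)) (Icc 0 1) t := by
  rw [← mdifferentiableWithinAt_iff_differentiableWithinAt]
  have h : FieldDifferentiableAtE γ V t ↔ _ := mdifferentiableWithinAt_totalSpace 𝓘(ℝ, E)
    (fun τ => (⟨γ τ, V τ⟩ : TangentBundle 𝓘(ℝ, E) M)) (s := Icc 0 1) (x₀ := t)
  rw [h]
  exact and_iff_right hγ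

theorem hasDerivWithinAt_fieldCoordE_transition {γ : ℝ → M} {V : ℝ → E} {t : ℝ} {x₀ x₁ : M}
    {v' : E} (ht : t ∈ Icc (0 : ℝ) 1)
    (hγ : MDifferentiableWithinAt 𝓘(ℝ, ℝ) 𝓘(ℝ, E) γ (Icc 0 1) t)
    (h₀ : γ t ∈ (extChartAt 𝓘(ℝ, E) x₀).source) (h₁ : γ t ∈ (extChartAt 𝓘(ℝ, E) x₁).source)
    (hV : HasDerivWithinAt (fieldCoordE γ V x₀) v' (Icc 0 1) t) :
    HasDerivWithinAt (fieldCoordE γ V x₁)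
      (fderiv ℝ (fderiv ℝ (transition x₀ x₁)) (extChartAt 𝓘(ℝ, E) x₀ (γ t))
          (toCoord x₀ (γ t) (velocityE γ t)) (toCoord x₀ (γ t) (V t)) +
        fderiv ℝ (transition x₀ x₁) (extChartAt 𝓘(ℝ, E) x₀ (γ t)) v') (Icc 0 1) t := by
  have hD := ((contDiffAt_fderiv_transition h₀ h₁).differentiableAt
    (by simp)).hasFDerivAt.comp_hasDerivWithinAt t (hasDerivWithinAt_extChartAt ht hγ h₀)
  refine (hD.clm_apply hV).congr_of_eventuallyEq_of_mem ?_ ht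
  filter_upwards [eventually_mem_source hγ.continuousWithinAt h₀,
    eventually_mem_source hγ.continuousWithinAt h₁] with τ hτ₀ hτ₁
  exact (fderiv_transition_toCoord hτ₀ hτ₁ (V τ)).symm

theorem covDerivE_eq (g : RMetric E M) (γ : ℝ → M) (V : ℝ → E) (t : ℝ) :
    covDerivE g γ V t = derivWithin (fieldCoordE γ V (γ t)) (Icc 0 1) t +
      christoffelL g (γ t) (extChartAt 𝓘(ℝ, E) (γ t) (γ t)) (velocityE γ t) (V t) := by
  rw [← christoffel_eq_christoffelL]
  rfl

theorem FieldDifferentiableAtE.hasCovDerivAtE (g : RMetric E M) {γ : ℝ → M} {V : ℝ → E} {t : ℝ}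
    (hV : FieldDifferentiableAtE γ V t) : HasCovDerivAtE g γ V (covDerivE g γ V t) t :=
  ⟨hV, rfl⟩

section FiniteDimensional

variable [FiniteDimensional ℝ E]

theorem hasCovDerivAtE_of_hasDerivWithinAt (g : RMetric E M) {γ : ℝ → M} {V : ℝ → E} {t : ℝ}
    {x₀ : M} {w : E} (ht : t ∈ Icc (0 : ℝ) 1)
    (hγ : MDifferentiableWithinAt 𝓘(ℝ, ℝ) 𝓘(ℝ, E) γ (Icc 0 1) t)
    (h₀ : γ t ∈ (extChartAt 𝓘(ℝ, E) x₀).source)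
    (hV : HasDerivWithinAt (fieldCoordE γ V x₀) (toCoord x₀ (γ t) w -
      christoffelL g x₀ (extChartAt 𝓘(ℝ, E) x₀ (γ t)) (toCoord x₀ (γ t) (velocityE γ t))
        (toCoord x₀ (γ t) (V t))) (Icc 0 1) t) :
    HasCovDerivAtE g γ V w t := by
  have hs := mem_extChartAt_source (I := 𝓘(ℝ, E)) (γ t)
  have h := hasDerivWithinAt_fieldCoordE_transition ht hγ h₀ hs hV
  refine ⟨(fieldDifferentiableAtE_iff hγ).2 h.differentiableWithinAt, ?_⟩
  rw [covDerivE_eq, h.derivWithin (uniqueDiffWithinAt_unitIcc ht), map_sub,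
    christoffelL_transition g h₀ hs]
  simp only [fderiv_transition_toCoord h₀ hs, toCoord_self]
  abel

theorem HasCovDerivAtE.hasDerivWithinAt {g : RMetric E M} {γ : ℝ → M} {V : ℝ → E} {t : ℝ}
    {x₀ : M} {w : E} (hV : HasCovDerivAtE g γ V w t) (ht : t ∈ Icc (0 : ℝ) 1)
    (hγ : MDifferentiableWithinAt 𝓘(ℝ, ℝ) 𝓘(ℝ, E) γ (Icc 0 1) t)
    (h₀ : γ t ∈ (extChartAt 𝓘(ℝ, E) x₀).source) :
    HasDerivWithinAt (fieldCoordE γ V x₀) (toCoord x₀ (γ t) w -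
      christoffelL g x₀ (extChartAt 𝓘(ℝ, E) x₀ (γ t)) (toCoord x₀ (γ t) (velocityE γ t))
        (toCoord x₀ (γ t) (V t))) (Icc 0 1) t := by
  have hs := mem_extChartAt_source (I := 𝓘(ℝ, E)) (γ t)
  have h := hasDerivWithinAt_fieldCoordE_transition ht hγ hs h₀
    ((fieldDifferentiableAtE_iff hγ).1 hV.1).hasDerivWithinAt
  convert! h using 1
  rw [← hV.2, covDerivE_eq, ← fderiv_transition_toCoord hs h₀, toCoord_self, map_add,
    christoffelL_transition g hs h₀, ← fderiv_transition_toCoord hs h₀ (velocityE γ t),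
    ← fderiv_transition_toCoord hs h₀ (V t)]
  simp only [toCoord_self]
  abel

theorem hasCovDerivAtE_iff {g : RMetric E M} {γ : ℝ → M} {V : ℝ → E} {t : ℝ}
    {x₀ : M} {w : E} (ht : t ∈ Icc (0 : ℝ) 1)
    (hγ : MDifferentiableWithinAt 𝓘(ℝ, ℝ) 𝓘(ℝ, E) γ (Icc 0 1) t)
    (h₀ : γ t ∈ (extChartAt 𝓘(ℝ, E) x₀).source) :
    HasCovDerivAtE g γ V w t ↔ HasDerivWithinAt (fieldCoordE γ V x₀) (toCoord x₀ (γ t) w -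
      christoffelL g x₀ (extChartAt 𝓘(ℝ, E) x₀ (γ t)) (toCoord x₀ (γ t) (velocityE γ t))
        (toCoord x₀ (γ t) (V t))) (Icc 0 1) t :=
  ⟨fun h => h.hasDerivWithinAt ht hγ h₀, hasCovDerivAtE_of_hasDerivWithinAt g ht hγ h₀⟩

theorem HasCovDerivAtE.add {g : RMetric E M} {γ : ℝ → M} {V W : ℝ → E} {v w : E} {t : ℝ}
    (hV : HasCovDerivAtE g γ V v t) (hW : HasCovDerivAtE g γ W w t) (ht : t ∈ Icc (0 : ℝ) 1)
    (hγ : MDifferentiableWithinAt 𝓘(ℝ, ℝ) 𝓘(ℝ, E) γ (Icc 0 1) t) :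
    HasCovDerivAtE g γ (fun τ => V τ + W τ) (v + w) t := by
  have hs := mem_extChartAt_source (I := 𝓘(ℝ, E)) (γ t)
  rw [hasCovDerivAtE_iff ht hγ hs] at hV hW ⊢
  refine ((hV.add hW).congr_deriv ?_).congr_of_mem (fun τ _ => map_add _ _ _) ht
  simp only [map_add]
  abel

theorem HasCovDerivAtE.smul {g : RMetric E M} {γ : ℝ → M} {V : ℝ → E} {f : ℝ → ℝ} {v : E}
    {f' t : ℝ} (hf : HasDerivWithinAt f f' (Icc 0 1) t) (hV : HasCovDerivAtE g γ V v t)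
    (ht : t ∈ Icc (0 : ℝ) 1) (hγ : MDifferentiableWithinAt 𝓘(ℝ, ℝ) 𝓘(ℝ, E) γ (Icc 0 1) t) :
    HasCovDerivAtE g γ (fun τ => f τ • V τ) (f t • v + f' • V t) t := by
  have hs := mem_extChartAt_source (I := 𝓘(ℝ, E)) (γ t)
  rw [hasCovDerivAtE_iff ht hγ hs] at hV ⊢
  refine ((hf.smul hV).congr_deriv ?_).congr_of_mem (fun τ _ => map_smul _ _ _) ht
  simp only [map_add, map_smul, smul_sub, fieldCoordE]
  abel

theorem HasCovDerivAtE.inner {g : RMetric E M} {γ : ℝ → M} {V W : ℝ → E} {v w : E} {t : ℝ}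
    (hV : HasCovDerivAtE g γ V v t) (hW : HasCovDerivAtE g γ W w t) (ht : t ∈ Icc (0 : ℝ) 1)
    (hγ : MDifferentiableWithinAt 𝓘(ℝ, ℝ) 𝓘(ℝ, E) γ (Icc 0 1) t) :
    HasDerivWithinAt (fun τ => innerE g (γ τ) (V τ) (W τ))
      (innerE g (γ t) v (W t) + innerE g (γ t) (V t) w) (Icc 0 1) t := by
  have hs := mem_extChartAt_source (I := 𝓘(ℝ, E)) (γ t)
  have hy := (extChartAt 𝓘(ℝ, E) (γ t)).map_source hs
  have hg := (hasFDerivAt_chartMetric g (γ t) hy).comp_hasDerivWithinAt t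
    (hasDerivWithinAt_extChartAt ht hγ hs)
  have h := ((hg.clm_apply (hV.hasDerivWithinAt ht hγ hs)).clm_apply
    (hW.hasDerivWithinAt ht hγ hs)).congr_of_eventuallyEq_of_mem
    (f₁ := fun τ => innerE g (γ τ) (V τ) (W τ)) (by
      filter_upwards [eventually_mem_source hγ.continuousWithinAt hs] with τ hτ
      exact (chartMetric_toCoord g hτ _ _).symm) ht
  refine h.congr_deriv ?_
  simp only [Function.comp_apply, add_apply, fieldCoordE, map_sub, sub_apply,
    ← chartMetric_toCoord g hs]
  rw [fderiv_chartMetric_eq_christoffelL g (γ t) hy]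
  ring

end FiniteDimensional

end

/-! ### Parallel transport -/

section

variable {E : Type*} [NormedAddCommGroup E] [NormedSpace ℝ E]
  {M : Type*} [TopologicalSpace M] [ChartedSpace E M] [IsManifold 𝓘(ℝ, E) ∞ M]

theorem exists_short_Icc {p : ℝ → Prop} {t : ℝ} (ht : t ∈ Icc (0 : ℝ) 1)
    (hp : ∀ᶠ τ in 𝓝[Icc 0 1] t, p τ) (C : ℝ) :
    ∃ ε > 0, ∃ α β, α < β ∧ Icc (0 : ℝ) 1 ∩ Metric.ball t ε ⊆ Icc α β ∧ Icc α β ⊆ Icc 0 1 ∧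
      (∀ τ ∈ Icc α β, p τ) ∧ C * (β - α) < 1 := by
  obtain ⟨r, hr, hrp⟩ := Metric.mem_nhdsWithin_iff.1 hp
  have hsmall : ∀ᶠ ε in 𝓝[>] (0 : ℝ), |C| * (2 * ε) < 1 :=
    nhdsWithin_le_nhds <| (Continuous.tendsto' (by fun_prop) (0 : ℝ) 0
      (by simp)).eventually_lt_const one_pos
  obtain ⟨ε, hεC, hε, hεr⟩ := (hsmall.and (Ioo_mem_nhdsGT hr)).exists
  have hsub : Icc (max 0 (t - ε)) (min 1 (t + ε)) ⊆ Icc 0 1 :=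
    Icc_subset_Icc (le_max_left _ _) (min_le_left _ _)
  have hlt : max 0 (t - ε) < min 1 (t + ε) :=
    max_lt (lt_min one_pos (by linarith [ht.1])) (lt_min (by linarith [ht.2]) (by linarith))
  refine ⟨ε, hε, max 0 (t - ε), min 1 (t + ε), hlt, fun τ hτ => ?_, hsub, fun τ hτ => ?_, ?_⟩
  · have hball := hτ.2
    rw [Real.ball_eq_Ioo] at hball
    exact ⟨max_le hτ.1.1 hball.1.le, le_min hτ.1.2 hball.2.le⟩
  · refine hrp ⟨?_, hsub hτ⟩
    rw [Real.ball_eq_Ioo]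
    exact ⟨by linarith [le_max_right 0 (t - ε), hτ.1], by linarith [min_le_right 1 (t + ε), hτ.2]⟩
  · calc C * (min 1 (t + ε) - max 0 (t - ε))
        ≤ |C| * (min 1 (t + ε) - max 0 (t - ε)) :=
          mul_le_mul_of_nonneg_right (le_abs_self C) (sub_pos.2 hlt).le
      _ ≤ |C| * (2 * ε) := by
          gcongr
          linarith [le_max_right 0 (t - ε), min_le_right 1 (t + ε)]
      _ < 1 := hεC

theorem unitIcc_induction {P : Set ℝ → Prop}
    (hloc : ∀ t ∈ Icc (0 : ℝ) 1, ∃ U, IsOpen U ∧ IsPreconnected U ∧ t ∈ U ∧ P (Icc 0 1 ∩ U))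
    (hunion : ∀ U V, IsOpen U → IsOpen V → IsPreconnected U → IsPreconnected V →
      (Icc (0 : ℝ) 1 ∩ (U ∩ V)).Nonempty → P (Icc 0 1 ∩ U) → P (Icc 0 1 ∩ V) →
      P (Icc 0 1 ∩ (U ∪ V))) :
    P (Icc 0 1) := by
  choose! U hopen hconn hmem hU using hloc
  obtain ⟨t, ht₀, -, ⟨N, hN⟩, ht⟩ := exists_monotone_Icc_subset_open_cover_Icc zero_le_one
    (c := fun t : Icc (0 : ℝ) 1 => Subtype.val ⁻¹' U t)
    (fun t => (hopen t t.2).preimage continuous_subtype_val)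
    (fun t _ => mem_iUnion.2 ⟨t, hmem t t.2⟩)
  have hstep : ∀ n, ∃ V, IsOpen V ∧ IsPreconnected V ∧ Icc (0 : ℝ) (t n) ⊆ V ∧
      P (Icc 0 1 ∩ V) := fun n => by
    induction n with
    | zero =>
      have h₀ : (0 : ℝ) ∈ Icc (0 : ℝ) 1 := left_mem_Icc.2 zero_le_one
      refine ⟨U 0, hopen 0 h₀, hconn 0 h₀, ?_, hU 0 h₀⟩
      rw [ht₀, Icc_self, singleton_subset_iff]
      exact hmem 0 h₀
    | succ n ih =>
      obtain ⟨V, hVopen, hVconn, hV, hPV⟩ := ih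
      obtain ⟨i, hi⟩ := ht n
      by_cases hn : t (n + 1) ≤ t n
      · exact ⟨V, hVopen, hVconn, (Icc_subset_Icc_right (Subtype.coe_le_coe.2 hn)).trans hV, hPV⟩
      have hnV : (t n : ℝ) ∈ V := hV (right_mem_Icc.2 (t n).2.1)
      have hni : (t n : ℝ) ∈ U i := hi (left_mem_Icc.2 (le_of_not_ge hn))
      refine ⟨V ∪ U i, hVopen.union (hopen i i.2), hVconn.union _ hnV hni (hconn i i.2), ?_,
        hunion V (U i) hVopen (hopen i i.2) hVconn (hconn i i.2) ⟨t n, (t n).2, hnV, hni⟩ hPV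
          (hU i i.2)⟩
      intro τ hτ
      rcases le_total τ (t n) with hle | hge
      · exact .inl (hV ⟨hτ.1, hle⟩)
      · exact .inr (hi (a := ⟨τ, hτ.1, hτ.2.trans (t (n + 1)).2.2⟩) ⟨hge, hτ.2⟩)
  obtain ⟨V, -, -, hV, hPV⟩ := hstep N
  rw [hN N le_rfl] at hV
  rwa [inter_eq_left.2 hV] at hPV

/-- The vector field `V` along `γ` is parallel at `t`. -/
def IsParallelAtE (g : RMetric E M) (γ : ℝ → M) (V : ℝ → E) (t : ℝ) : Prop :=
  HasCovDerivAtE g γ V 0 t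

theorem FieldDifferentiableAtE.congr {γ : ℝ → M} {V W : ℝ → E} {t : ℝ}
    (hV : FieldDifferentiableAtE γ V t) (ht : t ∈ Icc (0 : ℝ) 1) (h : V =ᶠ[𝓝[Icc 0 1] t] W) :
    FieldDifferentiableAtE γ W t := by
  refine MDifferentiableWithinAt.congr_of_eventuallyEq hV ?_ ?_
  · filter_upwards [h] with τ hτ
    rw [hτ]
  · rw [h.self_of_nhdsWithin ht]

theorem covDerivE_congr (g : RMetric E M) {γ : ℝ → M} {V W : ℝ → E} {t : ℝ}
    (ht : t ∈ Icc (0 : ℝ) 1) (h : V =ᶠ[𝓝[Icc 0 1] t] W) :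
    covDerivE g γ V t = covDerivE g γ W t := by
  rw [covDerivE_eq, covDerivE_eq, h.self_of_nhdsWithin ht]
  congr 1
  refine Filter.EventuallyEq.derivWithin_eq ?_ ?_
  · filter_upwards [h] with τ hτ
    simp only [fieldCoordE, hτ]
  · simp only [fieldCoordE, h.self_of_nhdsWithin ht]

theorem HasCovDerivAtE.congr {g : RMetric E M} {γ : ℝ → M} {V W : ℝ → E} {w : E} {t : ℝ}
    (hV : HasCovDerivAtE g γ V w t) (ht : t ∈ Icc (0 : ℝ) 1) (h : V =ᶠ[𝓝[Icc 0 1] t] W) :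
    HasCovDerivAtE g γ W w t :=
  ⟨hV.1.congr ht h, (covDerivE_congr g ht h).symm.trans hV.2⟩

variable [FiniteDimensional ℝ E] {g : RMetric E M} {γ : ℝ → M} {V W : ℝ → E} {t t₁ t₂ : ℝ}

theorem IsParallelAtE.add (hV : IsParallelAtE g γ V t) (hW : IsParallelAtE g γ W t)
    (ht : t ∈ Icc (0 : ℝ) 1)
    (hγ : MDifferentiableWithinAt 𝓘(ℝ, ℝ) 𝓘(ℝ, E) γ (Icc 0 1) t) :
    IsParallelAtE g γ (fun τ => V τ + W τ) t := by
  have h := HasCovDerivAtE.add hV hW ht hγ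
  rwa [add_zero] at h

theorem IsParallelAtE.const_smul (hV : IsParallelAtE g γ V t) (r : ℝ) (ht : t ∈ Icc (0 : ℝ) 1)
    (hγ : MDifferentiableWithinAt 𝓘(ℝ, ℝ) 𝓘(ℝ, E) γ (Icc 0 1) t) :
    IsParallelAtE g γ (fun τ => r • V τ) t := by
  have h := HasCovDerivAtE.smul (hasDerivWithinAt_const t _ r) hV ht hγ
  rwa [smul_zero, zero_smul, add_zero] at h

theorem innerE_eq_of_isParallelAtE {K : Set ℝ} (hK : K ⊆ Icc 0 1) (hconv : Convex ℝ K)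
    (hγ : ContMDiffOn 𝓘(ℝ, ℝ) 𝓘(ℝ, E) ∞ γ (Icc 0 1)) (hV : ∀ t ∈ K, IsParallelAtE g γ V t)
    (hW : ∀ t ∈ K, IsParallelAtE g γ W t) (h₁ : t₁ ∈ K) (h₂ : t₂ ∈ K) :
    innerE g (γ t₂) (V t₂) (W t₂) = innerE g (γ t₁) (V t₁) (W t₁) := by
  have hd : ∀ t ∈ K, HasDerivWithinAt (fun τ => innerE g (γ τ) (V τ) (W τ)) 0 K t := fun t ht => by
    have h := HasCovDerivAtE.inner (hV t ht) (hW t ht) (hK ht)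
      ((hγ t (hK ht)).mdifferentiableWithinAt (by simp))
    simp only [map_zero, zero_apply, add_zero] at h
    exact h.mono hK
  have h := Convex.norm_image_sub_le_of_norm_hasDerivWithin_le (C := 0) hd (by simp) hconv h₁ h₂
  rwa [zero_mul, norm_le_zero_iff, sub_eq_zero] at h

theorem eq_of_isParallelAtE {K : Set ℝ} (hK : K ⊆ Icc 0 1) (hconv : Convex ℝ K)
    (hγ : ContMDiffOn 𝓘(ℝ, ℝ) 𝓘(ℝ, E) ∞ γ (Icc 0 1)) (hV : ∀ t ∈ K, IsParallelAtE g γ V t)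
    (hW : ∀ t ∈ K, IsParallelAtE g γ W t) (h₁ : t₁ ∈ K) (h : V t₁ = W t₁) :
    ∀ t ∈ K, V t = W t := by
  intro t ht
  have hmd := fun t (ht : t ∈ K) => (hγ t (hK ht)).mdifferentiableWithinAt (n := ∞) (by simp)
  have hD : ∀ t ∈ K, IsParallelAtE g γ (fun τ => V τ + (-1 : ℝ) • W τ) t := fun t ht =>
    (hV t ht).add ((hW t ht).const_smul (-1) (hK ht) (hmd t ht)) (hK ht) (hmd t ht)
  by_contra hne
  have hpos : 0 < innerE g (γ t) (V t + (-1 : ℝ) • W t) (V t + (-1 : ℝ) • W t) :=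
    innerE_pos g _ (by rwa [neg_one_smul, ← sub_eq_add_neg, sub_ne_zero])
  rw [innerE_eq_of_isParallelAtE hK hconv hγ hD hD h₁ ht, h, neg_one_smul, add_neg_cancel,
    map_zero] at hpos
  exact lt_irrefl 0 hpos

omit [FiniteDimensional ℝ E] in
theorem continuousWithinAt_fieldCoordE_velocityE {x₀ : M} (ht : t ∈ Icc (0 : ℝ) 1)
    (hγ : ContMDiffOn 𝓘(ℝ, ℝ) 𝓘(ℝ, E) ∞ γ (Icc 0 1))
    (hx : γ t ∈ (extChartAt 𝓘(ℝ, E) x₀).source) :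
    ContinuousWithinAt (fieldCoordE (E := E) γ (velocityE γ) x₀) (Icc 0 1) t := by
  have hderiv := ((contDiffWithinAt_extChartAt_comp (hγ t ht) hx).fderivWithin_right (m := 0)
    (uniqueDiffOn_Icc zero_lt_one) (by simp) ht).continuousWithinAt.clm_apply
    (continuousWithinAt_const (b := (1 : ℝ)))
  refine hderiv.congr_of_eventuallyEq_of_mem ?_ ht
  filter_upwards [eventually_mem_source (hγ t ht).continuousWithinAt hx, self_mem_nhdsWithin]
    with τ hτ hτ'
  exact ((hasDerivWithinAt_extChartAt hτ' ((hγ τ hτ').mdifferentiableWithinAt (by simp))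
    hτ).derivWithin (uniqueDiffWithinAt_unitIcc hτ')).symm

/-- The coefficient `-Γ(γ', ·)` of the equation of parallel transport along `γ` in the chart at
`x₀`. -/
def parallelCoeff (g : RMetric E M) (γ : ℝ → M) (x₀ : M) (t : ℝ) : E →L[ℝ] E :=
  -christoffelL g x₀ (extChartAt 𝓘(ℝ, E) x₀ (γ t)) (fieldCoordE γ (velocityE γ) x₀ t)

theorem continuousWithinAt_parallelCoeff {x₀ : M} (ht : t ∈ Icc (0 : ℝ) 1)
    (hγ : ContMDiffOn 𝓘(ℝ, ℝ) 𝓘(ℝ, E) ∞ γ (Icc 0 1))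
    (hx : γ t ∈ (extChartAt 𝓘(ℝ, E) x₀).source) :
    ContinuousWithinAt (parallelCoeff g γ x₀) (Icc 0 1) t := by
  have hΓ : ContinuousWithinAt (fun τ => christoffelL g x₀ (extChartAt 𝓘(ℝ, E) x₀ (γ τ)))
      (Icc 0 1) t :=
    (contDiffAt_christoffelL g x₀
      ((extChartAt 𝓘(ℝ, E) x₀).map_source hx)).continuousAt.comp_continuousWithinAt
      (f := fun τ => extChartAt 𝓘(ℝ, E) x₀ (γ τ))
      (contDiffWithinAt_extChartAt_comp (hγ t ht) hx).continuousWithinAt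
  exact (hΓ.clm_apply (continuousWithinAt_fieldCoordE_velocityE ht hγ hx)).neg

theorem isParallelAtE_iff {x₀ : M} (ht : t ∈ Icc (0 : ℝ) 1)
    (hγ : MDifferentiableWithinAt 𝓘(ℝ, ℝ) 𝓘(ℝ, E) γ (Icc 0 1) t)
    (hx : γ t ∈ (extChartAt 𝓘(ℝ, E) x₀).source) :
    IsParallelAtE g γ V t ↔ HasDerivWithinAt (fieldCoordE γ V x₀)
      (parallelCoeff g γ x₀ t (fieldCoordE γ V x₀ t)) (Icc 0 1) t := by
  rw [IsParallelAtE, hasCovDerivAtE_iff ht hγ hx, map_zero, zero_sub]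
  rfl

/-- Every initial condition at a time of `K` extends to a vector field parallel on `K`. -/
def HasParallelFieldsOn (g : RMetric E M) (γ : ℝ → M) (K : Set ℝ) : Prop :=
  ∀ t₀ ∈ K, ∀ w : E, ∃ W : ℝ → E, W t₀ = w ∧ ∀ τ ∈ K, IsParallelAtE g γ W τ

theorem exists_hasParallelFieldsOn_ball (g : RMetric E M) (ht : t ∈ Icc (0 : ℝ) 1)
    (hγ : ContMDiffOn 𝓘(ℝ, ℝ) 𝓘(ℝ, E) ∞ γ (Icc 0 1)) :
    ∃ ε > 0, HasParallelFieldsOn g γ (Icc 0 1 ∩ Metric.ball t ε) := by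
  let x₀ := γ t
  have hx := mem_extChartAt_source (I := 𝓘(ℝ, E)) (γ t)
  have hbound : ∀ᶠ τ in 𝓝[Icc 0 1] t, γ τ ∈ (extChartAt 𝓘(ℝ, E) x₀).source ∧
      ‖parallelCoeff g γ x₀ τ‖ ≤ ‖parallelCoeff g γ x₀ t‖ + 1 :=
    (eventually_mem_source (hγ t ht).continuousWithinAt hx).and
      ((continuousWithinAt_parallelCoeff ht hγ hx).norm.eventually
        (Iic_mem_nhds (lt_add_one _)))
  obtain ⟨ε, hε, α, β, -, hball, hsub, hαβ, hshort⟩ :=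
    exists_short_Icc ht hbound (‖parallelCoeff g γ x₀ t‖ + 1)
  refine ⟨ε, hε, fun t₀ ht₀ w => ?_⟩
  obtain ⟨x, hxt₀, hode⟩ := exists_hasDerivWithinAt_of_short
    (fun τ hτ => (continuousWithinAt_parallelCoeff (hsub hτ) hγ (hαβ τ hτ).1).mono hsub)
    (fun τ hτ => (hαβ τ hτ).2) hshort (hball ht₀) (toCoord x₀ (γ t₀) w)
  have hcoord : ∀ τ ∈ Icc α β, fieldCoordE γ (fun τ => ofCoord x₀ (γ τ) (x τ)) x₀ τ = x τ :=
    fun τ hτ => toCoord_ofCoord (hαβ τ hτ).1 _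
  refine ⟨fun τ => ofCoord x₀ (γ τ) (x τ), ?_, fun τ hτ => ?_⟩
  · beta_reduce
    rw [hxt₀]
    exact ofCoord_toCoord (hαβ t₀ (hball ht₀)).1 w
  · have hnhds : Icc α β ∈ 𝓝[Icc 0 1] τ :=
      mem_of_superset (inter_mem self_mem_nhdsWithin
        (mem_nhdsWithin_of_mem_nhds (Metric.isOpen_ball.mem_nhds hτ.2))) hball
    rw [isParallelAtE_iff hτ.1 ((hγ τ hτ.1).mdifferentiableWithinAt (by simp))
      (hαβ τ (hball hτ)).1, hcoord τ (hball hτ)]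
    exact ((hode τ (hball hτ)).mono_of_mem_nhdsWithin hnhds).congr_of_eventuallyEq_of_mem
      (eventually_of_mem hnhds hcoord) hτ.1

theorem HasParallelFieldsOn.union (hγ : ContMDiffOn 𝓘(ℝ, ℝ) 𝓘(ℝ, E) ∞ γ (Icc 0 1))
    {U₁ U₂ : Set ℝ} (hU₁ : IsOpen U₁) (hU₂ : IsOpen U₂) (hconn₁ : IsPreconnected U₁)
    (hconn₂ : IsPreconnected U₂) (hne : (Icc (0 : ℝ) 1 ∩ (U₁ ∩ U₂)).Nonempty)
    (h₁ : HasParallelFieldsOn g γ (Icc 0 1 ∩ U₁)) (h₂ : HasParallelFieldsOn g γ (Icc 0 1 ∩ U₂)) :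
    HasParallelFieldsOn g γ (Icc 0 1 ∩ (U₁ ∪ U₂)) := by
  classical
  rintro t₀ ⟨ht₀, hU⟩ w
  wlog h : t₀ ∈ U₁ generalizing U₁ U₂
  · rw [union_comm]
    exact this hU₂ hU₁ hconn₂ hconn₁ (inter_comm U₁ U₂ ▸ hne) h₂ h₁ hU.symm (hU.resolve_left h)
  obtain ⟨c, hc, hc₁, hc₂⟩ := hne
  obtain ⟨V, hVt₀, hV⟩ := h₁ t₀ ⟨ht₀, h⟩ w
  obtain ⟨W, hWc, hW⟩ := h₂ c ⟨hc, hc₂⟩ (V c)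
  have hVW : ∀ τ ∈ Icc (0 : ℝ) 1 ∩ (U₁ ∩ U₂), V τ = W τ :=
    eq_of_isParallelAtE inter_subset_left
      ((convex_Icc _ _).inter (hconn₁.ordConnected.convex.inter hconn₂.ordConnected.convex)) hγ
      (fun τ hτ => hV τ ⟨hτ.1, hτ.2.1⟩) (fun τ hτ => hW τ ⟨hτ.1, hτ.2.2⟩) ⟨hc, hc₁, hc₂⟩ hWc.symm
  refine ⟨U₁.piecewise V W, by rw [piecewise_eq_of_mem _ _ _ h, hVt₀], fun τ ⟨hτ, hτU⟩ => ?_⟩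
  rcases hτU with hτ₁ | hτ₂
  · refine HasCovDerivAtE.congr (hV τ ⟨hτ, hτ₁⟩) hτ ?_
    filter_upwards [mem_nhdsWithin_of_mem_nhds (hU₁.mem_nhds hτ₁)] with σ hσ
    exact (piecewise_eq_of_mem _ _ _ hσ).symm
  · refine HasCovDerivAtE.congr (hW τ ⟨hτ, hτ₂⟩) hτ ?_
    filter_upwards [self_mem_nhdsWithin, mem_nhdsWithin_of_mem_nhds (hU₂.mem_nhds hτ₂)]
      with σ hσ hσ₂
    by_cases hσ₁ : σ ∈ U₁
    · rw [piecewise_eq_of_mem _ _ _ hσ₁, hVW σ ⟨hσ, hσ₁, hσ₂⟩]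
    · rw [piecewise_eq_of_notMem _ _ _ hσ₁]

theorem hasParallelFieldsOn_unitIcc (g : RMetric E M)
    (hγ : ContMDiffOn 𝓘(ℝ, ℝ) 𝓘(ℝ, E) ∞ γ (Icc 0 1)) : HasParallelFieldsOn g γ (Icc 0 1) := by
  refine unitIcc_induction (fun t ht => ?_)
    (fun U₁ U₂ hU₁ hU₂ hconn₁ hconn₂ => HasParallelFieldsOn.union hγ hU₁ hU₂ hconn₁ hconn₂)
  obtain ⟨ε, hε, h⟩ := exists_hasParallelFieldsOn_ball g ht hγ
  exact ⟨Metric.ball t ε, Metric.isOpen_ball, (convex_ball t ε).isPreconnected,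
    Metric.mem_ball_self hε, h⟩

theorem hasTransport (g : RMetric E M) (hγ : ContMDiffOn 𝓘(ℝ, ℝ) 𝓘(ℝ, E) ∞ γ (Icc 0 1)) :
    HasTransport g γ := by
  refine fun t₁ ht₁ => ⟨fun u => ?_, fun V W hV hW h => ?_⟩
  · obtain ⟨V, hV, hV'⟩ := hasParallelFieldsOn_unitIcc g hγ t₁ ht₁ u
    exact ⟨V, hV', hV⟩
  · exact eq_of_isParallelAtE (V := V) (W := W) Subset.rfl (convex_Icc _ _) hγ hV hW ht₁ h

/-- Parallel transport, as a map on the model space. -/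
def transportE (g : RMetric E M) (γ : ℝ → M) (t₁ t₂ : ℝ) (u : E) : E :=
  transport (E := E) g γ t₁ t₂ u

theorem transportE_eq_of_isParallelAtE (hγ : ContMDiffOn 𝓘(ℝ, ℝ) 𝓘(ℝ, E) ∞ γ (Icc 0 1))
    (hV : ∀ t ∈ Icc (0 : ℝ) 1, IsParallelAtE g γ V t) (h₁ : t₁ ∈ Icc (0 : ℝ) 1)
    (h₂ : t₂ ∈ Icc (0 : ℝ) 1) : transportE g γ t₁ t₂ (V t₁) = V t₂ := by
  have h : ∃ W : ∀ t, TangentSpace 𝓘(ℝ, E) (γ t), IsParallel g γ W ∧ W t₁ = V t₁ := ⟨V, hV, rfl⟩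
  have hchoose : transportE g γ t₁ t₂ (V t₁) = h.choose t₂ := dif_pos h
  rw [hchoose]
  exact eq_of_isParallelAtE (V := h.choose) (W := V) Subset.rfl (convex_Icc _ _) hγ
    h.choose_spec.1 hV h₁ h.choose_spec.2 t₂ h₂

theorem isParallelAtE_transportE (hγ : ContMDiffOn 𝓘(ℝ, ℝ) 𝓘(ℝ, E) ∞ γ (Icc 0 1))
    (h₁ : t₁ ∈ Icc (0 : ℝ) 1) (u : E) (ht : t ∈ Icc (0 : ℝ) 1) :
    IsParallelAtE g γ (fun τ => transportE g γ t₁ τ u) t := by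
  obtain ⟨V, rfl, hV⟩ := hasParallelFieldsOn_unitIcc g hγ t₁ h₁ u
  refine HasCovDerivAtE.congr (hV t ht) ht ?_
  filter_upwards [self_mem_nhdsWithin] with τ hτ
  exact (transportE_eq_of_isParallelAtE hγ hV h₁ hτ).symm

theorem transportE_self (hγ : ContMDiffOn 𝓘(ℝ, ℝ) 𝓘(ℝ, E) ∞ γ (Icc 0 1))
    (h₁ : t₁ ∈ Icc (0 : ℝ) 1) (u : E) : transportE g γ t₁ t₁ u = u := by
  obtain ⟨V, rfl, hV⟩ := hasParallelFieldsOn_unitIcc g hγ t₁ h₁ u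
  exact transportE_eq_of_isParallelAtE hγ hV h₁ h₁

theorem transportE_transportE (hγ : ContMDiffOn 𝓘(ℝ, ℝ) 𝓘(ℝ, E) ∞ γ (Icc 0 1)) {t₃ : ℝ}
    (h₁ : t₁ ∈ Icc (0 : ℝ) 1) (h₂ : t₂ ∈ Icc (0 : ℝ) 1) (h₃ : t₃ ∈ Icc (0 : ℝ) 1) (u : E) :
    transportE g γ t₂ t₃ (transportE g γ t₁ t₂ u) = transportE g γ t₁ t₃ u := by
  obtain ⟨V, rfl, hV⟩ := hasParallelFieldsOn_unitIcc g hγ t₁ h₁ u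
  rw [transportE_eq_of_isParallelAtE hγ hV h₁ h₂, transportE_eq_of_isParallelAtE hγ hV h₁ h₃,
    transportE_eq_of_isParallelAtE hγ hV h₂ h₃]

theorem innerE_transportE (hγ : ContMDiffOn 𝓘(ℝ, ℝ) 𝓘(ℝ, E) ∞ γ (Icc 0 1))
    (h₁ : t₁ ∈ Icc (0 : ℝ) 1) (h₂ : t₂ ∈ Icc (0 : ℝ) 1) (u v : E) :
    innerE g (γ t₂) (transportE g γ t₁ t₂ u) v = innerE g (γ t₁) u (transportE g γ t₂ t₁ v) := by
  obtain ⟨V, rfl, hV⟩ := hasParallelFieldsOn_unitIcc g hγ t₁ h₁ u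
  obtain ⟨W, rfl, hW⟩ := hasParallelFieldsOn_unitIcc g hγ t₂ h₂ v
  rw [transportE_eq_of_isParallelAtE hγ hV h₁ h₂, transportE_eq_of_isParallelAtE hγ hW h₂ h₁]
  exact innerE_eq_of_isParallelAtE Subset.rfl (convex_Icc _ _) hγ hV hW h₁ h₂

end

/-! ### Smooth squares -/

section

/-- The parameter domain `[0, 1] × [0, 1]` of a path of curves. -/
def unitSquare : Set (ℝ × ℝ) := Icc 0 1 ×ˢ Icc 0 1

theorem uniqueDiffOn_unitSquare : UniqueDiffOn ℝ unitSquare :=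
  (uniqueDiffOn_Icc zero_lt_one).prod (uniqueDiffOn_Icc zero_lt_one)

theorem mem_closure_interior_unitSquare {z : ℝ × ℝ} (hz : z ∈ unitSquare) :
    z ∈ closure (interior unitSquare) := by
  rw [unitSquare, interior_prod_eq, closure_prod_eq, interior_Icc, closure_Ioo zero_ne_one]
  exact hz

theorem tendsto_unitSquare_left {s t : ℝ} (ht : t ∈ Icc (0 : ℝ) 1) :
    Tendsto (fun σ : ℝ => (σ, t)) (𝓝[Icc 0 1] s) (𝓝[unitSquare] (s, t)) :=
  (Continuous.prodMk_left t).continuousWithinAt.tendsto_nhdsWithin fun _ hσ => ⟨hσ, ht⟩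

theorem tendsto_unitSquare_right {s t : ℝ} (hs : s ∈ Icc (0 : ℝ) 1) :
    Tendsto (fun τ : ℝ => (s, τ)) (𝓝[Icc 0 1] t) (𝓝[unitSquare] (s, t)) :=
  (Continuous.prodMk_right s).continuousWithinAt.tendsto_nhdsWithin fun _ hτ => ⟨hs, hτ⟩

section Calculus

variable {F : Type*} [NormedAddCommGroup F] [NormedSpace ℝ F] {f : ℝ × ℝ → F}
  {L : ℝ × ℝ →L[ℝ] F} {s t : ℝ}

theorem hasDerivWithinAt_left (ht : t ∈ Icc (0 : ℝ) 1)
    (hf : HasFDerivWithinAt f L unitSquare (s, t)) :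
    HasDerivWithinAt (fun σ => f (σ, t)) (L (1, 0)) (Icc 0 1) s := by
  have h : HasDerivWithinAt (fun σ : ℝ => (σ, t)) ((1 : ℝ), (0 : ℝ)) (Icc 0 1) s :=
    (hasDerivWithinAt_id s _).prodMk (hasDerivWithinAt_const s _ t)
  exact hf.comp_hasDerivWithinAt (f := fun σ : ℝ => (σ, t)) s h fun σ hσ => ⟨hσ, ht⟩

theorem hasDerivWithinAt_right (hs : s ∈ Icc (0 : ℝ) 1)
    (hf : HasFDerivWithinAt f L unitSquare (s, t)) :
    HasDerivWithinAt (fun τ => f (s, τ)) (L (0, 1)) (Icc 0 1) t := by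
  have h : HasDerivWithinAt (fun τ : ℝ => (s, τ)) ((0 : ℝ), (1 : ℝ)) (Icc 0 1) t :=
    (hasDerivWithinAt_const t _ s).prodMk (hasDerivWithinAt_id t _)
  exact hf.comp_hasDerivWithinAt (f := fun τ : ℝ => (s, τ)) t h fun τ hτ => ⟨hs, hτ⟩

end Calculus

variable {E : Type*} [NormedAddCommGroup E] [NormedSpace ℝ E]
  {M : Type*} [TopologicalSpace M] [ChartedSpace E M]

/-- `c` is a smooth map from the unit square to `M`. -/
def SmoothSquare (E : Type*) [NormedAddCommGroup E] [NormedSpace ℝ E] {M : Type*}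
    [TopologicalSpace M] [ChartedSpace E M] (c : ℝ → ℝ → M) : Prop :=
  ContMDiffOn 𝓘(ℝ, ℝ × ℝ) 𝓘(ℝ, E) ∞ (fun z : ℝ × ℝ => c z.1 z.2) unitSquare

variable (E) in
/-- A map from the unit square to `M`, read in the chart at `x₀`. -/
def chartSquare (c : ℝ → ℝ → M) (x₀ : M) (z : ℝ × ℝ) : E := extChartAt 𝓘(ℝ, E) x₀ (c z.1 z.2)

variable (E) in
/-- The differential of a map from the unit square to `M`, read in the chart at `x₀`. -/
def chartSquareDeriv (c : ℝ → ℝ → M) (x₀ : M) (z : ℝ × ℝ) : ℝ × ℝ →L[ℝ] E :=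
  fderivWithin ℝ (chartSquare E c x₀) unitSquare z

variable (E) in
/-- The second differential of a map from the unit square to `M`, read in the chart at `x₀`. -/
def chartSquareDeriv₂ (c : ℝ → ℝ → M) (x₀ : M) (z : ℝ × ℝ) : ℝ × ℝ →L[ℝ] ℝ × ℝ →L[ℝ] E :=
  fderivWithin ℝ (chartSquareDeriv E c x₀) unitSquare z

variable {c : ℝ → ℝ → M} {x₀ : M} {z : ℝ × ℝ} {s t : ℝ}

theorem SmoothSquare.contMDiffOn_left (hc : SmoothSquare E c) (ht : t ∈ Icc (0 : ℝ) 1) :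
    ContMDiffOn 𝓘(ℝ, ℝ) 𝓘(ℝ, E) ∞ (fun σ => c σ t) (Icc 0 1) := by
  have h : ContMDiffOn 𝓘(ℝ, ℝ) 𝓘(ℝ, ℝ × ℝ) ∞ (fun σ : ℝ => (σ, t)) (Icc 0 1) :=
    contMDiffOn_iff_contDiffOn.2 (contDiff_id.prodMk contDiff_const).contDiffOn
  exact ContMDiffOn.comp (f := fun σ : ℝ => (σ, t)) hc h fun σ hσ => ⟨hσ, ht⟩

theorem SmoothSquare.contMDiffOn_right (hc : SmoothSquare E c) (hs : s ∈ Icc (0 : ℝ) 1) :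
    ContMDiffOn 𝓘(ℝ, ℝ) 𝓘(ℝ, E) ∞ (c s) (Icc 0 1) := by
  have h : ContMDiffOn 𝓘(ℝ, ℝ) 𝓘(ℝ, ℝ × ℝ) ∞ (fun τ : ℝ => (s, τ)) (Icc 0 1) :=
    contMDiffOn_iff_contDiffOn.2 (contDiff_const.prodMk contDiff_id).contDiffOn
  exact ContMDiffOn.comp (f := fun τ : ℝ => (s, τ)) hc h fun τ hτ => ⟨hs, hτ⟩

theorem SmoothSquare.mdifferentiableWithinAt_left (hc : SmoothSquare E c)
    (hs : s ∈ Icc (0 : ℝ) 1) (ht : t ∈ Icc (0 : ℝ) 1) :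
    MDifferentiableWithinAt 𝓘(ℝ, ℝ) 𝓘(ℝ, E) (fun σ => c σ t) (Icc 0 1) s :=
  (hc.contMDiffOn_left ht s hs).mdifferentiableWithinAt (by simp)

theorem SmoothSquare.mdifferentiableWithinAt_right (hc : SmoothSquare E c)
    (hs : s ∈ Icc (0 : ℝ) 1) (ht : t ∈ Icc (0 : ℝ) 1) :
    MDifferentiableWithinAt 𝓘(ℝ, ℝ) 𝓘(ℝ, E) (c s) (Icc 0 1) t :=
  (hc.contMDiffOn_right hs t ht).mdifferentiableWithinAt (by simp)

theorem SmoothSquare.eventually_mem_source (hc : SmoothSquare E c) (hz : z ∈ unitSquare)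
    (hx : c z.1 z.2 ∈ (extChartAt 𝓘(ℝ, E) x₀).source) :
    ∀ᶠ w in 𝓝[unitSquare] z, c w.1 w.2 ∈ (extChartAt 𝓘(ℝ, E) x₀).source :=
  CurveSpace.eventually_mem_source (hc z hz).continuousWithinAt hx

section

variable [IsManifold 𝓘(ℝ, E) ∞ M]

theorem SmoothSquare.contDiffWithinAt (hc : SmoothSquare E c) (hz : z ∈ unitSquare)
    (hx : c z.1 z.2 ∈ (extChartAt 𝓘(ℝ, E) x₀).source) :
    ContDiffWithinAt ℝ ∞ (chartSquare E c x₀) unitSquare z :=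
  contDiffWithinAt_extChartAt_comp (hc z hz) hx

theorem SmoothSquare.contDiffWithinAt_deriv (hc : SmoothSquare E c) (hz : z ∈ unitSquare)
    (hx : c z.1 z.2 ∈ (extChartAt 𝓘(ℝ, E) x₀).source) :
    ContDiffWithinAt ℝ ∞ (chartSquareDeriv E c x₀) unitSquare z :=
  (hc.contDiffWithinAt hz hx).fderivWithin_right uniqueDiffOn_unitSquare (by simp) hz

theorem SmoothSquare.contDiffWithinAt_deriv₂ (hc : SmoothSquare E c) (hz : z ∈ unitSquare)
    (hx : c z.1 z.2 ∈ (extChartAt 𝓘(ℝ, E) x₀).source) :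
    ContDiffWithinAt ℝ ∞ (chartSquareDeriv₂ E c x₀) unitSquare z :=
  (hc.contDiffWithinAt_deriv hz hx).fderivWithin_right uniqueDiffOn_unitSquare (by simp) hz

theorem SmoothSquare.hasFDerivWithinAt (hc : SmoothSquare E c) (hz : z ∈ unitSquare)
    (hx : c z.1 z.2 ∈ (extChartAt 𝓘(ℝ, E) x₀).source) :
    HasFDerivWithinAt (chartSquare E c x₀) (chartSquareDeriv E c x₀ z) unitSquare z :=
  ((hc.contDiffWithinAt hz hx).differentiableWithinAt (by simp)).hasFDerivWithinAt

theorem SmoothSquare.hasFDerivWithinAt_deriv (hc : SmoothSquare E c) (hz : z ∈ unitSquare)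
    (hx : c z.1 z.2 ∈ (extChartAt 𝓘(ℝ, E) x₀).source) :
    HasFDerivWithinAt (chartSquareDeriv E c x₀) (chartSquareDeriv₂ E c x₀ z) unitSquare z :=
  ((hc.contDiffWithinAt_deriv hz hx).differentiableWithinAt (by simp)).hasFDerivWithinAt

theorem SmoothSquare.chartSquareDeriv₂_symm (hc : SmoothSquare E c) (hz : z ∈ unitSquare)
    (hx : c z.1 z.2 ∈ (extChartAt 𝓘(ℝ, E) x₀).source) (u v : ℝ × ℝ) :
    chartSquareDeriv₂ E c x₀ z u v = chartSquareDeriv₂ E c x₀ z v u :=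
  ((hc.contDiffWithinAt hz hx).isSymmSndFDerivWithinAt
    (by rw [minSmoothness_of_isRCLikeNormedField]; exact WithTop.coe_le_coe.2 le_top)
    uniqueDiffOn_unitSquare (mem_closure_interior_unitSquare hz) hz).eq u v

theorem SmoothSquare.chartSquareDeriv_fst (hc : SmoothSquare E c) (hz : z ∈ unitSquare)
    (hx : c z.1 z.2 ∈ (extChartAt 𝓘(ℝ, E) x₀).source) :
    chartSquareDeriv E c x₀ z (1, 0) =
      toCoord x₀ (c z.1 z.2) (velocityE (fun σ => c σ z.2) z.1) :=
  (uniqueDiffWithinAt_unitIcc hz.1).eq_deriv _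
    (hasDerivWithinAt_left hz.2 (hc.hasFDerivWithinAt hz hx))
    (hasDerivWithinAt_extChartAt hz.1 (hc.mdifferentiableWithinAt_left hz.1 hz.2) hx)

theorem SmoothSquare.chartSquareDeriv_snd (hc : SmoothSquare E c) (hz : z ∈ unitSquare)
    (hx : c z.1 z.2 ∈ (extChartAt 𝓘(ℝ, E) x₀).source) :
    chartSquareDeriv E c x₀ z (0, 1) = toCoord x₀ (c z.1 z.2) (velocityE (c z.1) z.2) :=
  (uniqueDiffWithinAt_unitIcc hz.2).eq_deriv _
    (hasDerivWithinAt_right hz.1 (hc.hasFDerivWithinAt hz hx))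
    (hasDerivWithinAt_extChartAt hz.2 (hc.mdifferentiableWithinAt_right hz.1 hz.2) hx)

theorem SmoothSquare.hasDerivWithinAt_velocityT (hc : SmoothSquare E c)
    (hs : s ∈ Icc (0 : ℝ) 1) (ht : t ∈ Icc (0 : ℝ) 1)
    (hx : c s t ∈ (extChartAt 𝓘(ℝ, E) x₀).source) :
    HasDerivWithinAt (fieldCoordE (fun σ => c σ t) (fun σ => velocityE (c σ) t) x₀)
      (chartSquareDeriv₂ E c x₀ (s, t) (1, 0) (0, 1)) (Icc 0 1) s := by
  have h := (hasDerivWithinAt_left ht (hc.hasFDerivWithinAt_deriv ⟨hs, ht⟩ hx)).clm_apply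
    (hasDerivWithinAt_const s _ ((0 : ℝ), (1 : ℝ)))
  rw [map_zero, add_zero] at h
  refine h.congr_of_eventuallyEq_of_mem ?_ hs
  filter_upwards [(tendsto_unitSquare_left ht).eventually (hc.eventually_mem_source ⟨hs, ht⟩ hx),
    self_mem_nhdsWithin] with σ hσx hσ
  exact (hc.chartSquareDeriv_snd (z := (σ, t)) ⟨hσ, ht⟩ hσx).symm

theorem SmoothSquare.hasDerivWithinAt_velocityS (hc : SmoothSquare E c)
    (hs : s ∈ Icc (0 : ℝ) 1) (ht : t ∈ Icc (0 : ℝ) 1)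
    (hx : c s t ∈ (extChartAt 𝓘(ℝ, E) x₀).source) :
    HasDerivWithinAt (fieldCoordE (c s) (fun τ => velocityE (fun σ => c σ τ) s) x₀)
      (chartSquareDeriv₂ E c x₀ (s, t) (0, 1) (1, 0)) (Icc 0 1) t := by
  have h := (hasDerivWithinAt_right hs (hc.hasFDerivWithinAt_deriv ⟨hs, ht⟩ hx)).clm_apply
    (hasDerivWithinAt_const t _ ((1 : ℝ), (0 : ℝ)))
  rw [map_zero, add_zero] at h
  refine h.congr_of_eventuallyEq_of_mem ?_ ht
  filter_upwards [(tendsto_unitSquare_right hs).eventually (hc.eventually_mem_source ⟨hs, ht⟩ hx),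
    self_mem_nhdsWithin] with τ hτx hτ
  exact (hc.chartSquareDeriv_fst (z := (s, τ)) ⟨hs, hτ⟩ hτx).symm

end

variable [IsManifold 𝓘(ℝ, E) ∞ M] {g : RMetric E M}

/-- The covariant derivative `∇_s c_t` at a point of the unit square. -/
def covVelocityE (g : RMetric E M) (c : ℝ → ℝ → M) (z : ℝ × ℝ) : E :=
  covDerivE g (fun σ => c σ z.2) (fun σ => velocityE (c σ) z.2) z.1

/-- A field of tangent vectors along the unit square with continuous coordinates at `z`. -/
def ContinuousFieldE (c : ℝ → ℝ → M) (X : ℝ × ℝ → E) (z : ℝ × ℝ) : Prop :=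
  ContinuousWithinAt (fun w => toCoord (c z.1 z.2) (c w.1 w.2) (X w)) unitSquare z

theorem SmoothSquare.continuousFieldE_velocityT (hc : SmoothSquare E c) (hz : z ∈ unitSquare) :
    ContinuousFieldE c (fun w => velocityE (c w.1) w.2 : ℝ × ℝ → E) z := by
  have hx := mem_extChartAt_source (I := 𝓘(ℝ, E)) (c z.1 z.2)
  refine ((hc.contDiffWithinAt_deriv hz hx).continuousWithinAt.clm_apply
    (continuousWithinAt_const (b := ((0 : ℝ), (1 : ℝ))))).congr_of_eventuallyEq_of_mem ?_ hz
  filter_upwards [hc.eventually_mem_source hz hx, self_mem_nhdsWithin] with w hwx hw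
  exact (hc.chartSquareDeriv_snd hw hwx).symm

theorem SmoothSquare.continuousFieldE_velocityS (hc : SmoothSquare E c) (hz : z ∈ unitSquare) :
    ContinuousFieldE c (fun w => velocityE (fun σ => c σ w.2) w.1 : ℝ × ℝ → E) z := by
  have hx := mem_extChartAt_source (I := 𝓘(ℝ, E)) (c z.1 z.2)
  refine ((hc.contDiffWithinAt_deriv hz hx).continuousWithinAt.clm_apply
    (continuousWithinAt_const (b := ((1 : ℝ), (0 : ℝ))))).congr_of_eventuallyEq_of_mem ?_ hz
  filter_upwards [hc.eventually_mem_source hz hx, self_mem_nhdsWithin] with w hwx hw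
  exact (hc.chartSquareDeriv_fst hw hwx).symm

section FiniteDimensional

variable [FiniteDimensional ℝ E]

theorem hasCovDerivAtE_ofCoord (g : RMetric E M) {γ : ℝ → M} {V : ℝ → E} {v' : E}
    (ht : t ∈ Icc (0 : ℝ) 1) (hγ : MDifferentiableWithinAt 𝓘(ℝ, ℝ) 𝓘(ℝ, E) γ (Icc 0 1) t)
    (hx : γ t ∈ (extChartAt 𝓘(ℝ, E) x₀).source)
    (hV : HasDerivWithinAt (fieldCoordE γ V x₀) v' (Icc 0 1) t) :
    HasCovDerivAtE g γ V (ofCoord x₀ (γ t) (v' + christoffelL g x₀ (extChartAt 𝓘(ℝ, E) x₀ (γ t))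
      (toCoord x₀ (γ t) (velocityE γ t)) (toCoord x₀ (γ t) (V t)))) t := by
  refine hasCovDerivAtE_of_hasDerivWithinAt g ht hγ hx ?_
  rwa [toCoord_ofCoord hx, add_sub_cancel_right]

theorem SmoothSquare.hasCovDerivAtE_velocityT (hc : SmoothSquare E c) (g : RMetric E M)
    (hs : s ∈ Icc (0 : ℝ) 1) (ht : t ∈ Icc (0 : ℝ) 1) :
    HasCovDerivAtE g (fun σ => c σ t) (fun σ => velocityE (c σ) t) (covVelocityE g c (s, t)) s :=
  (hasCovDerivAtE_ofCoord g hs (hc.mdifferentiableWithinAt_left hs ht)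
    (mem_extChartAt_source _) (hc.hasDerivWithinAt_velocityT hs ht
      (mem_extChartAt_source _))).1.hasCovDerivAtE g

theorem SmoothSquare.covVelocityE_eq_ofCoord (hc : SmoothSquare E c) (g : RMetric E M)
    (hz : z ∈ unitSquare) (hx : c z.1 z.2 ∈ (extChartAt 𝓘(ℝ, E) x₀).source) :
    covVelocityE g c z = ofCoord x₀ (c z.1 z.2) (chartSquareDeriv₂ E c x₀ z (1, 0) (0, 1) +
      christoffelL g x₀ (chartSquare E c x₀ z) (chartSquareDeriv E c x₀ z (1, 0))
        (chartSquareDeriv E c x₀ z (0, 1))) := by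
  rw [hc.chartSquareDeriv_fst hz hx, hc.chartSquareDeriv_snd hz hx]
  exact (hasCovDerivAtE_ofCoord g hz.1 (hc.mdifferentiableWithinAt_left hz.1 hz.2) hx
    (hc.hasDerivWithinAt_velocityT hz.1 hz.2 hx)).2

/-- The symmetry `∇_t c_s = ∇_s c_t`: the connection is torsion-free. -/
theorem SmoothSquare.hasCovDerivAtE_velocityS (hc : SmoothSquare E c) (g : RMetric E M)
    (hs : s ∈ Icc (0 : ℝ) 1) (ht : t ∈ Icc (0 : ℝ) 1) :
    HasCovDerivAtE g (c s) (fun τ => velocityE (fun σ => c σ τ) s) (covVelocityE g c (s, t)) t := by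
  have hx := mem_extChartAt_source (I := 𝓘(ℝ, E)) (c s t)
  have hz : (s, t) ∈ unitSquare := ⟨hs, ht⟩
  rw [hc.covVelocityE_eq_ofCoord g hz hx, hc.chartSquareDeriv₂_symm hz hx,
    christoffelL_symm g _ (y := chartSquare E c (c s t) (s, t))
      ((extChartAt 𝓘(ℝ, E) (c s t)).map_source hx), hc.chartSquareDeriv_fst hz hx,
    hc.chartSquareDeriv_snd hz hx]
  exact hasCovDerivAtE_ofCoord g ht (hc.mdifferentiableWithinAt_right hs ht) hx
    (hc.hasDerivWithinAt_velocityS hs ht hx)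

theorem SmoothSquare.contDiffWithinAt_christoffelL (hc : SmoothSquare E c) (g : RMetric E M)
    (hz : z ∈ unitSquare) (hx : c z.1 z.2 ∈ (extChartAt 𝓘(ℝ, E) x₀).source) :
    ContDiffWithinAt ℝ ∞ (fun w => christoffelL g x₀ (chartSquare E c x₀ w)) unitSquare z :=
  (contDiffAt_christoffelL g x₀
    ((extChartAt 𝓘(ℝ, E) x₀).map_source hx)).comp_contDiffWithinAt (f := chartSquare E c x₀) z
    (hc.contDiffWithinAt hz hx)

theorem SmoothSquare.continuousFieldE_covVelocityE (hc : SmoothSquare E c) (g : RMetric E M)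
    (hz : z ∈ unitSquare) : ContinuousFieldE c (covVelocityE g c) z := by
  have hx := mem_extChartAt_source (I := 𝓘(ℝ, E)) (c z.1 z.2)
  have hD := (hc.contDiffWithinAt_deriv hz hx).continuousWithinAt
  have hD₂ := ((hc.contDiffWithinAt_deriv₂ hz hx).continuousWithinAt.clm_apply
    (continuousWithinAt_const (b := ((1 : ℝ), (0 : ℝ))))).clm_apply
    (continuousWithinAt_const (b := ((0 : ℝ), (1 : ℝ))))
  have hΓ := ((hc.contDiffWithinAt_christoffelL g hz hx).continuousWithinAt.clm_apply
    (hD.clm_apply (continuousWithinAt_const (b := ((1 : ℝ), (0 : ℝ)))))).clm_apply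
    (hD.clm_apply (continuousWithinAt_const (b := ((0 : ℝ), (1 : ℝ)))))
  refine (hD₂.add hΓ).congr_of_eventuallyEq_of_mem ?_ hz
  filter_upwards [hc.eventually_mem_source hz hx, self_mem_nhdsWithin] with w hwx hw
  rw [hc.covVelocityE_eq_ofCoord g hw hwx, toCoord_ofCoord hwx]
  rfl

theorem ContinuousFieldE.innerE {X Z : ℝ × ℝ → E} (hX : ContinuousFieldE c X z)
    (hZ : ContinuousFieldE c Z z) (hc : SmoothSquare E c) (g : RMetric E M)
    (hz : z ∈ unitSquare) :
    ContinuousWithinAt (fun w => innerE g (c w.1 w.2) (X w) (Z w)) unitSquare z := by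
  have hx := mem_extChartAt_source (I := 𝓘(ℝ, E)) (c z.1 z.2)
  have hg : ContinuousWithinAt (fun w => chartMetric g (c z.1 z.2) (chartSquare E c (c z.1 z.2) w))
      unitSquare z :=
    (contDiffAt_chartMetric g (c z.1 z.2)
      ((extChartAt 𝓘(ℝ, E) _).map_source hx)).continuousAt.comp_continuousWithinAt
      (f := chartSquare E c (c z.1 z.2)) (hc.contDiffWithinAt hz hx).continuousWithinAt
  refine ((hg.clm_apply hX).clm_apply hZ).congr_of_eventuallyEq_of_mem ?_ hz
  filter_upwards [hc.eventually_mem_source hz hx] with w hwx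
  exact (chartMetric_toCoord g hwx _ _).symm

end FiniteDimensional

end

/-! ### The square root velocity function and the Sobolev integrand -/

section

theorem continuousOn_integral_unitSquare {f : ℝ × ℝ → ℝ} (hf : ContinuousOn f unitSquare) :
    ContinuousOn (fun s => ∫ t in (0 : ℝ)..1, f (s, t)) (Icc 0 1) := by
  rw [continuousOn_iff_continuous_domRestrict]
  have hproj : Continuous (Function.uncurry fun (s : Icc (0 : ℝ) 1) (t : ℝ) =>
      f (s, projIcc 0 1 zero_le_one t)) :=
    hf.comp_continuous (by fun_prop) fun z => ⟨z.1.2, (projIcc 0 1 zero_le_one z.2).2⟩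
  refine (intervalIntegral.continuous_parametric_intervalIntegral_of_continuous'
    (μ := volume) hproj 0 1).congr fun s => intervalIntegral.integral_congr fun t ht => ?_
  rw [uIcc_of_le zero_le_one] at ht
  simp only [projIcc_of_mem zero_le_one ht]

theorem intervalIntegrable_of_unitSquare {f : ℝ × ℝ → ℝ} (hf : ContinuousOn f unitSquare) {s : ℝ}
    (hs : s ∈ Icc (0 : ℝ) 1) : IntervalIntegrable (fun t => f (s, t)) volume 0 1 := by
  refine ContinuousOn.intervalIntegrable ?_
  rw [uIcc_of_le zero_le_one]
  exact hf.comp (by fun_prop) fun t ht => ⟨hs, ht⟩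

theorem intervalIntegrable_congr_Icc {f f' : ℝ → ℝ} (h : ∀ t ∈ Icc (0 : ℝ) 1, f t = f' t)
    (hf : IntervalIntegrable f volume 0 1) : IntervalIntegrable f' volume 0 1 :=
  hf.congr fun t ht => h t (Ioc_subset_Icc_self (by simpa [uIoc_of_le] using ht))

variable {E : Type*} [NormedAddCommGroup E] [NormedSpace ℝ E]
  {M : Type*} [TopologicalSpace M] [ChartedSpace E M] [IsManifold 𝓘(ℝ, E) ∞ M]

/-- The Riemannian norm at a point of `M`, on the model space. -/
def normE (g : RMetric E M) (p : M) (u : E) : ℝ := √(innerE g p u u)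

theorem normE_sq (g : RMetric E M) (p : M) (u : E) : normE g p u ^ 2 = innerE g p u u :=
  Real.sq_sqrt (innerE_self_nonneg g p u)

theorem normE_pos (g : RMetric E M) (p : M) {u : E} (hu : u ≠ 0) : 0 < normE g p u :=
  Real.sqrt_pos.2 (innerE_pos g p hu)

/-- The square root velocity function of a curve, with values in the model space. -/
def srvfE (g : RMetric E M) (γ : ℝ → M) (t : ℝ) : E :=
  (√(normE g (γ t) (velocityE γ t)))⁻¹ • velocityE γ t

/-- The covariant derivative `∇_s q` at a point of the unit square. -/
def covSrvfE (g : RMetric E M) (c : ℝ → ℝ → M) (z : ℝ × ℝ) : E :=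
  covDerivE g (fun σ => c σ z.2) (fun σ => srvfE g (c σ) z.2) z.1

/-- The common value of the Sobolev integrand and of `‖∇_s q‖²`, as a function of `D = ∇_s c_t` and
`w = c_t`. -/
def elasticDensity (g : RMetric E M) (p : M) (D w : E) : ℝ :=
  (innerE g p D D - 3 / 4 * innerE g p D w ^ 2 / normE g p w ^ 2) / normE g p w

theorem sobolevIntegrand_eq_elasticDensity (g : RMetric E M) {γ : ℝ → M} {t : ℝ} (h : ℝ → E)
    (h₀ : (velocityE γ t : E) ≠ 0) :
    sobolevIntegrand (E := E) g γ h h t =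
      elasticDensity g (γ t) (covDerivE g γ h t) (velocityE γ t) := by
  set D := covDerivE g γ h t
  set w : E := velocityE γ t
  set n := normE g (γ t) w
  have hn : n ≠ 0 := (normE_pos g (γ t) h₀).ne'
  have hw : innerE g (γ t) w w = n ^ 2 := (normE_sq g (γ t) w).symm
  let T : E := innerE g (γ t) (n⁻¹ • D) (n⁻¹ • w) • n⁻¹ • w
  change (innerE g (γ t) (n⁻¹ • D - T) (n⁻¹ • D - T) + 1 / 4 * innerE g (γ t) T T) * n =
    (innerE g (γ t) D D - 3 / 4 * innerE g (γ t) D w ^ 2 / n ^ 2) / n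
  simp only [T, map_smul, map_sub, smul_apply, sub_apply, smul_eq_mul, innerE_symm g (γ t) w D, hw]
  field_simp
  ring

theorem innerE_rescale_eq_elasticDensity (g : RMetric E M) (p : M) (D : E) {w : E} (h₀ : w ≠ 0) :
    let u := (√(normE g p w))⁻¹ • (D - (innerE g p D w / (2 * normE g p w ^ 2)) • w)
    innerE g p u u = elasticDensity g p D w := by
  have hn := normE_pos g p h₀
  have hsq : (√(normE g p w))⁻¹ * (√(normE g p w))⁻¹ = (normE g p w)⁻¹ := by
    rw [← mul_inv, Real.mul_self_sqrt hn.le]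
  simp only [map_smul, map_sub, smul_apply, sub_apply, smul_eq_mul, innerE_symm g p w D,
    ← normE_sq g p w, elasticDensity, div_eq_mul_inv _ (normE g p w), ← hsq]
  generalize (√(normE g p w))⁻¹ = e
  field_simp
  ring

section FiniteDimensional

variable [FiniteDimensional ℝ E] {g : RMetric E M} {c : ℝ → ℝ → M} {s t : ℝ}

theorem HasCovDerivAtE.normE {γ : ℝ → M} {V : ℝ → E} {D : E} (hV : HasCovDerivAtE g γ V D t)
    (h₀ : V t ≠ 0) (ht : t ∈ Icc (0 : ℝ) 1)
    (hγ : MDifferentiableWithinAt 𝓘(ℝ, ℝ) 𝓘(ℝ, E) γ (Icc 0 1) t) :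
    HasDerivWithinAt (fun τ => normE g (γ τ) (V τ))
      (innerE g (γ t) D (V t) / normE g (γ t) (V t)) (Icc 0 1) t := by
  refine ((hV.inner hV ht hγ).sqrt (innerE_pos g _ h₀).ne').congr_deriv ?_
  change (innerE g (γ t) D (V t) + innerE g (γ t) (V t) D) /
    (2 * CurveSpace.normE g (γ t) (V t)) = _
  rw [innerE_symm g _ (V t) D, ← two_mul, mul_div_mul_left _ _ two_ne_zero]

theorem HasCovDerivAtE.inv_sqrt_normE_smul {γ : ℝ → M} {V : ℝ → E} {D : E}
    (hV : HasCovDerivAtE g γ V D t) (h₀ : V t ≠ 0) (ht : t ∈ Icc (0 : ℝ) 1)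
    (hγ : MDifferentiableWithinAt 𝓘(ℝ, ℝ) 𝓘(ℝ, E) γ (Icc 0 1) t) :
    HasCovDerivAtE g γ (fun τ => (√(CurveSpace.normE g (γ τ) (V τ)))⁻¹ • V τ)
      ((√(CurveSpace.normE g (γ t) (V t)))⁻¹ •
        (D - (innerE g (γ t) D (V t) / (2 * CurveSpace.normE g (γ t) (V t) ^ 2)) • V t)) t := by
  have hn := normE_pos g (γ t) h₀
  have hr := ((hV.normE h₀ ht hγ).sqrt hn.ne').inv (Real.sqrt_ne_zero'.2 hn)
  convert! HasCovDerivAtE.smul hr hV ht hγ using 1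
  rw [smul_sub, sub_eq_add_neg, smul_smul, ← neg_smul]
  congr 2
  rw [Real.sq_sqrt hn.le]
  field_simp

namespace SmoothSquare

theorem hasCovDerivAtE_srvfE (hc : SmoothSquare E c) (g : RMetric E M) (hs : s ∈ Icc (0 : ℝ) 1)
    (ht : t ∈ Icc (0 : ℝ) 1) (h₀ : (velocityE (c s) t : E) ≠ 0) :
    HasCovDerivAtE g (fun σ => c σ t) (fun σ => srvfE g (c σ) t) (covSrvfE g c (s, t)) s :=
  ((hc.hasCovDerivAtE_velocityT g hs ht).inv_sqrt_normE_smul h₀ hs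
    (hc.mdifferentiableWithinAt_left hs ht)).1.hasCovDerivAtE g

theorem normE_covSrvfE_sq (hc : SmoothSquare E c) (g : RMetric E M) (hs : s ∈ Icc (0 : ℝ) 1)
    (ht : t ∈ Icc (0 : ℝ) 1) (h₀ : (velocityE (c s) t : E) ≠ 0) :
    normE g (c s t) (covSrvfE g c (s, t)) ^ 2 =
      elasticDensity g (c s t) (covVelocityE g c (s, t)) (velocityE (c s) t) := by
  have h : covSrvfE g c (s, t) = _ := ((hc.hasCovDerivAtE_velocityT g hs ht).inv_sqrt_normE_smul h₀
    hs (hc.mdifferentiableWithinAt_left hs ht)).2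
  rw [normE_sq, h, innerE_rescale_eq_elasticDensity g _ _ h₀]

theorem sobolevIntegrand_derivS (hc : SmoothSquare E c) (g : RMetric E M)
    (hs : s ∈ Icc (0 : ℝ) 1) (ht : t ∈ Icc (0 : ℝ) 1) (h₀ : (velocityE (c s) t : E) ≠ 0) :
    sobolevIntegrand (E := E) g (c s) (derivS c s) (derivS c s) t =
      normE g (c s t) (covSrvfE g c (s, t)) ^ 2 := by
  rw [hc.normE_covSrvfE_sq g hs ht h₀, ← (hc.hasCovDerivAtE_velocityS g hs ht).2]
  exact sobolevIntegrand_eq_elasticDensity g (fun τ => velocityE (fun σ => c σ τ) s) h₀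

theorem continuousOn_normE_covSrvfE_sq (hc : SmoothSquare E c) (g : RMetric E M)
    (himm : ∀ s ∈ Icc (0 : ℝ) 1, ∀ t ∈ Icc (0 : ℝ) 1, (velocityE (c s) t : E) ≠ 0) :
    ContinuousOn (fun z => normE g (c z.1 z.2) (covSrvfE g c z) ^ 2) unitSquare := by
  have hdensity : ContinuousOn (fun z : ℝ × ℝ => elasticDensity g (c z.1 z.2)
      (covVelocityE g c z) (velocityE (c z.1) z.2)) unitSquare := fun z hz => by
    have hD := hc.continuousFieldE_covVelocityE g hz
    have hw := hc.continuousFieldE_velocityT hz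
    have hn := (hw.innerE hw hc g hz).sqrt
    have hn₀ := (normE_pos g (c z.1 z.2) (himm z.1 hz.1 z.2 hz.2)).ne'
    exact ((hD.innerE hD hc g hz).sub ((continuousWithinAt_const.mul
      ((hD.innerE hw hc g hz).pow 2)).div (hn.pow 2) (pow_ne_zero 2 hn₀))).div hn hn₀
  exact hdensity.congr fun z hz => hc.normE_covSrvfE_sq g hz.1 hz.2 (himm z.1 hz.1 z.2 hz.2)

end SmoothSquare

end FiniteDimensional

end

/-! ### Curvature and families of parallel fields -/

section

variable {E : Type*} [NormedAddCommGroup E] [NormedSpace ℝ E]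
  {M : Type*} [TopologicalSpace M] [ChartedSpace E M] [IsManifold 𝓘(ℝ, E) ∞ M]

theorem exists_short_box {p : ℝ × ℝ → Prop} {s t : ℝ} (hs : s ∈ Icc (0 : ℝ) 1)
    (ht : t ∈ Icc (0 : ℝ) 1) (hp : ∀ᶠ z in 𝓝[unitSquare] (s, t), p z) (C : ℝ) :
    ∃ a₀ a₁, a₀ < a₁ ∧ Icc a₀ a₁ ∈ 𝓝[Icc 0 1] s ∧ Icc a₀ a₁ ⊆ Icc 0 1 ∧
      ∃ ε > 0, ∃ α β, Icc (0 : ℝ) 1 ∩ Metric.ball t ε ⊆ Icc α β ∧ Icc α β ⊆ Icc 0 1 ∧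
        (∀ z ∈ Icc a₀ a₁ ×ˢ Icc α β, p z) ∧ C * (β - α) < 1 := by
  rw [unitSquare, nhdsWithin_prod_eq] at hp
  obtain ⟨q, hq, r, hr, hqr⟩ := eventually_prod_iff.1 hp
  obtain ⟨δ, hδ, a₀, a₁, ha, hball, hsub, haq, -⟩ := exists_short_Icc hs hq 0
  obtain ⟨ε, hε, α, β, -, hball', hsub', htr, hshort⟩ := exists_short_Icc ht hr C
  exact ⟨a₀, a₁, ha, mem_of_superset (inter_mem_nhdsWithin _ (Metric.ball_mem_nhds s hδ)) hball,
    hsub, ε, hε, α, β, hball', hsub', fun z hz => hqr (haq _ hz.1) (htr _ hz.2), hshort⟩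

/-- The curvature tensor, on the model space. -/
def curvatureE (g : RMetric E M) (p : M) (u v w : E) : E := curvature (E := E) g p u v w

/-- The curvature tensor in the coordinates of the chart at `x₀`. -/
def curvatureL (g : RMetric E M) (x₀ : M) (y u v w : E) : E :=
  fderiv ℝ (christoffelL g x₀) y u v w - fderiv ℝ (christoffelL g x₀) y v u w
    + christoffelL g x₀ y u (christoffelL g x₀ y v w)
    - christoffelL g x₀ y v (christoffelL g x₀ y u w)

/-- The connection form of the chart at `x₀`, pulled back to the unit square and evaluated in the
direction `e`. -/
def connectionForm (g : RMetric E M) (c : ℝ → ℝ → M) (x₀ : M) (e z : ℝ × ℝ) : E →L[ℝ] E :=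
  christoffelL g x₀ (chartSquare E c x₀ z) (chartSquareDeriv E c x₀ z e)

variable {c : ℝ → ℝ → M} {x₀ : M} {s t : ℝ} {z : ℝ × ℝ}

theorem SmoothSquare.parallelCoeff_eq_neg_connectionForm (hc : SmoothSquare E c) (g : RMetric E M)
    (hs : s ∈ Icc (0 : ℝ) 1) (ht : t ∈ Icc (0 : ℝ) 1)
    (hx : c s t ∈ (extChartAt 𝓘(ℝ, E) x₀).source) :
    parallelCoeff g (c s) x₀ t = -connectionForm g c x₀ (0, 1) (s, t) := by
  rw [connectionForm, hc.chartSquareDeriv_snd (z := (s, t)) ⟨hs, ht⟩ hx]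
  rfl

variable [FiniteDimensional ℝ E]

theorem curvatureE_eq_curvatureL (g : RMetric E M) (p : M) (u v w : E) :
    curvatureE g p u v w = curvatureL g p (extChartAt 𝓘(ℝ, E) p p) u v w := by
  have hd := ((contDiffAt_christoffelL g p ((extChartAt 𝓘(ℝ, E) p).map_source
    (mem_extChartAt_source p))).differentiableAt (by simp)).hasFDerivAt
  have h (a b d : E) : fderiv ℝ (fun y => christoffel g p y a b) (extChartAt 𝓘(ℝ, E) p p) d =
      fderiv ℝ (christoffelL g p) (extChartAt 𝓘(ℝ, E) p p) d a b := by
    simp only [christoffel_eq_christoffelL]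
    rw [((hd.clm_apply (hasFDerivAt_const a _)).clm_apply (hasFDerivAt_const b _)).fderiv]
    simp
  unfold curvatureL
  rw [← h, ← h]
  simp only [← christoffel_eq_christoffelL]
  rfl

section ConnectionForm

variable (hc : SmoothSquare E c) (g : RMetric E M) (hz : z ∈ unitSquare)
  (hx : c z.1 z.2 ∈ (extChartAt 𝓘(ℝ, E) x₀).source)

include hc hz hx

theorem SmoothSquare.contDiffWithinAt_connectionForm (e : ℝ × ℝ) :
    ContDiffWithinAt ℝ ∞ (connectionForm g c x₀ e) unitSquare z :=
  (hc.contDiffWithinAt_christoffelL g hz hx).clm_apply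
    ((hc.contDiffWithinAt_deriv hz hx).clm_apply contDiffWithinAt_const)

theorem SmoothSquare.hasFDerivWithinAt_connectionForm (e : ℝ × ℝ) :
    HasFDerivWithinAt (connectionForm g c x₀ e)
      (fderivWithin ℝ (connectionForm g c x₀ e) unitSquare z) unitSquare z :=
  ((hc.contDiffWithinAt_connectionForm g hz hx e).differentiableWithinAt
    (by simp)).hasFDerivWithinAt

theorem SmoothSquare.continuousWithinAt_fderivWithin_connectionForm (d e : ℝ × ℝ) :
    ContinuousWithinAt (fun w => fderivWithin ℝ (connectionForm g c x₀ e) unitSquare w d)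
      unitSquare z :=
  ((hc.contDiffWithinAt_connectionForm g hz hx e).fderivWithin_right (m := 0)
    uniqueDiffOn_unitSquare (by simp) hz).continuousWithinAt.clm_apply continuousWithinAt_const

theorem SmoothSquare.fderivWithin_connectionForm (d e : ℝ × ℝ) :
    fderivWithin ℝ (connectionForm g c x₀ e) unitSquare z d =
      fderiv ℝ (christoffelL g x₀) (chartSquare E c x₀ z) (chartSquareDeriv E c x₀ z d)
        (chartSquareDeriv E c x₀ z e) +
      christoffelL g x₀ (chartSquare E c x₀ z) (chartSquareDeriv₂ E c x₀ z d e) := by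
  have hΓ := ((contDiffAt_christoffelL g x₀ ((extChartAt 𝓘(ℝ, E) x₀).map_source
    hx)).differentiableAt (by simp)).hasFDerivAt.comp_hasFDerivWithinAt (f := chartSquare E c x₀) z
      (hc.hasFDerivWithinAt hz hx)
  have hY := (hc.hasFDerivWithinAt_deriv hz hx).clm_apply (hasFDerivWithinAt_const e z unitSquare)
  have h : HasFDerivWithinAt (connectionForm g c x₀ e) _ unitSquare z := hΓ.clm_apply hY
  rw [h.fderivWithin (uniqueDiffOn_unitSquare z hz)]
  simp [add_comm, chartSquare]

/-- The structure equation `R = dA + A ∧ A` of the connection form. -/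
theorem SmoothSquare.curvatureL_eq_connectionForm (d e : ℝ × ℝ) (w : E) :
    curvatureL g x₀ (chartSquare E c x₀ z) (chartSquareDeriv E c x₀ z d)
        (chartSquareDeriv E c x₀ z e) w =
      fderivWithin ℝ (connectionForm g c x₀ e) unitSquare z d w -
        fderivWithin ℝ (connectionForm g c x₀ d) unitSquare z e w +
        connectionForm g c x₀ d z (connectionForm g c x₀ e z w) -
        connectionForm g c x₀ e z (connectionForm g c x₀ d z w) := by
  rw [hc.fderivWithin_connectionForm g hz hx, hc.fderivWithin_connectionForm g hz hx,
    hc.chartSquareDeriv₂_symm hz hx d e]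
  simp only [curvatureL, connectionForm, add_apply]
  abel

end ConnectionForm

section Family

variable {U : ℝ → ℝ → E} {g : RMetric E M}
  (hU : ∀ a ∈ Icc (0 : ℝ) 1, ∀ τ ∈ Icc (0 : ℝ) 1, IsParallelAtE g (c a) (U a) τ)
  (hc : SmoothSquare E c) (hs : s ∈ Icc (0 : ℝ) 1)

include hU hc hs

theorem SmoothSquare.exists_ball_hasDerivWithinAt_family (ht : t ∈ Icc (0 : ℝ) 1) :
    ∃ ε > 0, ∀ t₀ ∈ Icc (0 : ℝ) 1 ∩ Metric.ball t ε,
      FieldDifferentiableAtE (fun a => c a t₀) (fun a => U a t₀) s →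
      ∃ w : ℝ → E, ∀ τ ∈ Icc (0 : ℝ) 1 ∩ Metric.ball t ε,
        c s τ ∈ (extChartAt 𝓘(ℝ, E) (c s t)).source ∧
        HasDerivWithinAt (fieldCoordE (fun a => c a τ) (fun a => U a τ) (c s t)) (w τ)
          (Icc 0 1) s ∧
        HasDerivWithinAt w (-connectionForm g c (c s t) (0, 1) (s, τ) (w τ) -
          fderivWithin ℝ (connectionForm g c (c s t) (0, 1)) unitSquare (s, τ) (1, 0)
            (fieldCoordE (c s) (U s) (c s t) τ)) (Icc 0 1) τ := by
  set x₀ := c s t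
  set A := connectionForm g c x₀ (0, 1)
  have hx := mem_extChartAt_source (I := 𝓘(ℝ, E)) x₀
  have hst : (s, t) ∈ unitSquare := ⟨hs, ht⟩
  obtain ⟨a₀, a₁, ha, hmem, hsub, ε, hε, α, β, hball, hsub', hbound, hshort⟩ :=
    exists_short_box hs ht ((hc.eventually_mem_source hst hx).and
      ((hc.contDiffWithinAt_connectionForm g hst hx (0, 1)).continuousWithinAt.norm.eventually
        (Iic_mem_nhds (lt_add_one _)))) (‖A (s, t)‖ + 1)
  have hbox : Icc a₀ a₁ ×ˢ Icc α β ⊆ unitSquare := prod_mono hsub hsub'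
  have hsrc : ∀ a ∈ Icc a₀ a₁, ∀ τ ∈ Icc α β, c a τ ∈ (extChartAt 𝓘(ℝ, E) x₀).source :=
    fun a ha τ hτ => (hbound (a, τ) ⟨ha, hτ⟩).1
  have hsa : s ∈ Icc a₀ a₁ := mem_of_mem_nhdsWithin hs hmem
  refine ⟨ε, hε, fun t₀ ht₀ hdiff => ?_⟩
  obtain ⟨w, hw⟩ := exists_hasDerivWithinAt_parameter (B := fun z => -A z)
    (B' := fun z => -fderivWithin ℝ A unitSquare z (1, 0))
    (W := fun z => fieldCoordE (c z.1) (U z.1) x₀ z.2) ha hsa (hball ht₀)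
    (fun z hz => ((hc.contDiffWithinAt_connectionForm g (hbox hz)
      (hsrc _ hz.1 _ hz.2) _).continuousWithinAt.mono hbox).neg)
    (fun z hz => ((hc.continuousWithinAt_fderivWithin_connectionForm g (hbox hz)
      (hsrc _ hz.1 _ hz.2) _ _).mono hbox).neg)
    (fun a ha τ hτ => ((hasDerivWithinAt_left (hsub' hτ) (hc.hasFDerivWithinAt_connectionForm g
      (z := (a, τ)) (hbox ⟨ha, hτ⟩) (hsrc a ha τ hτ) _)).mono hsub).neg)
    (fun z hz => (norm_neg (A z)).trans_le (hbound z hz).2) hshort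
    (fun a ha τ hτ => by
      have h := (isParallelAtE_iff (hsub' hτ) (hc.mdifferentiableWithinAt_right (hsub ha)
        (hsub' hτ)) (hsrc a ha τ hτ)).1 (hU a (hsub ha) τ (hsub' hτ))
      rw [hc.parallelCoeff_eq_neg_connectionForm g (hsub ha) (hsub' hτ) (hsrc a ha τ hτ)] at h
      exact h.mono hsub')
    ((hdiff.hasCovDerivAtE g).hasDerivWithinAt hs (hc.mdifferentiableWithinAt_left hs ht₀.1)
      (hsrc s hsa t₀ (hball ht₀)) |>.mono hsub)
  refine ⟨w, fun τ hτ => ⟨hsrc s hsa τ (hball hτ),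
    (hw τ (hball hτ)).1.mono_of_mem_nhdsWithin hmem, ?_⟩⟩
  have hmem' : Icc α β ∈ 𝓝[Icc 0 1] τ :=
    mem_of_superset (inter_mem_nhdsWithin _ (Metric.isOpen_ball.mem_nhds hτ.2)) hball
  rw [sub_eq_add_neg]
  exact (hw τ (hball hτ)).2.mono_of_mem_nhdsWithin hmem'

theorem SmoothSquare.exists_ball_hasCovDerivAtE_family (ht : t ∈ Icc (0 : ℝ) 1) :
    ∃ ε > 0, ∀ t₀ ∈ Icc (0 : ℝ) 1 ∩ Metric.ball t ε,
      FieldDifferentiableAtE (fun a => c a t₀) (fun a => U a t₀) s →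
      ∀ τ ∈ Icc (0 : ℝ) 1 ∩ Metric.ball t ε,
        c s τ ∈ (extChartAt 𝓘(ℝ, E) (c s t)).source ∧
        FieldDifferentiableAtE (fun a => c a τ) (fun a => U a τ) s ∧
        HasCovDerivAtE g (c s) (fun τ => covDerivE g (fun a => c a τ) (fun a => U a τ) s)
          (ofCoord (c s t) (c s τ) (curvatureL g (c s t) (chartSquare E c (c s t) (s, τ))
            (chartSquareDeriv E c (c s t) (s, τ) (0, 1))
            (chartSquareDeriv E c (c s t) (s, τ) (1, 0))
            (fieldCoordE (c s) (U s) (c s t) τ))) τ := by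
  obtain ⟨ε, hε, hfamily⟩ := hc.exists_ball_hasDerivWithinAt_family hU hs ht
  refine ⟨ε, hε, fun t₀ ht₀ hdiff => ?_⟩
  obtain ⟨w, hw⟩ := hfamily t₀ ht₀ hdiff
  set x₀ := c s t
  set A := connectionForm g c x₀
  set W := fieldCoordE (c s) (U s) x₀
  have hH : ∀ τ ∈ Icc (0 : ℝ) 1 ∩ Metric.ball t ε,
      HasCovDerivAtE g (fun a => c a τ) (fun a => U a τ)
        (ofCoord x₀ (c s τ) (w τ + A (1, 0) (s, τ) (W τ))) s := fun τ hτ => by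
    have hz : (s, τ) ∈ unitSquare := ⟨hs, hτ.1⟩
    have h := hasCovDerivAtE_ofCoord g hs (hc.mdifferentiableWithinAt_left hs hτ.1) (hw τ hτ).1
      (hw τ hτ).2.1
    rwa [← hc.chartSquareDeriv_fst hz (hw τ hτ).1] at h
  intro τ hτ
  obtain ⟨hx, -, hw'⟩ := hw τ hτ
  have hz : (s, τ) ∈ unitSquare := ⟨hs, hτ.1⟩
  have hγ := hc.mdifferentiableWithinAt_right hs hτ.1
  have hW : HasDerivWithinAt W (-A (0, 1) (s, τ) (W τ)) (Icc 0 1) τ := by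
    have h := (isParallelAtE_iff hτ.1 hγ hx).1 (hU s hs τ hτ.1)
    rwa [hc.parallelCoeff_eq_neg_connectionForm g hs hτ.1 hx] at h
  have hsum := hw'.add ((hasDerivWithinAt_right hs
    (hc.hasFDerivWithinAt_connectionForm g hz hx (1, 0))).clm_apply hW)
  have hcoord := hsum.congr_of_eventuallyEq_of_mem
    (f₁ := fieldCoordE (c s) (fun τ => covDerivE g (fun a => c a τ) (fun a => U a τ) s) x₀) (by
      filter_upwards [inter_mem_nhdsWithin _ (Metric.isOpen_ball.mem_nhds hτ.2)] with τ' hτ'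
      rw [fieldCoordE, (hH τ' hτ').2, toCoord_ofCoord (hw τ' hτ').1]
      rfl) hτ.1
  refine ⟨hx, (hH τ hτ).1, ?_⟩
  have h := hasCovDerivAtE_ofCoord g hτ.1 hγ hx hcoord
  rw [(hH τ hτ).2, toCoord_ofCoord hx, ← hc.chartSquareDeriv_snd hz hx] at h
  rw [hc.curvatureL_eq_connectionForm g hz hx]
  convert h using 2
  change _ = _ + A (0, 1) (s, τ) (w τ + A (1, 0) (s, τ) (W τ))
  simp only [map_add, map_neg, A]
  abel

theorem SmoothSquare.fieldDifferentiableAtE_family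
    (h₀ : FieldDifferentiableAtE (fun a => c a 0) (fun a => U a 0) s) (ht : t ∈ Icc (0 : ℝ) 1) :
    FieldDifferentiableAtE (fun a => c a t) (fun a => U a t) s := by
  refine isPreconnected_Icc.induction₂' (fun t t' =>
    FieldDifferentiableAtE (fun a => c a t) (fun a => U a t) s →
      FieldDifferentiableAtE (fun a => c a t') (fun a => U a t') s) (fun t ht => ?_)
    (fun _ _ _ _ _ _ h h' => h' ∘ h) (by simp) ht h₀
  obtain ⟨ε, hε, h⟩ := hc.exists_ball_hasCovDerivAtE_family hU hs ht
  have htε : t ∈ Icc (0 : ℝ) 1 ∩ Metric.ball t ε := ⟨ht, Metric.mem_ball_self hε⟩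
  filter_upwards [inter_mem_nhdsWithin _ (Metric.ball_mem_nhds t hε)] with τ hτ
  exact ⟨fun hd => (h t htε hd τ hτ).2.1, fun hd => (h τ hτ hd t htε).2.1⟩

theorem SmoothSquare.hasCovDerivAtE_covDerivE_family
    (h₀ : FieldDifferentiableAtE (fun a => c a 0) (fun a => U a 0) s) (ht : t ∈ Icc (0 : ℝ) 1) :
    HasCovDerivAtE g (c s) (fun τ => covDerivE g (fun a => c a τ) (fun a => U a τ) s)
      (curvatureE g (c s t) (velocityE (c s) t) (velocityE (fun a => c a t) s) (U s t)) t := by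
  obtain ⟨ε, hε, h⟩ := hc.exists_ball_hasCovDerivAtE_family hU hs ht
  have htε : t ∈ Icc (0 : ℝ) 1 ∩ Metric.ball t ε := ⟨ht, Metric.mem_ball_self hε⟩
  obtain ⟨hx, -, hcov⟩ := h t htε (hc.fieldDifferentiableAtE_family hU hs h₀ ht) t htε
  have hst : (s, t) ∈ unitSquare := ⟨hs, ht⟩
  rw [hc.chartSquareDeriv_fst hst hx, hc.chartSquareDeriv_snd hst hx, fieldCoordE] at hcov
  rw [curvatureE_eq_curvatureL]
  convert hcov using 1
  rw [← toCoord_self (c s t) (ofCoord _ _ _), toCoord_ofCoord hx,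
    toCoord_self, toCoord_self, toCoord_self]
  rfl

theorem SmoothSquare.continuousWithinAt_curvatureE_family
    (h₀ : FieldDifferentiableAtE (fun a => c a 0) (fun a => U a 0) s) (ht : t ∈ Icc (0 : ℝ) 1) :
    ContinuousWithinAt (fieldCoordE (c s) (fun τ => curvatureE g (c s τ) (velocityE (c s) τ)
      (velocityE (fun a => c a τ) s) (U s τ)) (c s t)) (Icc 0 1) t := by
  obtain ⟨ε, hε, h⟩ := hc.exists_ball_hasCovDerivAtE_family hU hs ht
  replace h := h t ⟨ht, Metric.mem_ball_self hε⟩ (hc.fieldDifferentiableAtE_family hU hs h₀ ht)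
  have hx := mem_extChartAt_source (I := 𝓘(ℝ, E)) (c s t)
  have hst : (s, t) ∈ unitSquare := ⟨hs, ht⟩
  have hA (e : ℝ × ℝ) : ContinuousWithinAt (fun τ => connectionForm g c (c s t) e (s, τ))
      (Icc 0 1) t :=
    (hc.contDiffWithinAt_connectionForm g hst hx e).continuousWithinAt.tendsto.comp
      (tendsto_unitSquare_right hs)
  have hdA (d e : ℝ × ℝ) : ContinuousWithinAt
      (fun τ => fderivWithin ℝ (connectionForm g c (c s t) e) unitSquare (s, τ) d) (Icc 0 1) t :=
    (hc.continuousWithinAt_fderivWithin_connectionForm g hst hx d e).tendsto.comp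
      (tendsto_unitSquare_right hs)
  have hW : ContinuousWithinAt (fieldCoordE (c s) (U s) (c s t)) (Icc 0 1) t :=
    ((hU s hs t ht).hasDerivWithinAt ht (hc.mdifferentiableWithinAt_right hs ht)
      hx).continuousWithinAt
  refine (((((hdA (0, 1) (1, 0)).clm_apply hW).sub ((hdA (1, 0) (0, 1)).clm_apply hW)).add
    ((hA (0, 1)).clm_apply ((hA (1, 0)).clm_apply hW))).sub
    ((hA (1, 0)).clm_apply ((hA (0, 1)).clm_apply hW))).congr_of_eventuallyEq_of_mem ?_ ht
  filter_upwards [inter_mem_nhdsWithin _ (Metric.ball_mem_nhds t hε)] with τ hτ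
  obtain ⟨hxτ, -, hcov⟩ := h τ hτ
  have hcurv := (hc.hasCovDerivAtE_covDerivE_family hU hs h₀ hτ.1).2.symm.trans hcov.2
  rw [fieldCoordE, hcurv, toCoord_ofCoord hxτ,
    hc.curvatureL_eq_connectionForm g (z := (s, τ)) ⟨hs, hτ.1⟩ hxτ]
  rfl

end Family

end

/-! ### Transport from and to the origin of the square -/

section

variable {E : Type*} [NormedAddCommGroup E] [NormedSpace ℝ E] [FiniteDimensional ℝ E]
  {M : Type*} [TopologicalSpace M] [ChartedSpace E M] [IsManifold 𝓘(ℝ, E) ∞ M]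
  {g : RMetric E M}

theorem exists_continuousLinearEquiv_innerE (g : RMetric E M) (p : M) :
    ∃ e : E ≃L[ℝ] (Fin (Module.finrank ℝ E) → ℝ),
      ∀ u i, e u i = innerE g p u (Module.finBasis ℝ E i) := by
  obtain ⟨e, he⟩ := isInvertible_of_pos fun _ hu => innerE_pos g p hu
  refine ⟨(e.toLinearEquiv ≪≫ₗ LinearMap.toContinuousLinearMap.symm ≪≫ₗ
    ((Module.finBasis ℝ E).constr ℝ).symm).toContinuousLinearEquiv, fun u i => ?_⟩
  rw [← he]
  rfl

theorem hasDerivWithinAt_of_innerE {p : M} {f : ℝ → E} {f' : E} {s : Set ℝ} {t : ℝ}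
    (h : ∀ u, HasDerivWithinAt (fun τ => innerE g p (f τ) u) (innerE g p f' u) s t) :
    HasDerivWithinAt f f' s t := by
  obtain ⟨e, he⟩ := exists_continuousLinearEquiv_innerE g p
  have h₁ : HasDerivWithinAt (fun τ => e (f τ)) (e f') s t :=
    hasDerivWithinAt_pi.2 fun i => by simpa only [he] using h _
  simpa only [Function.comp_def, ContinuousLinearEquiv.coe_coe, e.symm_apply_apply]
    using e.symm.hasFDerivAt.comp_hasDerivWithinAt t h₁

theorem continuousWithinAt_of_innerE {p : M} {f : ℝ → E} {s : Set ℝ} {t : ℝ}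
    (h : ∀ u, ContinuousWithinAt (fun τ => innerE g p (f τ) u) s t) :
    ContinuousWithinAt f s t := by
  obtain ⟨e, he⟩ := exists_continuousLinearEquiv_innerE g p
  exact (e.toHomeomorph.comp_continuousWithinAt_iff f s t).2 <|
    continuousWithinAt_pi.2 fun i => (h _).congr (fun τ _ => he (f τ) i) (he (f t) i)

section Curve

variable {γ : ℝ → M} (hγ : ContMDiffOn 𝓘(ℝ, ℝ) 𝓘(ℝ, E) ∞ γ (Icc 0 1)) {X w : ℝ → E} {t₀ t : ℝ}
  (ht₀ : t₀ ∈ Icc (0 : ℝ) 1) (ht : t ∈ Icc (0 : ℝ) 1)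

include hγ ht₀ ht

theorem HasCovDerivAtE.hasDerivWithinAt_transportE {x : E} (hX : HasCovDerivAtE g γ X x t) :
    HasDerivWithinAt (fun τ => transportE g γ τ t₀ (X τ)) (transportE g γ t t₀ x) (Icc 0 1) t := by
  refine hasDerivWithinAt_of_innerE (g := g) (p := γ t₀) fun u => ?_
  have h := hX.inner (isParallelAtE_transportE hγ ht₀ u ht) ht
    ((hγ t ht).mdifferentiableWithinAt (by simp))
  rw [map_zero, add_zero] at h
  rw [innerE_transportE hγ ht ht₀]
  exact h.congr_of_mem (fun τ hτ => innerE_transportE hγ hτ ht₀ _ _) ht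

theorem continuousWithinAt_transportE
    (hX : ContinuousWithinAt (fieldCoordE γ X (γ t)) (Icc 0 1) t) :
    ContinuousWithinAt (fun τ => transportE g γ τ t₀ (X τ)) (Icc 0 1) t := by
  refine continuousWithinAt_of_innerE (g := g) (p := γ t₀) fun u => ?_
  have hs := mem_extChartAt_source (I := 𝓘(ℝ, E)) (γ t)
  have hu := (isParallelAtE_transportE (g := g) hγ ht₀ u ht).hasDerivWithinAt ht
    ((hγ t ht).mdifferentiableWithinAt (by simp)) hs
  have hg : ContinuousWithinAt (fun τ => chartMetric g (γ t) (extChartAt 𝓘(ℝ, E) (γ t) (γ τ)))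
      (Icc 0 1) t :=
    (contDiffAt_chartMetric g (γ t)
      ((extChartAt 𝓘(ℝ, E) (γ t)).map_source hs)).continuousAt.comp_continuousWithinAt
      (f := fun τ => extChartAt 𝓘(ℝ, E) (γ t) (γ τ))
      (contDiffWithinAt_extChartAt_comp (hγ t ht) hs).continuousWithinAt
  refine ((hg.clm_apply hX).clm_apply hu.continuousWithinAt).congr_of_eventuallyEq_of_mem ?_ ht
  filter_upwards [eventually_mem_source (hγ t ht).continuousWithinAt hs, self_mem_nhdsWithin]
    with τ hτ hτ'
  rw [innerE_transportE hγ hτ' ht₀]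
  exact (chartMetric_toCoord g hτ _ _).symm

omit ht₀

theorem integral_transportE_of_hasCovDerivAtE
    (hX : ∀ τ ∈ Icc (0 : ℝ) 1, HasCovDerivAtE g γ X (w τ) τ)
    (hw : ∀ τ ∈ Icc (0 : ℝ) 1, ContinuousWithinAt (fieldCoordE γ w (γ τ)) (Icc 0 1) τ) :
    ∫ τ in (0 : ℝ)..t, transportE g γ τ 0 (w τ) = transportE g γ t 0 (X t) - X 0 := by
  have h₀ : (0 : ℝ) ∈ Icc (0 : ℝ) 1 := by simp
  have hsub : Icc 0 t ⊆ Icc (0 : ℝ) 1 := Icc_subset_Icc_right ht.2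
  have hcont : ContinuousOn (fun τ => transportE g γ τ 0 (w τ)) (Icc 0 1) :=
    fun τ hτ => continuousWithinAt_transportE hγ h₀ hτ (hw τ hτ)
  have hderiv : ∀ τ ∈ Icc (0 : ℝ) 1, HasDerivWithinAt (fun τ => transportE g γ τ 0 (X τ))
      (transportE g γ τ 0 (w τ)) (Icc 0 1) τ :=
    fun τ hτ => (hX τ hτ).hasDerivWithinAt_transportE hγ h₀ hτ
  rw [intervalIntegral.integral_eq_sub_of_hasDerivAt_of_le ht.1
    (fun τ hτ => (hderiv τ (hsub hτ)).continuousWithinAt.mono hsub)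
    (fun τ hτ => (hderiv τ (hsub (Ioo_subset_Icc_self hτ))).hasDerivAt
      (Icc_mem_nhds hτ.1 (hτ.2.trans_le ht.2)))
    ((hcont.mono hsub).intervalIntegrable_of_Icc ht.1), transportE_self hγ h₀]

end Curve

/-- Transport of `u` from the origin of the square to `(a, τ)`, first along `c(·, 0)` and then along
`c(a, ·)`. -/
def fromOrigin (g : RMetric E M) (c : ℝ → ℝ → M) (a τ : ℝ) (u : E) : E :=
  transportE g (c a) 0 τ (transportE g (fun σ => c σ 0) 0 a u)

/-- Transport from `(s, t)` to the origin of the square, on the model space. -/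
def toOrigin (g : RMetric E M) (c : ℝ → ℝ → M) (s t : ℝ) (u : E) : E :=
  transportE g (fun σ => c σ 0) s 0 (transportE g (c s) t 0 u)

/-- The covariant derivative in the first parameter of the field obtained by transport of `u` from
the origin of the square. -/
def covFromOrigin (g : RMetric E M) (c : ℝ → ℝ → M) (u : E) (s t : ℝ) : E :=
  covDerivE g (fun a => c a t) (fun a => fromOrigin g c a t u) s

variable {c : ℝ → ℝ → M} (hc : SmoothSquare E c) {s t : ℝ} (hs : s ∈ Icc (0 : ℝ) 1)

include hc hs

theorem SmoothSquare.hasCovDerivAtE_fromOrigin_zero (u : E) :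
    HasCovDerivAtE g (fun a => c a 0) (fun a => fromOrigin g c a 0 u) 0 s := by
  have h₀ : (0 : ℝ) ∈ Icc (0 : ℝ) 1 := by simp
  refine HasCovDerivAtE.congr (isParallelAtE_transportE (hc.contMDiffOn_left h₀) h₀ u hs) hs ?_
  filter_upwards [self_mem_nhdsWithin] with a ha
  exact (transportE_self (hc.contMDiffOn_right ha) h₀ _).symm

theorem SmoothSquare.covFromOrigin_zero (u : E) : covFromOrigin g c u s 0 = 0 :=
  (hc.hasCovDerivAtE_fromOrigin_zero hs u).2

variable (ht : t ∈ Icc (0 : ℝ) 1)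

include ht

theorem SmoothSquare.innerE_toOrigin_left (u v : E) :
    innerE g (c 0 0) (toOrigin g c s t u) v = innerE g (c s t) u (fromOrigin g c s t v) := by
  have h₀ : (0 : ℝ) ∈ Icc (0 : ℝ) 1 := by simp
  exact (innerE_transportE (hc.contMDiffOn_left h₀) hs h₀ _ v).trans
    (innerE_transportE (hc.contMDiffOn_right hs) ht h₀ u _)

theorem SmoothSquare.fromOrigin_toOrigin {τ : ℝ} (hτ : τ ∈ Icc (0 : ℝ) 1) (u : E) :
    fromOrigin g c s τ (toOrigin g c s t u) = transportE g (c s) t τ u := by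
  have h₀ : (0 : ℝ) ∈ Icc (0 : ℝ) 1 := by simp
  rw [fromOrigin, toOrigin, transportE_transportE (hc.contMDiffOn_left h₀) hs h₀ hs,
    transportE_self (hc.contMDiffOn_left h₀) hs,
    transportE_transportE (hc.contMDiffOn_right hs) ht h₀ hτ]

theorem SmoothSquare.fromOrigin_toOrigin_self (u : E) :
    fromOrigin g c s t (toOrigin g c s t u) = u := by
  rw [hc.fromOrigin_toOrigin hs ht ht, transportE_self (hc.contMDiffOn_right hs) ht]

theorem SmoothSquare.toOrigin_fromOrigin (u : E) :
    toOrigin g c s t (fromOrigin g c s t u) = u := by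
  have h₀ : (0 : ℝ) ∈ Icc (0 : ℝ) 1 := by simp
  rw [fromOrigin, toOrigin, transportE_transportE (hc.contMDiffOn_right hs) h₀ ht h₀,
    transportE_self (hc.contMDiffOn_right hs) h₀,
    transportE_transportE (hc.contMDiffOn_left h₀) h₀ hs h₀,
    transportE_self (hc.contMDiffOn_left h₀) h₀]

theorem SmoothSquare.innerE_toOrigin (u v : E) :
    innerE g (c 0 0) (toOrigin g c s t u) (toOrigin g c s t v) = innerE g (c s t) u v := by
  rw [hc.innerE_toOrigin_left hs ht, hc.fromOrigin_toOrigin_self hs ht]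

theorem SmoothSquare.innerE_fromOrigin (u v : E) :
    innerE g (c s t) (fromOrigin g c s t u) (fromOrigin g c s t v) = innerE g (c 0 0) u v := by
  rw [← hc.innerE_toOrigin_left hs ht, hc.toOrigin_fromOrigin hs ht]

theorem SmoothSquare.isParallelAtE_fromOrigin (u : E) :
    IsParallelAtE g (c s) (fun τ => fromOrigin g c s τ u) t :=
  isParallelAtE_transportE (hc.contMDiffOn_right hs) (by simp) _ ht

theorem SmoothSquare.hasCovDerivAtE_fromOrigin (u : E) :
    HasCovDerivAtE g (fun a => c a t) (fun a => fromOrigin g c a t u) (covFromOrigin g c u s t) s :=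
  (hc.fieldDifferentiableAtE_family (U := fun a τ => fromOrigin g c a τ u)
    (fun _ ha _ hτ => hc.isParallelAtE_fromOrigin ha hτ u) hs
    (hc.hasCovDerivAtE_fromOrigin_zero hs u).1 ht).hasCovDerivAtE g

theorem SmoothSquare.hasCovDerivAtE_covFromOrigin (u : E) :
    HasCovDerivAtE g (c s) (covFromOrigin g c u s) (curvatureE g (c s t) (velocityE (c s) t)
      (velocityE (fun a => c a t) s) (fromOrigin g c s t u)) t :=
  hc.hasCovDerivAtE_covDerivE_family (fun _ ha _ hτ => hc.isParallelAtE_fromOrigin ha hτ u) hs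
    (hc.hasCovDerivAtE_fromOrigin_zero hs u).1 ht

theorem SmoothSquare.continuousWithinAt_curvatureE_fromOrigin (u : E) :
    ContinuousWithinAt (fieldCoordE (c s) (fun τ => curvatureE g (c s τ) (velocityE (c s) τ)
      (velocityE (fun a => c a τ) s) (fromOrigin g c s τ u)) (c s t)) (Icc 0 1) t :=
  hc.continuousWithinAt_curvatureE_family (U := fun a τ => fromOrigin g c a τ u)
    (fun _ ha _ hτ => hc.isParallelAtE_fromOrigin ha hτ u) hs
    (hc.hasCovDerivAtE_fromOrigin_zero hs u).1 ht

theorem SmoothSquare.innerE_covFromOrigin (u v : E) :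
    innerE g (c s t) (covFromOrigin g c u s t) (fromOrigin g c s t v) =
      -innerE g (c s t) (fromOrigin g c s t u) (covFromOrigin g c v s t) := by
  have hconst : HasDerivWithinAt
      (fun a => innerE g (c a t) (fromOrigin g c a t u) (fromOrigin g c a t v)) 0 (Icc 0 1) s :=
    (hasDerivWithinAt_const s _ (innerE g (c 0 0) u v)).congr_of_mem
      (fun a ha => hc.innerE_fromOrigin ha ht u v) hs
  exact eq_neg_of_add_eq_zero_left ((uniqueDiffWithinAt_unitIcc hs).eq_deriv _
    ((hc.hasCovDerivAtE_fromOrigin hs ht u).inner (hc.hasCovDerivAtE_fromOrigin hs ht v) hs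
      (hc.mdifferentiableWithinAt_left hs ht)) hconst)

theorem SmoothSquare.hasDerivWithinAt_toOrigin {Q : ℝ → E} {q : E}
    (hQ : HasCovDerivAtE g (fun a => c a t) Q q s) :
    HasDerivWithinAt (fun σ => toOrigin g c σ t (Q σ)) (toOrigin g c s t q -
      toOrigin g c s t (covFromOrigin g c (toOrigin g c s t (Q s)) s t)) (Icc 0 1) s := by
  refine hasDerivWithinAt_of_innerE (g := g) (p := c 0 0) fun u => ?_
  rw [map_sub, sub_apply, hc.innerE_toOrigin_left hs ht, hc.innerE_toOrigin_left hs ht,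
    hc.innerE_covFromOrigin hs ht, hc.fromOrigin_toOrigin_self hs ht, sub_neg_eq_add]
  exact (hQ.inner (hc.hasCovDerivAtE_fromOrigin hs ht u) hs
    (hc.mdifferentiableWithinAt_left hs ht)).congr_of_mem
      (fun σ hσ => hc.innerE_toOrigin_left hσ ht _ _) hs

theorem SmoothSquare.integral_curvatureE_fromOrigin (u : E) :
    ∫ τ in (0 : ℝ)..t, transportE g (c s) τ 0 (curvatureE g (c s τ) (velocityE (c s) τ)
      (velocityE (fun a => c a τ) s) (fromOrigin g c s τ u)) =
      transportE g (c s) t 0 (covFromOrigin g c u s t) := by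
  rw [integral_transportE_of_hasCovDerivAtE (hc.contMDiffOn_right hs) ht
    (fun τ hτ => hc.hasCovDerivAtE_covFromOrigin hs hτ u)
    (fun τ hτ => hc.continuousWithinAt_curvatureE_fromOrigin hs hτ u),
    hc.covFromOrigin_zero hs, sub_zero]

end

/-! ### Raising, holonomy and speed of a path of immersions -/

section

variable {E : Type*} [NormedAddCommGroup E] [NormedSpace ℝ E] [FiniteDimensional ℝ E]
  {M : Type*} [TopologicalSpace M] [ChartedSpace E M] [IsManifold 𝓘(ℝ, E) ∞ M]
  {g : RMetric E M} {c : ℝ → ℝ → M}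

theorem integral_congr_unitIcc {f f' : ℝ → ℝ} (h : ∀ t ∈ Icc (0 : ℝ) 1, f t = f' t) :
    ∫ t in (0 : ℝ)..1, f t = ∫ t in (0 : ℝ)..1, f' t :=
  intervalIntegral.integral_congr fun t ht => h t (by rwa [uIcc_of_le zero_le_one] at ht)

namespace SmoothSquare

section Point

variable (hc : SmoothSquare E c) {s t : ℝ} (hs : s ∈ Icc (0 : ℝ) 1) (ht : t ∈ Icc (0 : ℝ) 1)

include hc hs

theorem curvatureIntegrand_eq (ht : t ∈ Icc (0 : ℝ) 1) {τ : ℝ} (hτ : τ ∈ Icc (0 : ℝ) 1) :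
    curvatureIntegrand (E := E) g c s t τ =
      transportE g (c s) τ 0 (curvatureE g (c s τ) (velocityE (c s) τ)
        (velocityE (fun a => c a τ) s)
        (fromOrigin g c s τ (toOrigin g c s t (srvfE g (c s) t)))) := by
  rw [hc.fromOrigin_toOrigin hs ht hτ]
  rfl

theorem omegaField_eq_fromOrigin {a : ℝ} (ha : a ∈ Icc (0 : ℝ) 1) :
    omegaField (E := E) g c s t a t =
      fromOrigin g c a t (toOrigin g c s t (srvfE g (c s) t)) := by
  rw [fromOrigin, toOrigin, transportE_transportE (hc.contMDiffOn_left (by simp)) hs (by simp) ha]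
  rfl

include ht

theorem intervalIntegrable_curvatureIntegrand :
    IntervalIntegrable (curvatureIntegrand (E := E) g c s t) volume 0 t := by
  have hsub : Icc 0 t ⊆ Icc (0 : ℝ) 1 := Icc_subset_Icc_right ht.2
  refine ContinuousOn.intervalIntegrable_of_Icc ht.1 fun τ hτ => ?_
  refine ContinuousWithinAt.congr_of_mem ?_
    (fun σ hσ => hc.curvatureIntegrand_eq hs ht (hsub hσ)) hτ
  exact (continuousWithinAt_transportE (hc.contMDiffOn_right hs) (left_mem_Icc.2 zero_le_one)
    (hsub hτ) (hc.continuousWithinAt_curvatureE_fromOrigin hs (hsub hτ) _)).mono hsub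

theorem integral_curvatureIntegrand :
    ∫ τ in (0 : ℝ)..t, curvatureIntegrand (E := E) g c s t τ =
      transportE g (c s) t 0
        (covFromOrigin g c (toOrigin g c s t (srvfE g (c s) t)) s t) := by
  rw [← hc.integral_curvatureE_fromOrigin hs ht]
  refine intervalIntegral.integral_congr fun τ hτ => hc.curvatureIntegrand_eq hs ht ?_
  rw [uIcc_of_le ht.1] at hτ
  exact Icc_subset_Icc_right ht.2 hτ

theorem hasCovDerivAtE_omegaField :
    HasCovDerivAtE g (fun a => c a t) (fun a => omegaField (E := E) g c s t a t)
      (covFromOrigin g c (toOrigin g c s t (srvfE g (c s) t)) s t) s := by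
  refine (hc.hasCovDerivAtE_fromOrigin hs ht (toOrigin g c s t (srvfE g (c s) t))).congr hs ?_
  filter_upwards [self_mem_nhdsWithin] with a ha
  exact (hc.omegaField_eq_fromOrigin hs ha).symm

theorem holonomy_eq_toOrigin :
    holonomy (E := E) g c s t =
      toOrigin g c s t (covFromOrigin g c (toOrigin g c s t (srvfE g (c s) t)) s t) :=
  congrArg (toOrigin g c s t) (hc.hasCovDerivAtE_omegaField hs ht).2

theorem holonomy_eq_transport_integral :
    holonomy (E := E) g c s t = transport (E := E) g (fun σ => c σ 0) s 0
      (∫ τ in (0 : ℝ)..t, curvatureIntegrand (E := E) g c s t τ : E) :=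
  (hc.holonomy_eq_toOrigin hs ht).trans <|
    congrArg (transportE g (fun σ => c σ 0) s 0) (hc.integral_curvatureIntegrand hs ht).symm

variable (h₀ : (velocityE (c s) t : E) ≠ 0)

include h₀

theorem hasDerivWithinAt_raising :
    HasDerivWithinAt (F := E) (fun σ => raising (E := E) g c σ t)
      (toOrigin g c s t (covSrvfE g c (s, t)) -
        toOrigin g c s t (covFromOrigin g c (toOrigin g c s t (srvfE g (c s) t)) s t))
      (Icc 0 1) s :=
  hc.hasDerivWithinAt_toOrigin hs ht (hc.hasCovDerivAtE_srvfE g hs ht h₀)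

theorem raisingS_add_holonomy :
    raisingS (E := E) g c s t + holonomy (E := E) g c s t =
      toOrigin g c s t (covSrvfE g c (s, t)) := by
  have hderiv : raisingS (E := E) g c s t = _ :=
    (hc.hasDerivWithinAt_raising hs ht h₀).derivWithin (uniqueDiffWithinAt_unitIcc hs)
  rw [hderiv, hc.holonomy_eq_toOrigin hs ht]
  exact sub_add_cancel _ _

theorem gnorm_raisingS_add_holonomy :
    gnorm (E := E) g (raisingS g c s t + holonomy g c s t) =
      gnorm (E := E) g (covSrvf g c s t) := by
  rw [hc.raisingS_add_holonomy hs ht h₀]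
  exact congrArg Real.sqrt (hc.innerE_toOrigin hs ht _ _)

end Point

section Immersed

variable (hc : SmoothSquare E c)
  (himm : ∀ s ∈ Icc (0 : ℝ) 1, ∀ t ∈ Icc (0 : ℝ) 1, (velocityE (c s) t : E) ≠ 0) {s : ℝ}

include hc himm

theorem sqrt_sobolevMetric_derivS (hs : s ∈ Icc (0 : ℝ) 1) :
    √(sobolevMetric (E := E) g (c s) (derivS c s) (derivS c s)) = speedSrvf (E := E) g c s :=
  congrArg Real.sqrt <| congrArg₂ (· + ·) (normE_sq g _ _).symm <|
    integral_congr_unitIcc fun t ht => hc.sobolevIntegrand_derivS g hs ht (himm s hs t ht)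

theorem speedRaising_eq_speedSrvf (hs : s ∈ Icc (0 : ℝ) 1) :
    speedRaising (E := E) g c s = speedSrvf (E := E) g c s :=
  congrArg (fun I => √(_ + I)) <| integral_congr_unitIcc fun t ht =>
    congrArg (· ^ 2) (hc.gnorm_raisingS_add_holonomy hs ht (himm s hs t ht))

theorem intervalIntegrable_gnorm_covSrvf_sq (hs : s ∈ Icc (0 : ℝ) 1) :
    IntervalIntegrable (fun t => gnorm (E := E) g (covSrvf g c s t) ^ 2) volume 0 1 :=
  intervalIntegrable_of_unitSquare (hc.continuousOn_normE_covSrvfE_sq g himm) hs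

theorem intervalIntegrable_speedSrvf :
    IntervalIntegrable (speedSrvf (E := E) g c) volume 0 1 := by
  have hS : ContinuousOn (fun s => normE g (c s 0) (velocityE (fun σ => c σ 0) s)) (Icc 0 1) := by
    have h : ContinuousOn (fun z : ℝ × ℝ =>
        normE g (c z.1 z.2) (velocityE (fun σ => c σ z.2) z.1)) unitSquare := fun z hz =>
      ((hc.continuousFieldE_velocityS hz).innerE (hc.continuousFieldE_velocityS hz) hc g hz).sqrt
    exact h.comp (f := fun s : ℝ => (s, 0)) (by fun_prop) fun s hs => ⟨hs, by simp⟩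
  exact ContinuousOn.intervalIntegrable_of_Icc zero_le_one ((hS.pow 2).add
    (continuousOn_integral_unitSquare (hc.continuousOn_normE_covSrvfE_sq g himm))).sqrt

theorem wellDefined : WellDefined (E := E) g c where
  transport_curve s hs := hasTransport g (hc.contMDiffOn_right hs)
  transport_origin := hasTransport g (hc.contMDiffOn_left (by simp))
  derivS_diff s hs t ht := (hc.hasCovDerivAtE_velocityS g hs ht).1
  srvf_diff s hs t ht := (hc.hasCovDerivAtE_srvfE g hs ht (himm s hs t ht)).1
  raising_diff s hs t ht :=
    (hc.hasDerivWithinAt_raising hs ht (himm s hs t ht)).differentiableWithinAt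
  omega_diff s hs t ht := (hc.hasCovDerivAtE_omegaField hs ht).1
  sobolev_int s hs := intervalIntegrable_congr_Icc
    (fun t ht => (hc.sobolevIntegrand_derivS g hs ht (himm s hs t ht)).symm)
    (hc.intervalIntegrable_gnorm_covSrvf_sq himm hs)
  length_int := intervalIntegrable_congr_Icc
    (fun s hs => (hc.sqrt_sobolevMetric_derivS himm hs).symm)
    (hc.intervalIntegrable_speedSrvf himm)
  srvf_int s hs := hc.intervalIntegrable_gnorm_covSrvf_sq himm hs
  raising_int s hs := intervalIntegrable_congr_Icc
    (fun t ht => congrArg (· ^ 2) (hc.gnorm_raisingS_add_holonomy hs ht (himm s hs t ht)).symm)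
    (hc.intervalIntegrable_gnorm_covSrvf_sq himm hs)
  curvature_int s hs t ht := hc.intervalIntegrable_curvatureIntegrand hs ht
  speedSrvf_int := hc.intervalIntegrable_speedSrvf himm
  speedRaising_int := intervalIntegrable_congr_Icc
    (fun s hs => (hc.speedRaising_eq_speedSrvf himm hs).symm)
    (hc.intervalIntegrable_speedSrvf himm)

theorem pathLength_eq_integral_speedSrvf :
    pathLength (E := E) g c = ∫ s in (0 : ℝ)..1, speedSrvf (E := E) g c s :=
  integral_congr_unitIcc fun _ hs => hc.sqrt_sobolevMetric_derivS himm hs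

theorem pathLength_eq_integral_speedRaising :
    pathLength (E := E) g c = ∫ s in (0 : ℝ)..1, speedRaising (E := E) g c s :=
  integral_congr_unitIcc fun _ hs => (hc.sqrt_sobolevMetric_derivS himm hs).trans
    (hc.speedRaising_eq_speedSrvf himm hs).symm

end Immersed

end SmoothSquare

end

end CurveSpace

end

open CurveSpace in
theorem proposition3_general
    {E : Type*} [NormedAddCommGroup E] [NormedSpace ℝ E] [FiniteDimensional ℝ E]
    {M : Type*} [TopologicalSpace M] [ChartedSpace E M] [IsManifold 𝓘(ℝ, E) ∞ M]
    (g : RMetric E M) (c₀ c₁ : ℝ → M) :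
    geodesicDist g c₀ c₁ =
        ⨅ (c : ℝ → ℝ → M) (_ : IsPath (E := E) c₀ c₁ c),
          ENNReal.ofReal (∫ s in (0 : ℝ)..1,
            √(gnorm g (derivS c s 0) ^ 2 + ∫ t in (0 : ℝ)..1, gnorm g (covSrvf g c s t) ^ 2)) ∧
      geodesicDist g c₀ c₁ =
        ⨅ (c : ℝ → ℝ → M) (_ : IsPath (E := E) c₀ c₁ c),
          ENNReal.ofReal (∫ s in (0 : ℝ)..1,
            √(gnorm g (derivS c s 0) ^ 2 +
              ∫ t in (0 : ℝ)..1, gnorm g (raisingS g c s t + holonomy g c s t) ^ 2)) ∧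
      ∀ c : ℝ → ℝ → M, IsPath (E := E) c₀ c₁ c →
        WellDefined g c ∧
          ∀ s ∈ Icc (0 : ℝ) 1, ∀ t ∈ Icc (0 : ℝ) 1,
            holonomy g c s t =
              transport g (fun σ => c σ 0) s 0
                (∫ τ in (0 : ℝ)..t, curvatureIntegrand g c s t τ : E) := by
  have hsq (c) (hP : IsPath (E := E) c₀ c₁ c) : SmoothSquare E c := hP.smooth
  have himm (c) (hP : IsPath (E := E) c₀ c₁ c) :
      ∀ s ∈ Icc (0 : ℝ) 1, ∀ t ∈ Icc (0 : ℝ) 1, (velocityE (c s) t : E) ≠ 0 :=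
    fun s hs => (hP.imm s hs).2
  refine ⟨?_, ?_, fun c hP => ⟨(hsq c hP).wellDefined (himm c hP), fun s hs t ht =>
    (hsq c hP).holonomy_eq_transport_integral hs ht⟩⟩
  · exact iInf_congr fun c => iInf_congr fun hP => congrArg ENNReal.ofReal
      ((hsq c hP).pathLength_eq_integral_speedSrvf (himm c hP))
  · exact iInf_congr fun c => iInf_congr fun hP => congrArg ENNReal.ofReal
      ((hsq c hP).pathLength_eq_integral_speedRaising (himm c hP))

open CurveSpace in
theorem proposition3
    {E : Type*} [NormedAddCommGroup E] [NormedSpace ℝ E] [FiniteDimensional ℝ E]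
    {M : Type*} [TopologicalSpace M] [T2Space M] [ChartedSpace E M] [IsManifold 𝓘(ℝ, E) ∞ M]
    (g : Bundle.ContMDiffRiemannianMetric 𝓘(ℝ, E) ∞ E (fun x : M => TangentSpace 𝓘(ℝ, E) x))
    (c₀ c₁ : ℝ → M) (hc₀ : IsImm (E := E) c₀) (hc₁ : IsImm (E := E) c₁) :
    geodesicDist g c₀ c₁ =
        ⨅ (c : ℝ → ℝ → M) (_ : IsPath (E := E) c₀ c₁ c),
          ENNReal.ofReal (∫ s in (0 : ℝ)..1,
            √(gnorm g (derivS c s 0) ^ 2 + ∫ t in (0 : ℝ)..1, gnorm g (covSrvf g c s t) ^ 2)) ∧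
      geodesicDist g c₀ c₁ =
        ⨅ (c : ℝ → ℝ → M) (_ : IsPath (E := E) c₀ c₁ c),
          ENNReal.ofReal (∫ s in (0 : ℝ)..1,
            √(gnorm g (derivS c s 0) ^ 2 +
              ∫ t in (0 : ℝ)..1, gnorm g (raisingS g c s t + holonomy g c s t) ^ 2)) ∧
      ∀ c : ℝ → ℝ → M, IsPath (E := E) c₀ c₁ c →
        WellDefined g c ∧
          ∀ s ∈ Icc (0 : ℝ) 1, ∀ t ∈ Icc (0 : ℝ) 1,
            holonomy g c s t =
              transport g (fun σ => c σ 0) s 0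
                (∫ τ in (0 : ℝ)..t, curvatureIntegrand g c s t τ : E) :=
  proposition3_general g c₀ c₁
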